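/- Let $k\ge 0$ be an integer, $\alpha>1$, and let $(X_t)_{t\in\mathbb Z}$ be a strictly stationary sequence of real random variables which is $k$-dependent, i.e. $\sigma(X_t,\,t\le 0)$ and $\sigma(X_t,\,t\ge k+1)$ are independent, has mean zero, $\mathbb E X_0=0$, and is regularly varying with index $\alpha$: for every $n\ge 1$ the vector $V=(X_1,\dots,X_n)$ satisfies, for some probability measure $\sigma_n$ on the Euclidean unit sphere of $\mathbb R^n$ and all $u>0$, $\mathbb P(|V|>ux,\ V/|V|\in\cdot)/\mathbb P(|V|>x)\to u^{-\alpha}\sigma_n(\cdot)$ weakly as $x\to\infty$. Let $(Y_t)_{t\in\mathbb Z}$ be the tail process of $(X_t)$, i.e. a real process with $\mathbb P(|Y_0|>y)=y^{-\alpha}$ for $y>1$ such that, for every $m\ge 0$, the conditional law of $x^{-1}(X_{-m},\dots,X_m)$ given $|X_0|>x$ converges weakly to the law of $(Y_{-m},\dots,Y_m)$ as $x\to\infty$, and let $\Theta_t=Y_t/|Y_0|$ be the spectral tail process. Put $$\lambda_k=\mathbb P(\Theta_{-j}=0,\ j=1,\dots,k).$$ Then $\lambda_k>0$. Let $(\widetilde\Theta_0,\dots,\widetilde\Theta_k)$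 have the conditional law of $(\Theta_0,\dots,\Theta_k)$ given $\Theta_{-j}=0$ for $j=1,\dots,k$, and let $S_0=0$, $S_t=X_1+\cdots+X_t$ for $t\ge 1$. Then $\mathbb E\big[\big(\sup_{0\le t\le k}\sum_{i=0}^t\widetilde\Theta_i\big)_+^\alpha\big]<\infty$, and for every $\rho>0$, $$\lim_{x\to\infty}\frac{\mathbb P\big(\sup_{t\ge 0}(S_t-\rho t)>x\big)}{x\,\mathbb P(|X_0|>x)}=\frac{\lambda_k}{(\alpha-1)\rho}\ \mathbb E\Big[\Big(\sup_{0\le t\le k}\ \sum_{i=0}^t\widetilde\Theta_i\Big)_+^\alpha\Big].$$ -/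

import Mathlib

open MeasureTheory ProbabilityTheory Filter Topology

noncomputable section

namespace RuinProb

/-- Weak convergence of finite measures: the integrals of all bounded continuous functions
converge. -/
def WeaklyTendsto {ι E : Type*} [TopologicalSpace E] [MeasurableSpace E]
    (m : ι → Measure E) (l : Filter ι) (m₀ : Measure E) : Prop :=
  ∀ f : BoundedContinuousFunction E ℝ,
    Tendsto (fun i => ∫ v, f v ∂(m i)) l (𝓝 (∫ v, f v ∂m₀))

/-- A random vector `V` in `ℝ^d` is regularly varying with index `α > 0`: for some probability
measure `σ` on the Euclidean unit sphere (the spectral measure) and every `u > 0`,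
`P(|V| > u x, V/|V| ∈ ·) / P(|V| > x)` converges weakly to `u^{-α} σ` as `x → ∞`. -/
def IsRegularlyVaryingVec {Ω : Type*} [MeasurableSpace Ω] (P : Measure Ω) {d : ℕ}
    (V : Ω → EuclideanSpace ℝ (Fin d)) (α : ℝ) : Prop :=
  0 < α ∧ ∃ σ : Measure (EuclideanSpace ℝ (Fin d)),
    IsProbabilityMeasure σ ∧ (∀ᵐ v ∂σ, ‖v‖ = 1) ∧
    ∀ u : ℝ, 0 < u →
      WeaklyTendsto
        (fun x : ℝ => (P {ω | x < ‖V ω‖})⁻¹ •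
          (P.restrict {ω | u * x < ‖V ω‖}).map (fun ω => ‖V ω‖⁻¹ • V ω))
        atTop (ENNReal.ofReal (u ^ (-α)) • σ)

/-- The real-valued process `(X_t)` is regularly varying with index `α`: each lagged vector
`(X_1, …, X_n)`, `n ≥ 1`, is. -/
def IsRegularlyVarying {Ω : Type*} [MeasurableSpace Ω] (P : Measure Ω)
    (X : ℤ → Ω → ℝ) (α : ℝ) : Prop :=
  ∀ n : ℕ, 1 ≤ n →
    IsRegularlyVaryingVec P
      (fun ω => WithLp.toLp 2 (fun i : Fin n => X ((i : ℕ) + 1 : ℤ) ω)) α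

/-- Strict stationarity: the law of the whole process is invariant under all time shifts. -/
def IsStrictlyStationary {Ω : Type*} [MeasurableSpace Ω] (P : Measure Ω)
    (X : ℤ → Ω → ℝ) : Prop :=
  ∀ h : ℤ, P.map (fun ω (t : ℤ) => X (t + h) ω) = P.map (fun ω (t : ℤ) => X t ω)

/-- `k`-dependence (of a stationary process): `σ(X_t, t ≤ 0)` and `σ(X_t, t ≥ k + 1)` are
independent. -/
def IsKDependent {Ω : Type*} [MeasurableSpace Ω] (P : Measure Ω)
    (X : ℤ → Ω → ℝ) (k : ℕ) : Prop :=
  Indep (⨆ t : {t : ℤ // t ≤ 0}, MeasurableSpace.comap (X t) inferInstance)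
    (⨆ t : {t : ℤ // (k : ℤ) + 1 ≤ t}, MeasurableSpace.comap (X t) inferInstance) P

/-- `(Y_t)`, defined on a probability space with probability `Q`, is a tail process of `(X_t)`:
`Q(|Y_0| > y) = y^{-α}` for `y > 1`, and for each `m ≥ 0` the conditional law of
`x⁻¹ (X_{-m}, …, X_m)` given `|X_0| > x` converges weakly to the law of `(Y_{-m}, …, Y_m)` as
`x → ∞`. -/
structure IsTailProcess {Ω Ω' : Type*} [MeasurableSpace Ω] [MeasurableSpace Ω']
    (P : Measure Ω) (X : ℤ → Ω → ℝ) (α : ℝ) (Q : Measure Ω') (Y : ℤ → Ω' → ℝ) : Prop where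
  measurable : ∀ t, Measurable (Y t)
  pareto : ∀ y : ℝ, 1 < y → Q {ω | y < |Y 0 ω|} = ENNReal.ofReal (y ^ (-α))
  tendsto : ∀ m : ℕ,
    WeaklyTendsto
      (fun x : ℝ => (cond P {ω | x < |X 0 ω|}).map
        (fun ω (t : Set.Icc (-(m : ℤ)) (m : ℤ)) => x⁻¹ * X t ω))
      atTop (Q.map (fun ω (t : Set.Icc (-(m : ℤ)) (m : ℤ)) => Y t ω))

/-- The spectral tail process `Θ_t = Y_t / |Y_0|`. -/
def spectralTail {Ω' : Type*} (Y : ℤ → Ω' → ℝ) (t : ℤ) (ω : Ω') : ℝ :=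
  Y t ω / |Y 0 ω|

/-- The event `{Θ_{-j} = 0 for j = 1, …, k}`. -/
def zeroPast {Ω' : Type*} (Y : ℤ → Ω' → ℝ) (k : ℕ) : Set Ω' :=
  {ω | ∀ j : ℕ, 1 ≤ j → j ≤ k → spectralTail Y (-(j : ℤ)) ω = 0}

/-- `λ_k = Q(Θ_{-j} = 0, j = 1, …, k)`. -/
def lam {Ω' : Type*} [MeasurableSpace Ω'] (Q : Measure Ω') (Y : ℤ → Ω' → ℝ) (k : ℕ) : ℝ :=
  Q.real (zeroPast Y k)

/-- The law of `(Θ̃_0, …, Θ̃_k)`: the conditional law of `(Θ_0, …, Θ_k)` given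
`Θ_{-j} = 0` for `j = 1, …, k`. -/
def tildeLaw {Ω' : Type*} [MeasurableSpace Ω'] (Q : Measure Ω') (Y : ℤ → Ω' → ℝ) (k : ℕ) :
    Measure (Fin (k + 1) → ℝ) :=
  (cond Q (zeroPast Y k)).map (fun ω (j : Fin (k + 1)) => spectralTail Y ((j : ℕ) : ℤ) ω)

/-- `(max_{0 ≤ t ≤ k} ∑_{i=0}^t θ_i)_+^α`. -/
def supPosPow (α : ℝ) {k : ℕ} (θ : Fin (k + 1) → ℝ) : ℝ :=
  (max (⨆ t : Fin (k + 1), ∑ i ∈ Finset.Iic t, θ i) 0) ^ α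

/-- The random walk `S_t = X_1 + … + X_t`, `S_0 = 0`. -/
def walk {Ω : Type*} (X : ℤ → Ω → ℝ) (t : ℕ) (ω : Ω) : ℝ :=
  ∑ i ∈ Finset.Icc 1 t, X (i : ℤ) ω

/-- The ruin probability `P(sup_{t ≥ 0} (S_t - ρ t) > x)`; the supremum is taken in the extended
reals. -/
def ruinProb {Ω : Type*} [MeasurableSpace Ω] (P : Measure Ω) (X : ℤ → Ω → ℝ) (ρ x : ℝ) : ℝ :=
  P.real {ω | (x : EReal) < ⨆ t : ℕ, ((walk X t ω - ρ * t : ℝ) : EReal)}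

end RuinProb

end

noncomputable section

namespace RuinProb

/-! The principle is that of a single big jump, spread over at most k+1 consecutive times. Write
F(x) = P(|X_0| > x), fix a small δ and a large K, and call |X_i| > δx an exceedance. Three effects
are negligible against xF(x). Sums of variables truncated at δx stay below ηx up to time Kx outside
an event of probability x^{-α}; this is a Chernoff bound on the residue classes modulo k+1, inside
which the variables are independent (`truncated_sum_bound`). Ruin after time Kx costs at most C
K^{1-α} xF(x), by summing the same estimate over dyadic blocks (`exists_late_bound`). Two
exceedances more than k apart cost at most (KxF(δx))².

Hence ruin essentially means that some i ≤ Kx carries an exceedance preceded by k times without one,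
and that the partial sums of the k+1 values starting at i reach about x + ρi (`ruinProb_le`,
`le_ruinProb`). By stationarity each such event can be moved to time 0; summing over i then counts
the i with ρi < maximal sum - x. The result is x times the expectation of (maximal sum/x - 1)_+/ρ,
capped at K, on the event that time 0 is a first exceedance.

After division by F(x) this expectation converges to an integral over z > δ against law(Θ) ⊗
αz^{-α-1}dz, because the tail process splits into independent polar parts (`map_polar`). As δ → 0
the demand that the past stay below δ turns into Θ_{-j} = 0 (`tendsto_cutoff`), and without the cap
the radial integral ∫(zH-1)_+ αz^{-α-1}dz = H_+^α/(α-1) gives the constant. Domination throughout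
rests on {z|θ_t| > c} having finite limit measure for every t in the window, a consequence of
stationarity (`polarMeasure_lt_mul_abs`); the same fact gives the finite moment. Finally λ_k > 0
since, up to negligible events, every exceedance has a first exceedance at most k steps earlier
(`lam_pos`). -/

/-- A positive nonincreasing function which is regularly varying at infinity with index `-α`. -/
structure RegVar (F : ℝ → ℝ) (α : ℝ) : Prop where
  antitone : Antitone F
  pos : ∀ x, 0 < F x
  tendsto : ∀ u : ℝ, 0 < u → Tendsto (fun x => F (u * x) / F x) atTop (𝓝 (u ^ (-α)))

/-! ### Potter-type bounds by doubling -/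

namespace RegVar

variable {F : ℝ → ℝ} {α : ℝ}

theorem exists_doubling_le (h : RegVar F α) {β : ℝ} (hβ : β < α) :
    ∃ x₀ : ℝ, 1 ≤ x₀ ∧ ∀ x, x₀ ≤ x → F (2 * x) ≤ (2 : ℝ) ^ (-β) * F x := by
  have h2 : (2 : ℝ) ^ (-α) < (2 : ℝ) ^ (-β) :=
    Real.rpow_lt_rpow_of_exponent_lt (by norm_num) (by linarith)
  obtain ⟨x₀, hx₀⟩ := eventually_atTop.1 ((h.tendsto 2 two_pos).eventually (gt_mem_nhds h2))
  refine ⟨max x₀ 1, le_max_right _ _, fun x hx => ?_⟩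
  have := hx₀ x (le_trans (le_max_left _ _) hx)
  exact (div_le_iff₀ (h.pos x)).1 this.le

theorem exists_le_doubling (h : RegVar F α) {β : ℝ} (hβ : α < β) :
    ∃ x₀ : ℝ, 1 ≤ x₀ ∧ ∀ x, x₀ ≤ x → (2 : ℝ) ^ (-β) * F x ≤ F (2 * x) := by
  have h2 : (2 : ℝ) ^ (-β) < (2 : ℝ) ^ (-α) :=
    Real.rpow_lt_rpow_of_exponent_lt (by norm_num) (by linarith)
  obtain ⟨x₀, hx₀⟩ := eventually_atTop.1 ((h.tendsto 2 two_pos).eventually (lt_mem_nhds h2))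
  refine ⟨max x₀ 1, le_max_right _ _, fun x hx => ?_⟩
  have := hx₀ x (le_trans (le_max_left _ _) hx)
  exact (le_div_iff₀ (h.pos x)).1 this.le

theorem doubling_iterate {β x₀ : ℝ} (hx₀ : 1 ≤ x₀)
    (h : ∀ x, x₀ ≤ x → F (2 * x) ≤ (2 : ℝ) ^ (-β) * F x) (m : ℕ) :
    ∀ x, x₀ ≤ x → F (2 ^ m * x) ≤ ((2 : ℝ) ^ (-β)) ^ m * F x := by
  induction m with
  | zero => intro x _; simp
  | succ m ih =>
    intro x hx
    have h1 : x₀ ≤ 2 ^ m * x := by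
      have : (1 : ℝ) ≤ 2 ^ m := one_le_pow₀ (by norm_num)
      nlinarith
    calc F (2 ^ (m + 1) * x) = F (2 * (2 ^ m * x)) := by ring_nf
      _ ≤ (2 : ℝ) ^ (-β) * F (2 ^ m * x) := h _ h1
      _ ≤ (2 : ℝ) ^ (-β) * (((2 : ℝ) ^ (-β)) ^ m * F x) := by gcongr; exact ih x hx
      _ = _ := by ring

theorem le_doubling_iterate {β x₀ : ℝ} (hx₀ : 1 ≤ x₀)
    (h : ∀ x, x₀ ≤ x → (2 : ℝ) ^ (-β) * F x ≤ F (2 * x)) (m : ℕ) :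
    ∀ x, x₀ ≤ x → ((2 : ℝ) ^ (-β)) ^ m * F x ≤ F (2 ^ m * x) := by
  induction m with
  | zero => intro x _; simp
  | succ m ih =>
    intro x hx
    have h1 : x₀ ≤ 2 ^ m * x := by
      have : (1 : ℝ) ≤ 2 ^ m := one_le_pow₀ (by norm_num)
      nlinarith
    calc ((2 : ℝ) ^ (-β)) ^ (m + 1) * F x = (2 : ℝ) ^ (-β) * (((2 : ℝ) ^ (-β)) ^ m * F x) := by ring
      _ ≤ (2 : ℝ) ^ (-β) * F (2 ^ m * x) := by gcongr; exact ih x hx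
      _ ≤ F (2 * (2 ^ m * x)) := h _ h1
      _ = _ := by ring_nf

/-- The doubling inequality is iterated from a fixed x₀, and monotonicity fills in between
consecutive dyadic points, so no uniform convergence theorem for regular variation is needed. -/
theorem exists_le_rpow (h : RegVar F α) {β : ℝ} (hβ0 : 0 < β) (hβ : β < α) :
    ∃ C : ℝ, 0 < C ∧ ∃ x₀ : ℝ, 1 ≤ x₀ ∧ ∀ x, x₀ ≤ x → F x ≤ C * x ^ (-β) := by
  obtain ⟨x₀, hx₀, hd⟩ := h.exists_doubling_le hβ
  have hx0 : 0 < x₀ := by linarith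
  -- The dyadic point 2^m x₀ below x may miss it by a factor of up to 2, hence 2x₀ in the constant.
  refine ⟨(2 * x₀) ^ β * F x₀, mul_pos (by positivity) (h.pos _), x₀, hx₀, fun x hx => ?_⟩
  obtain ⟨m, hm1, hm2⟩ := exists_nat_pow_near (x := x / x₀) (y := 2)
    ((one_le_div hx0).2 hx) (by norm_num)
  have hxp : 0 < x := by linarith
  have h1 : F x ≤ F (2 ^ m * x₀) := h.antitone ((le_div_iff₀ hx0).1 hm1)
  have h2 := doubling_iterate hx₀ hd m x₀ le_rfl
  have h3 : ((2 : ℝ) ^ (-β)) ^ m ≤ (2 * x₀) ^ β * x ^ (-β) := by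
    have e1 : ((2 : ℝ) ^ (-β)) ^ m = ((2 : ℝ) ^ m) ^ (-β) := by
      rw [← Real.rpow_natCast, ← Real.rpow_natCast, ← Real.rpow_mul (by norm_num),
        ← Real.rpow_mul (by norm_num), mul_comm]
    have e2 : (2 * x₀) ^ β * x ^ (-β) = (x / (2 * x₀)) ^ (-β) := by
      rw [Real.div_rpow hxp.le (by positivity), Real.rpow_neg (by positivity : (0:ℝ) ≤ 2 * x₀)]
      rw [div_eq_mul_inv, inv_inv, mul_comm]
    rw [e1, e2]
    apply Real.rpow_le_rpow_of_nonpos (by positivity) _ (by linarith)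
    rw [div_le_iff₀ (by positivity)]
    have := (div_lt_iff₀ hx0).1 hm2
    rw [pow_succ] at this
    nlinarith
  calc F x ≤ ((2 : ℝ) ^ (-β)) ^ m * F x₀ := h1.trans h2
    _ ≤ ((2 * x₀) ^ β * x ^ (-β)) * F x₀ := by
      have := (h.pos x₀).le
      gcongr
    _ = _ := by ring

theorem exists_rpow_le (h : RegVar F α) {β : ℝ} (hβ0 : 0 < β) (hβ : α < β) :
    ∃ C : ℝ, 0 < C ∧ ∃ x₀ : ℝ, 1 ≤ x₀ ∧ ∀ x, x₀ ≤ x → C * x ^ (-β) ≤ F x := by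
  obtain ⟨x₀, hx₀, hd⟩ := h.exists_le_doubling hβ
  have hx0 : 0 < x₀ := by linarith
  refine ⟨(2 / x₀) ^ (-β) * F x₀, mul_pos (by positivity) (h.pos _), x₀, hx₀, fun x hx => ?_⟩
  obtain ⟨m, hm1, hm2⟩ := exists_nat_pow_near (x := x / x₀) (y := 2)
    ((one_le_div hx0).2 hx) (by norm_num)
  have hxp : 0 < x := by linarith
  have h1 : F (2 ^ (m + 1) * x₀) ≤ F x := h.antitone ((div_lt_iff₀ hx0).1 hm2).le
  have h2 := le_doubling_iterate hx₀ hd (m + 1) x₀ le_rfl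
  have h3 : (2 / x₀) ^ (-β) * x ^ (-β) ≤ ((2 : ℝ) ^ (-β)) ^ (m + 1) := by
    have e1 : ((2 : ℝ) ^ (-β)) ^ (m + 1) = ((2 : ℝ) ^ (m + 1)) ^ (-β) := by
      rw [← Real.rpow_natCast, ← Real.rpow_natCast, ← Real.rpow_mul (by norm_num),
        ← Real.rpow_mul (by norm_num), mul_comm]
    rw [e1, ← Real.mul_rpow (by positivity) hxp.le]
    apply Real.rpow_le_rpow_of_nonpos (by positivity) _ (by linarith)
    rw [pow_succ]
    calc (2 : ℝ) ^ m * 2 ≤ x / x₀ * 2 := by gcongr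
      _ = _ := by ring
  calc (2 / x₀) ^ (-β) * F x₀ * x ^ (-β) = ((2 / x₀) ^ (-β) * x ^ (-β)) * F x₀ := by ring
    _ ≤ ((2 : ℝ) ^ (-β)) ^ (m + 1) * F x₀ := by
      have := (h.pos x₀).le
      gcongr
    _ ≤ F x := h2.trans h1

/-- An upper bound with exponent halfway between 1 and α beats the factor x. Consequently the
expected number of exceedances up to a time of order x vanishes. -/
theorem tendsto_id_mul (h : RegVar F α) (hα : 1 < α) (c : ℝ) (hc : 0 < c) :
    Tendsto (fun x => x * F (c * x)) atTop (𝓝 0) := by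
  obtain ⟨C, hC, x₀, hx₀, hle⟩ := h.exists_le_rpow (β := (1 + α) / 2) (by linarith) (by linarith)
  have hlim : Tendsto (fun x : ℝ => C * c ^ (-((1 + α) / 2)) * x ^ (-((α - 1) / 2))) atTop (𝓝 0) := by
    have := (tendsto_rpow_neg_atTop (y := (α - 1) / 2) (by linarith)).const_mul
      (C * c ^ (-((1 + α) / 2)))
    simpa using this
  refine squeeze_zero' ?_ ?_ hlim
  · filter_upwards [eventually_gt_atTop 0] with x hx
    exact mul_nonneg hx.le (h.pos _).le
  · filter_upwards [eventually_gt_atTop 0, eventually_ge_atTop (x₀ / c)] with x hx hx2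
    have h1 := hle (c * x) (by rw [mul_comm]; exact (div_le_iff₀ hc).1 hx2)
    have e : x * x ^ (-((1 + α) / 2)) = x ^ (-((α - 1) / 2)) := by
      nth_rewrite 1 [← Real.rpow_one x]
      rw [← Real.rpow_add hx]; congr 1; ring
    calc x * F (c * x) ≤ x * (C * (c * x) ^ (-((1 + α) / 2))) := by gcongr
      _ = C * c ^ (-((1 + α) / 2)) * (x * x ^ (-((1 + α) / 2))) := by
        rw [Real.mul_rpow hc.le hx.le]; ring
      _ = _ := by rw [e]

/-- xF(x) decays no faster than any power below 1-α. With γ = α this discards the Chernoff error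
terms. -/
theorem tendsto_rpow_neg_div (h : RegVar F α) (hα : 1 < α) {γ : ℝ} (hγ : α - 1 < γ) :
    Tendsto (fun x => x ^ (-γ) / (x * F x)) atTop (𝓝 0) := by
  obtain ⟨C, hC, x₀, hx₀, hle⟩ := h.exists_rpow_le (β := (1 + α + γ) / 2) (by linarith)
    (by linarith)
  have hlim : Tendsto (fun x : ℝ => C⁻¹ * x ^ (-((γ - (α - 1)) / 2))) atTop (𝓝 0) := by
    have := (tendsto_rpow_neg_atTop (y := (γ - (α - 1)) / 2) (by linarith)).const_mul C⁻¹
    simpa using this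
  refine squeeze_zero' ?_ ?_ hlim
  · filter_upwards [eventually_gt_atTop 0] with x hx
    have := h.pos x
    positivity
  · filter_upwards [eventually_gt_atTop 0, eventually_ge_atTop x₀] with x hx hx2
    have h1 := hle x hx2
    have hF := h.pos x
    rw [div_le_iff₀ (by positivity)]
    have e : x ^ (-γ) = C⁻¹ * x ^ (-((γ - (α - 1)) / 2)) * (x * (C * x ^ (-((1 + α + γ) / 2)))) := by
      have e2 : x ^ (-((γ - (α - 1)) / 2)) * (x * x ^ (-((1 + α + γ) / 2))) = x ^ (-γ) := by
        nth_rewrite 2 [← Real.rpow_one x]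
        rw [← Real.rpow_add hx, ← Real.rpow_add hx]; congr 1; ring
      rw [← e2]; field_simp
    rw [e]
    gcongr

end RegVar

/-! ### Tail and moments of the marginal law -/

/-- The tail function `x ↦ P(|Z| > x)`. -/
def absTail {Ω : Type*} [MeasurableSpace Ω] (P : Measure Ω) (Z : Ω → ℝ) (x : ℝ) : ℝ :=
  P.real {ω | x < |Z ω|}

/-- Layer-cake formula: the tail is bounded by 1 up to x₀, and beyond x₀ by a power with exponent
halfway between β and α, which leaves an integrable power of t. -/
theorem integrable_abs_rpow {Ω : Type*} [MeasurableSpace Ω] {P : Measure Ω}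
    [IsProbabilityMeasure P] {Z : Ω → ℝ} (hZ : Measurable Z) {α : ℝ}
    (h : RegVar (absTail P Z) α) {β : ℝ} (hβ0 : 0 < β) (hβ : β < α) :
    Integrable (fun ω => |Z ω| ^ β) P := by
  obtain ⟨C, hC, x₀, hx₀, hle⟩ := h.exists_le_rpow (β := (β + α) / 2) (by linarith) (by linarith)
  have hx0 : 0 < x₀ := by linarith
  have hm : Measurable (fun ω => |Z ω|) := hZ.abs
  refine ⟨(hm.pow_const β).aestronglyMeasurable, ?_⟩
  rw [hasFiniteIntegral_iff_ofReal (ae_of_all _ fun ω => by positivity)]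
  rw [lintegral_rpow_eq_lintegral_meas_lt_mul P (ae_of_all _ fun ω => abs_nonneg _)
    hm.aemeasurable hβ0]
  refine ENNReal.mul_lt_top ENNReal.ofReal_lt_top ?_
  rw [← Set.Ioc_union_Ioi_eq_Ioi hx0.le]
  refine (lintegral_union_le _ _ _).trans_lt (ENNReal.add_lt_top.2 ⟨?_, ?_⟩)
  · calc ∫⁻ t in Set.Ioc 0 x₀, P {a | t < |Z a|} * ENNReal.ofReal (t ^ (β - 1))
        ≤ ∫⁻ t in Set.Ioc 0 x₀, ENNReal.ofReal (t ^ (β - 1)) := by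
          refine lintegral_mono fun t => ?_
          calc _ ≤ 1 * ENNReal.ofReal (t ^ (β - 1)) := by gcongr; exact prob_le_one
            _ = _ := one_mul _
      _ < ⊤ := by
        have hi : IntegrableOn (fun t : ℝ => t ^ (β - 1)) (Set.Ioc 0 x₀) := by
          have := intervalIntegral.intervalIntegrable_rpow' (a := 0) (b := x₀) (r := β - 1)
            (by linarith)
          exact (intervalIntegrable_iff_integrableOn_Ioc_of_le hx0.le).1 this
        exact hi.lintegral_lt_top
  · calc ∫⁻ t in Set.Ioi x₀, P {a | t < |Z a|} * ENNReal.ofReal (t ^ (β - 1))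
        ≤ ∫⁻ t in Set.Ioi x₀, ENNReal.ofReal (C * t ^ (β - 1 - (β + α) / 2)) := by
          refine setLIntegral_mono' measurableSet_Ioi fun t ht => ?_
          have ht0 : 0 < t := hx0.trans ht
          have := hle t (le_of_lt ht)
          have e : P {a | t < |Z a|} = ENNReal.ofReal (absTail P Z t) := by
            rw [absTail, ofReal_measureReal]
          rw [e, ← ENNReal.ofReal_mul (h.pos t).le]
          apply ENNReal.ofReal_le_ofReal
          calc absTail P Z t * t ^ (β - 1) ≤ C * t ^ (-((β + α) / 2)) * t ^ (β - 1) := by gcongr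
            _ = _ := by rw [mul_assoc, ← Real.rpow_add ht0]; congr 2; ring
      _ < ⊤ := by
        have := (integrableOn_Ioi_rpow_of_lt (a := β - 1 - (β + α) / 2) (by linarith) hx0).const_mul C
        exact this.lintegral_lt_top

/-- The one-dimensional marginal of a regularly varying sequence has a regularly varying tail. -/
theorem IsRegularlyVarying.regVar_absTail {Ω : Type*} [MeasurableSpace Ω] {P : Measure Ω}
    [IsProbabilityMeasure P] {X : ℤ → Ω → ℝ} (hX : ∀ t, Measurable (X t)) {α : ℝ}
    (h : IsRegularlyVarying P X α) : RegVar (absTail P (X 1)) α := by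
  obtain ⟨hα, σ, hσ, -, hlim⟩ := h 1 le_rfl
  have hnorm : ∀ ω, ‖(WithLp.toLp 2 (fun i : Fin 1 => X ((i : ℕ) + 1 : ℤ) ω) :
      EuclideanSpace ℝ (Fin 1))‖ = |X 1 ω| := by
    intro ω
    rw [EuclideanSpace.norm_eq]
    simp [Real.sqrt_sq_eq_abs]
  have hVm : Measurable (fun ω => (WithLp.toLp 2 (fun i : Fin 1 => X ((i : ℕ) + 1 : ℤ) ω) :
      EuclideanSpace ℝ (Fin 1))) := by
    apply (PiLp.continuous_toLp 2 _).measurable.comp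
    exact measurable_pi_lambda _ fun i => hX _
  have hanti : Antitone (absTail P (X 1)) := fun x y hxy =>
    measureReal_mono (fun ω (hω : y < _) => lt_of_le_of_lt hxy hω)
  have key : ∀ u : ℝ, 0 < u → Tendsto (fun x => ((P {ω | x < |X 1 ω|})⁻¹).toReal *
      absTail P (X 1) (u * x)) atTop (𝓝 (u ^ (-α))) := by
    intro u hu
    have := hlim u hu (BoundedContinuousFunction.const _ 1)
    have hu' : 0 ≤ u ^ (-α) := by positivity
    simp only [BoundedContinuousFunction.const_apply, hnorm, measureReal_ennreal_smul_apply,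
      integral_const, smul_eq_mul, mul_one, probReal_univ, ENNReal.toReal_ofReal hu'] at this
    refine this.congr fun x => ?_
    congr 1
    rw [measureReal_def, Measure.map_apply]
    · simp [absTail, measureReal_def]
    · exact (hX 1).abs.inv.smul hVm
    · exact MeasurableSet.univ
  -- If the tail vanished from some point on, the ratio at u = 1 would be eventually 0 instead of
  -- tending to 1.
  have hpos : ∀ x, 0 < absTail P (X 1) x := by
    intro x
    by_contra hx
    have hx0 : absTail P (X 1) x = 0 := le_antisymm (not_lt.1 hx) measureReal_nonneg
    have h1 := key 1 one_pos
    rw [Real.one_rpow] at h1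
    have h2 : Tendsto (fun x => ((P {ω | x < |X 1 ω|})⁻¹).toReal * absTail P (X 1) (1 * x))
        atTop (𝓝 0) := by
      refine tendsto_const_nhds.congr' ?_
      filter_upwards [eventually_ge_atTop x] with y hy
      have : absTail P (X 1) (1 * y) = 0 := by
        rw [one_mul]
        exact le_antisymm ((hanti hy).trans hx0.le) measureReal_nonneg
      rw [this, mul_zero]
    exact one_ne_zero (tendsto_nhds_unique h1 h2)
  refine ⟨hanti, hpos, fun u hu => (key u hu).congr fun x => ?_⟩
  rw [ENNReal.toReal_inv, div_eq_inv_mul]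
  rfl

/-! ### Stationarity and k-dependence -/

section Dependence

variable {Ω : Type*} {X : ℤ → Ω → ℝ}

/-- The σ-algebra generated by `X_t`, `t ≤ m`. -/
@[reducible] def past (X : ℤ → Ω → ℝ) (m : ℤ) : MeasurableSpace Ω :=
  ⨆ t : {t : ℤ // t ≤ m}, MeasurableSpace.comap (X t) inferInstance

/-- The σ-algebra generated by `X_t`, `t ≥ m`. -/
@[reducible] def future (X : ℤ → Ω → ℝ) (m : ℤ) : MeasurableSpace Ω :=
  ⨆ t : {t : ℤ // m ≤ t}, MeasurableSpace.comap (X t) inferInstance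

theorem measurable_past {i m : ℤ} (h : i ≤ m) : Measurable[past X m] (X i) :=
  measurable_iff_comap_le.2 (le_iSup (fun t : {t : ℤ // t ≤ m} =>
    MeasurableSpace.comap (X t) inferInstance) ⟨i, h⟩)

theorem measurable_future {i m : ℤ} (h : m ≤ i) : Measurable[future X m] (X i) :=
  measurable_iff_comap_le.2 (le_iSup (fun t : {t : ℤ // m ≤ t} =>
    MeasurableSpace.comap (X t) inferInstance) ⟨i, h⟩)

theorem past_eq_comap (m : ℤ) :
    past X m = MeasurableSpace.comap (fun ω (t : {t : ℤ // t ≤ m}) => X t ω) inferInstance := by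
  simp only [past, MeasurableSpace.pi, MeasurableSpace.comap_iSup, MeasurableSpace.comap_comp]
  rfl

theorem future_eq_comap (m : ℤ) :
    future X m = MeasurableSpace.comap (fun ω (t : {t : ℤ // m ≤ t}) => X t ω) inferInstance := by
  simp only [future, MeasurableSpace.pi, MeasurableSpace.comap_iSup, MeasurableSpace.comap_comp]
  rfl

theorem measurableSet_past_lt_abs {i m : ℤ} (h : i ≤ m) (y : ℝ) :
    MeasurableSet[past X m] {ω | y < |X i ω|} := by
  have : MeasurableSet {z : ℝ | y < |z|} := measurableSet_lt measurable_const measurable_id.abs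
  exact measurable_past h this

theorem measurableSet_future_lt_abs {i m : ℤ} (h : m ≤ i) (y : ℝ) :
    MeasurableSet[future X m] {ω | y < |X i ω|} := by
  have : MeasurableSet {z : ℝ | y < |z|} := measurableSet_lt measurable_const measurable_id.abs
  exact measurable_future h this

variable [mΩ : MeasurableSpace Ω] {P : Measure Ω}

theorem past_le (hX : ∀ t, Measurable (X t)) (m : ℤ) : past X m ≤ mΩ :=
  iSup_le fun t => (hX t).comap_le

theorem future_le (hX : ∀ t, Measurable (X t)) (m : ℤ) : future X m ≤ mΩ :=
  iSup_le fun t => (hX t).comap_le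

theorem measurable_path (hX : ∀ t, Measurable (X t)) (h : ℤ) :
    Measurable (fun ω (t : ℤ) => X (t + h) ω) :=
  measurable_pi_lambda _ fun t => hX (t + h)

theorem IsStrictlyStationary.lintegral_path (hX : ∀ t, Measurable (X t))
    (hs : IsStrictlyStationary P X) (h : ℤ) {f : (ℤ → ℝ) → ENNReal} (hf : Measurable f) :
    ∫⁻ ω, f (fun t => X (t + h) ω) ∂P = ∫⁻ ω, f (fun t => X t ω) ∂P := by
  rw [← lintegral_map (f := f) hf (measurable_path hX h), hs h, lintegral_map hf]
  simpa using measurable_path hX 0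

theorem IsStrictlyStationary.measureReal_path (hX : ∀ t, Measurable (X t))
    (hs : IsStrictlyStationary P X) (h : ℤ) {A : Set (ℤ → ℝ)} (hA : MeasurableSet A) :
    P.real {ω | (fun t => X (t + h) ω) ∈ A} = P.real {ω | (fun t => X t ω) ∈ A} := by
  have h0 : Measurable (fun ω (t : ℤ) => X t ω) := by simpa using measurable_path hX 0
  have := congrArg (fun m => m A) (hs h)
  simp only [Measure.map_apply (measurable_path hX h) hA, Measure.map_apply h0 hA] at this
  simp only [measureReal_def]
  exact congrArg _ this

theorem IsStrictlyStationary.absTail_eq (hX : ∀ t, Measurable (X t))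
    (hs : IsStrictlyStationary P X) (i : ℤ) : absTail P (X i) = absTail P (X 0) := by
  funext x
  have hA : MeasurableSet {a : ℤ → ℝ | x < |a 0|} :=
    measurableSet_lt measurable_const (measurable_pi_apply 0).abs
  simpa [absTail] using hs.measureReal_path hX i hA

/-- `k`-dependence of a stationary sequence at an arbitrary time. -/
theorem IsKDependent.indep [IsProbabilityMeasure P] (hX : ∀ t, Measurable (X t))
    (hs : IsStrictlyStationary P X) {k : ℕ} (hd : IsKDependent P X k) (m : ℤ) :
    Indep (past X m) (future X (m + k + 1)) P := by
  have e1 : past X m = past (fun t => X (t + m)) 0 := by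
    apply le_antisymm
    · refine iSup_le fun t => ?_
      have := measurable_past (X := fun t => X (t + m)) (i := t - m) (m := 0) (by have := t.2; omega)
      simpa using this.comap_le
    · exact iSup_le fun t => (measurable_past (by have := t.2; omega)).comap_le
  have e2 : future X (m + k + 1) = future (fun t => X (t + m)) (k + 1) := by
    apply le_antisymm
    · refine iSup_le fun t => ?_
      have := measurable_future (X := fun t => X (t + m)) (i := t - m) (m := k + 1)
        (by have := t.2; omega)
      simpa using this.comap_le
    · exact iSup_le fun t => (measurable_future (by have := t.2; omega)).comap_le
  have hL : ∀ h : ℤ, Measurable (fun ω (t : {t : ℤ // t ≤ 0}) => X (t + h) ω) := fun h =>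
    measurable_pi_lambda _ fun t => hX _
  have hR : ∀ h : ℤ, Measurable (fun ω (t : {t : ℤ // (k : ℤ) + 1 ≤ t}) => X (t + h) ω) := fun h =>
    measurable_pi_lambda _ fun t => hX _
  have h0 : IndepFun (fun ω (t : {t : ℤ // t ≤ 0}) => X (t + 0) ω)
      (fun ω (t : {t : ℤ // (k : ℤ) + 1 ≤ t}) => X (t + 0) ω) P := by
    have : Indep (past X 0) (future X (k + 1)) P := hd
    rw [past_eq_comap, future_eq_comap] at this
    simpa [IndepFun_iff_Indep] using this
  rw [e1, e2, past_eq_comap, future_eq_comap]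
  change IndepFun _ _ P
  rw [indepFun_iff_map_prod_eq_prod_map_map (hL m).aemeasurable (hR m).aemeasurable]
  rw [indepFun_iff_map_prod_eq_prod_map_map (hL 0).aemeasurable (hR 0).aemeasurable] at h0
  have hGL : Measurable (fun (a : ℤ → ℝ) (t : {t : ℤ // t ≤ 0}) => a t) :=
    measurable_pi_lambda _ fun t => measurable_pi_apply _
  have hGR : Measurable (fun (a : ℤ → ℝ) (t : {t : ℤ // (k : ℤ) + 1 ≤ t}) => a t) :=
    measurable_pi_lambda _ fun t => measurable_pi_apply _
  -- The joint law of the two blocks and both marginals are images of the law of the shifted path.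
  -- That law does not depend on the shift, so the product formula at time 0 carries over to time m.
  have a1 : ∀ h : ℤ, P.map (fun ω => ((fun (t : {t : ℤ // t ≤ 0}) => X (t + h) ω),
      (fun (t : {t : ℤ // (k : ℤ) + 1 ≤ t}) => X (t + h) ω))) =
      (P.map (fun ω (t : ℤ) => X (t + h) ω)).map (fun a => ((fun (t : {t : ℤ // t ≤ 0}) => a t),
      (fun (t : {t : ℤ // (k : ℤ) + 1 ≤ t}) => a t))) := fun h => by
    rw [Measure.map_map (hGL.prodMk hGR) (measurable_path hX h)]; rfl
  have a2 : ∀ h : ℤ, P.map (fun ω => (fun (t : {t : ℤ // t ≤ 0}) => X (t + h) ω)) =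
      (P.map (fun ω (t : ℤ) => X (t + h) ω)).map (fun a => (fun (t : {t : ℤ // t ≤ 0}) => a t)) :=
    fun h => by rw [Measure.map_map hGL (measurable_path hX h)]; rfl
  have a3 : ∀ h : ℤ, P.map (fun ω => (fun (t : {t : ℤ // (k : ℤ) + 1 ≤ t}) => X (t + h) ω)) =
      (P.map (fun ω (t : ℤ) => X (t + h) ω)).map
        (fun a => (fun (t : {t : ℤ // (k : ℤ) + 1 ≤ t}) => a t)) :=
    fun h => by rw [Measure.map_map hGR (measurable_path hX h)]; rfl
  rw [a1, a2, a3, hs] at h0 ⊢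
  exact h0

theorem IsKDependent.measureReal_inter [IsProbabilityMeasure P] (hX : ∀ t, Measurable (X t))
    (hs : IsStrictlyStationary P X) {k : ℕ} (hd : IsKDependent P X k) {m n : ℤ}
    (hmn : m + k + 1 ≤ n) {A B : Set Ω} (hA : MeasurableSet[past X m] A)
    (hB : MeasurableSet[future X n] B) : P.real (A ∩ B) = P.real A * P.real B := by
  have hB' : MeasurableSet[future X (m + k + 1)] B :=
    (iSup_le fun t : {t : ℤ // n ≤ t} =>
      (measurable_future (X := X) (m := m + k + 1) (hmn.trans t.2)).comap_le :
        future X n ≤ future X (m + k + 1)) B hB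
  have := (Indep_iff _ _ P).1 (hd.indep hX hs m) A B hA hB'
  simp only [measureReal_def, this, ENNReal.toReal_mul]

theorem IsKDependent.measureReal_two [IsProbabilityMeasure P] (hX : ∀ t, Measurable (X t))
    (hs : IsStrictlyStationary P X) {k : ℕ} (hd : IsKDependent P X k) {i j : ℤ}
    (hij : i + k + 1 ≤ j) (y z : ℝ) :
    P.real {ω | y < |X i ω| ∧ z < |X j ω|} = absTail P (X 0) y * absTail P (X 0) z := by
  have := hd.measureReal_inter hX hs hij (measurableSet_past_lt_abs le_rfl y)
    (measurableSet_future_lt_abs le_rfl z)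
  calc _ = absTail P (X i) y * absTail P (X j) z := this
    _ = _ := by rw [hs.absTail_eq hX i, hs.absTail_eq hX j]

/-- Distinct indices in one residue class modulo k+1 are at least k+1 apart, so each new factor is
independent of the product of the earlier ones. -/
theorem IsKDependent.lintegral_prod_residue_le [IsProbabilityMeasure P]
    (hX : ∀ t, Measurable (X t)) (hs : IsStrictlyStationary P X) {k : ℕ}
    (hd : IsKDependent P X k) {g : ℝ → ENNReal} (hg : Measurable g) {B : ENNReal} (hB : 1 ≤ B)
    (hgB : ∫⁻ ω, g (X 0 ω) ∂P ≤ B) (r t : ℕ) :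
    ∫⁻ ω, ∏ i ∈ Finset.Icc 1 t, (if i % (k + 1) = r then g (X i ω) else 1) ∂P ≤ B ^ t := by
  induction t with
  | zero => simp
  | succ t ih =>
    simp_rw [Finset.prod_Icc_succ_top (show 1 ≤ t + 1 by omega)]
    by_cases hr : (t + 1) % (k + 1) = r
    -- An index in (t-k, t] cannot be congruent to t+1 modulo k+1, so its factor is 1 and the
    -- earlier product is measurable with respect to the past at t-k.
    · have hsub : ∀ ω, ∏ i ∈ Finset.Icc 1 t, (if i % (k + 1) = r then g (X i ω) else 1) =
          ∏ i ∈ Finset.Icc 1 (t - k), (if i % (k + 1) = r then g (X i ω) else 1) := by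
        intro ω
        symm
        apply Finset.prod_subset
        · exact Finset.Icc_subset_Icc le_rfl (Nat.sub_le _ _)
        · intro i hi hi'
          rw [if_neg]
          intro hir
          simp only [Finset.mem_Icc] at hi hi'
          have hmod : i ≡ t + 1 [MOD (k + 1)] := hir.trans hr.symm
          have hdvd := (Nat.modEq_iff_dvd' (by omega)).1 hmod
          have := Nat.le_of_dvd (by omega) hdvd
          omega
      have hm1 : Measurable[past X ((t : ℤ) - k)] (fun ω =>
          ∏ i ∈ Finset.Icc 1 t, (if i % (k + 1) = r then g (X i ω) else 1)) := by
        simp_rw [hsub]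
        refine @Finset.measurable_fun_prod _ _ _ _ _ _ (past X ((t : ℤ) - k)) _ _ ?_
        intro i hi
        simp only [Finset.mem_Icc] at hi
        by_cases h : i % (k + 1) = r
        · simp only [h, if_true]
          exact hg.comp (measurable_past (by omega))
        · simp only [h, if_false]
          exact measurable_const
      have hm2 : Measurable[future X ((t : ℤ) - k + k + 1)]
          (fun ω => g (X ((t + 1 : ℕ) : ℤ) ω)) :=
        hg.comp (measurable_future (by push_cast; omega))
      have := lintegral_mul_eq_lintegral_mul_lintegral_of_independent_measurableSpace
        (past_le hX _) (future_le hX _) (hd.indep hX hs ((t : ℤ) - k)) hm1 hm2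
      simp only [hr, if_true]
      rw [this, pow_succ]
      gcongr
      have e := hs.lintegral_path hX ((t + 1 : ℕ) : ℤ) (f := fun a => g (a 0))
        (hg.comp (measurable_pi_apply 0))
      simp only [zero_add] at e
      rw [e]
      exact hgB
    · simp only [hr, if_false, mul_one]
      exact ih.trans (pow_le_pow_right₀ hB (Nat.le_succ t))

end Dependence

/-! ### Exponential bounds for truncated sums -/

/-- For |w| ≤ 1 the quadratic remainder is at most |w|^β since β ≤ 2; for w > 1 the factor exp b
suffices; for w < -1 one has 1 + w + |w| = 1. Replacing w² by |w|^β matters because the variance may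
be infinite. -/
theorem exp_le_one_add_add_rpow {w b β : ℝ} (hb : 0 ≤ b) (hwb : w ≤ b) (hβ1 : 1 ≤ β) (hβ2 : β ≤ 2) :
    Real.exp w ≤ 1 + w + Real.exp b * |w| ^ β := by
  have hb1 : 1 ≤ Real.exp b := Real.one_le_exp hb
  have hp : 0 ≤ |w| ^ β := by positivity
  rcases le_or_gt |w| 1 with h | h
  · have h1 := (abs_le.1 (Real.abs_exp_sub_one_sub_id_le h)).2
    have h2 : w ^ 2 ≤ |w| ^ β := by
      rcases eq_or_ne w 0 with rfl | hw
      · simpa using hp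
      · rw [← sq_abs, ← Real.rpow_natCast]
        exact Real.rpow_le_rpow_of_exponent_ge (abs_pos.2 hw) h (by simpa using hβ2)
    nlinarith
  · have h1 : |w| ≤ |w| ^ β := by
      nth_rewrite 1 [← Real.rpow_one |w|]
      exact Real.rpow_le_rpow_of_exponent_le h.le hβ1
    rcases lt_abs.1 h with h | h
    · have : Real.exp w ≤ Real.exp b := Real.exp_le_exp.2 hwb
      nlinarith
    · have h2 : Real.exp w ≤ 1 := Real.exp_le_one_iff.2 (by linarith)
      have h3 : |w| = -w := abs_of_neg (by linarith)
      nlinarith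

/-- Truncation at level `b`. -/
def trunc (b z : ℝ) : ℝ := if |z| ≤ b then z else 0

theorem measurable_trunc (b : ℝ) : Measurable (trunc b) :=
  Measurable.ite (measurableSet_le measurable_id.abs measurable_const) measurable_id
    measurable_const

theorem abs_trunc_le (b z : ℝ) : |trunc b z| ≤ |z| := by
  unfold trunc; split_ifs <;> simp

theorem abs_trunc_le_level {b : ℝ} (hb : 0 ≤ b) (z : ℝ) : |trunc b z| ≤ b := by
  unfold trunc; split_ifs with h
  · exact h
  · simpa using hb

theorem trunc_of_le {b z : ℝ} (h : |z| ≤ b) : trunc b z = z := if_pos h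

section NoBigJump

variable {Ω : Type*} [mΩ : MeasurableSpace Ω] {P : Measure Ω}

theorem lintegral_exp_trunc_le [IsProbabilityMeasure P] {Z : Ω → ℝ} (hZ : Measurable Z) {β : ℝ} (hβ1 : 1 ≤ β) (hβ2 : β ≤ 2)
    (hint : Integrable (fun ω => |Z ω| ^ β) P) {σ : ℝ} (hσ : |σ| = 1) {s b : ℝ} (hs : 0 < s)
    (hb : 0 ≤ b) :
    ∫⁻ ω, ENNReal.ofReal (Real.exp (s * (σ * trunc b (Z ω)))) ∂P ≤
      ENNReal.ofReal (Real.exp (s * (∫ ω, σ * trunc b (Z ω) ∂P) +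
        Real.exp (s * b) * s ^ β * ∫ ω, |Z ω| ^ β ∂P)) := by
  have hWm : Measurable (fun ω => σ * trunc b (Z ω)) :=
    ((measurable_trunc b).comp hZ).const_mul σ
  have hWb : ∀ ω, |σ * trunc b (Z ω)| ≤ b := fun ω => by
    rw [abs_mul, hσ, one_mul]; exact abs_trunc_le_level hb _
  have hWi : Integrable (fun ω => σ * trunc b (Z ω)) P :=
    Integrable.of_bound hWm.aestronglyMeasurable b (ae_of_all _ hWb)
  have hpt : ∀ ω, Real.exp (s * (σ * trunc b (Z ω))) ≤
      1 + s * (σ * trunc b (Z ω)) + Real.exp (s * b) * s ^ β * |Z ω| ^ β := by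
    intro ω
    have h1 := exp_le_one_add_add_rpow (w := s * (σ * trunc b (Z ω))) (b := s * b)
      (by positivity) (mul_le_mul_of_nonneg_left ((abs_le.1 (hWb ω)).2) hs.le) hβ1 hβ2
    have h2 : |s * (σ * trunc b (Z ω))| ^ β ≤ s ^ β * |Z ω| ^ β := by
      rw [← Real.mul_rpow hs.le (abs_nonneg _)]
      apply Real.rpow_le_rpow (abs_nonneg _) _ (by linarith)
      rw [abs_mul, abs_mul, hσ, one_mul, abs_of_pos hs]
      exact mul_le_mul_of_nonneg_left (abs_trunc_le _ _) hs.le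
    have h3 : 0 ≤ Real.exp (s * b) := (Real.exp_pos _).le
    nlinarith
  have i1 : Integrable (fun ω => 1 + s * (σ * trunc b (Z ω))) P :=
    (integrable_const 1).add (hWi.const_mul s)
  have i2 : Integrable (fun ω => Real.exp (s * b) * s ^ β * |Z ω| ^ β) P := hint.const_mul _
  have i3 : Integrable (fun ω => 1 + s * (σ * trunc b (Z ω)) +
      Real.exp (s * b) * s ^ β * |Z ω| ^ β) P := i1.add i2
  calc _ ≤ ∫⁻ ω, ENNReal.ofReal (1 + s * (σ * trunc b (Z ω)) +
          Real.exp (s * b) * s ^ β * |Z ω| ^ β) ∂P :=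
        lintegral_mono fun ω => ENNReal.ofReal_le_ofReal (hpt ω)
    _ = ENNReal.ofReal (∫ ω, (1 + s * (σ * trunc b (Z ω)) +
          Real.exp (s * b) * s ^ β * |Z ω| ^ β) ∂P) := by
        rw [ofReal_integral_eq_lintegral_ofReal i3]
        exact ae_of_all _ fun ω => (Real.exp_pos _).le.trans (hpt ω)
    _ ≤ _ := by
        apply ENNReal.ofReal_le_ofReal
        rw [integral_add i1 i2, integral_add (integrable_const 1) (hWi.const_mul s),
          integral_const_mul s, integral_const_mul (Real.exp (s * b) * s ^ β)]
        simp only [integral_const, probReal_univ, one_smul]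
        have := Real.add_one_le_exp (s * (∫ ω, σ * trunc b (Z ω) ∂P) +
          Real.exp (s * b) * s ^ β * ∫ ω, |Z ω| ^ β ∂P)
        linarith

/-- This is where the zero mean enters: the drift created by truncation tends to 0, so it is
eventually smaller than any prescribed slope. -/
theorem tendsto_integral_trunc {Z : Ω → ℝ} (hZ : Measurable Z) (hi : Integrable Z P)
    (h0 : ∫ ω, Z ω ∂P = 0) (σ : ℝ) {δ : ℝ} (hδ : 0 < δ) :
    Tendsto (fun x : ℝ => ∫ ω, σ * trunc (δ * x) (Z ω) ∂P) atTop (𝓝 0) := by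
  have : Tendsto (fun x : ℝ => ∫ ω, σ * trunc (δ * x) (Z ω) ∂P) atTop
      (𝓝 (∫ ω, σ * Z ω ∂P)) := by
    refine tendsto_integral_filter_of_dominated_convergence (fun ω => |σ| * |Z ω|) ?_ ?_ ?_ ?_
    · exact Eventually.of_forall fun x =>
        (((measurable_trunc _).comp hZ).const_mul σ).aestronglyMeasurable
    · refine Eventually.of_forall fun x => ae_of_all _ fun ω => ?_
      rw [Real.norm_eq_abs, abs_mul]
      exact mul_le_mul_of_nonneg_left (abs_trunc_le _ _) (abs_nonneg _)
    · exact hi.abs.const_mul _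
    · refine ae_of_all _ fun ω => tendsto_const_nhds.congr' ?_
      filter_upwards [eventually_ge_atTop (|Z ω| / δ)] with x hx
      rw [trunc_of_le]
      rw [mul_comm]; exact (div_le_iff₀ hδ).1 hx
  rwa [integral_const_mul, h0, mul_zero] at this

variable [IsProbabilityMeasure P] {X : ℤ → Ω → ℝ}

/-- Chernoff bound for the partial sums of a function of a stationary `k`-dependent sequence. -/
theorem IsKDependent.chernoff (hX : ∀ t, Measurable (X t)) (hs : IsStrictlyStationary P X) {k : ℕ}
    (hd : IsKDependent P X k) {g : ℝ → ℝ} (hg : Measurable g) {s ε a : ℝ} (hs0 : 0 < s)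
    (hε : 0 ≤ ε)
    (hmgf : ∫⁻ ω, ENNReal.ofReal (Real.exp (s * g (X 0 ω))) ∂P ≤ ENNReal.ofReal (Real.exp ε))
    (n : ℕ) :
    P.real {ω | ∃ t ≤ n, (k + 1) * a < ∑ i ∈ Finset.Icc 1 t, g (X i ω)} ≤
      (n + 1) * (k + 1) * Real.exp (ε * n - s * a) := by
  have hsub : {ω | ∃ t ≤ n, (k + 1) * a < ∑ i ∈ Finset.Icc 1 t, g (X i ω)} ⊆
      ⋃ t ∈ Finset.range (n + 1), ⋃ r ∈ Finset.range (k + 1),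
        {ω | a < ∑ i ∈ Finset.Icc 1 t, (if i % (k + 1) = r then g (X i ω) else 0)} := by
    rintro ω ⟨t, ht, h⟩
    simp only [Set.mem_iUnion, Finset.mem_range, Set.mem_ofPred_eq]
    refine ⟨t, by omega, ?_⟩
    by_contra! hc
    -- Pigeonhole: the sum splits over the k+1 residue classes, so a total above (k+1)a forces one
    -- class above a.
    have e : ∑ i ∈ Finset.Icc 1 t, g (X i ω) = ∑ r ∈ Finset.range (k + 1),
        ∑ i ∈ Finset.Icc 1 t, (if i % (k + 1) = r then g (X i ω) else 0) := by
      rw [Finset.sum_comm]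
      refine Finset.sum_congr rfl fun i _ => ?_
      rw [Finset.sum_ite_eq, if_pos]
      exact Finset.mem_range.2 (Nat.mod_lt _ (by omega))
    have := Finset.sum_le_sum (s := Finset.range (k + 1)) (fun r hr => hc r (Finset.mem_range.1 hr))
    rw [← e] at this
    simp only [Finset.sum_const, Finset.card_range, nsmul_eq_mul] at this
    push_cast at this
    linarith
  have hone : ∀ t ∈ Finset.range (n + 1), ∀ r ∈ Finset.range (k + 1),
      P.real {ω | a < ∑ i ∈ Finset.Icc 1 t, (if i % (k + 1) = r then g (X i ω) else 0)} ≤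
        Real.exp (ε * n - s * a) := by
    intro t ht r _
    have htn : (t : ℝ) ≤ n := by
      exact_mod_cast Nat.lt_succ_iff.1 (Finset.mem_range.1 ht)
    have hgm : Measurable (fun z : ℝ => ENNReal.ofReal (Real.exp (s * g z))) :=
      (Real.measurable_exp.comp (hg.const_mul s)).ennreal_ofReal
    have h1 := hd.lintegral_prod_residue_le hX hs hgm (B := ENNReal.ofReal (Real.exp ε))
      (by rw [ENNReal.one_le_ofReal]; exact Real.one_le_exp hε) hmgf r t
    have hpt : ∀ ω, ∏ i ∈ Finset.Icc 1 t, (if i % (k + 1) = r then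
        ENNReal.ofReal (Real.exp (s * g (X i ω))) else 1) = ENNReal.ofReal (Real.exp
          (s * ∑ i ∈ Finset.Icc 1 t, (if i % (k + 1) = r then g (X i ω) else 0))) := by
      intro ω
      rw [Finset.mul_sum, Real.exp_sum, ENNReal.ofReal_prod_of_nonneg]
      · refine Finset.prod_congr rfl fun i _ => ?_
        split_ifs <;> simp
      · intro i _; positivity
    simp_rw [hpt] at h1
    have hm : Measurable (fun ω => ENNReal.ofReal (Real.exp
          (s * ∑ i ∈ Finset.Icc 1 t, (if i % (k + 1) = r then g (X i ω) else 0)))) := by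
      refine (Real.measurable_exp.comp (Measurable.const_mul ?_ s)).ennreal_ofReal
      refine Finset.measurable_fun_sum _ fun i _ => ?_
      split_ifs
      · exact hg.comp (hX i)
      · exact measurable_const
    have h2 := meas_ge_le_lintegral_div (μ := P) hm.aemeasurable
      (ε := ENNReal.ofReal (Real.exp (s * a))) (by simp [Real.exp_pos]) ENNReal.ofReal_ne_top
    have h3 : P {ω | a < ∑ i ∈ Finset.Icc 1 t, (if i % (k + 1) = r then g (X i ω) else 0)} ≤
        ENNReal.ofReal (Real.exp (ε * n - s * a)) := by
      refine (measure_mono ?_).trans (h2.trans ((ENNReal.div_le_div_right h1 _).trans ?_))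
      · intro ω (hω : a < _)
        exact ENNReal.ofReal_le_ofReal (Real.exp_le_exp.2
          (mul_le_mul_of_nonneg_left hω.le hs0.le))
      · rw [← ENNReal.ofReal_pow (Real.exp_pos _).le, ← ENNReal.ofReal_div_of_pos (Real.exp_pos _),
          ← Real.exp_nat_mul, ← Real.exp_sub]
        apply ENNReal.ofReal_le_ofReal (Real.exp_le_exp.2 _)
        nlinarith
    exact ENNReal.toReal_le_of_le_ofReal (Real.exp_pos _).le h3
  calc _ ≤ _ := measureReal_mono hsub (measure_ne_top _ _)
    _ ≤ ∑ t ∈ Finset.range (n + 1), P.real (⋃ r ∈ Finset.range (k + 1),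
        {ω | a < ∑ i ∈ Finset.Icc 1 t, (if i % (k + 1) = r then g (X i ω) else 0)}) :=
      measureReal_biUnion_finset_le _ _
    _ ≤ ∑ t ∈ Finset.range (n + 1), ∑ r ∈ Finset.range (k + 1), P.real
        {ω | a < ∑ i ∈ Finset.Icc 1 t, (if i % (k + 1) = r then g (X i ω) else 0)} :=
      Finset.sum_le_sum fun t _ => measureReal_biUnion_finset_le _ _
    _ ≤ ∑ t ∈ Finset.range (n + 1), ∑ r ∈ Finset.range (k + 1), Real.exp (ε * n - s * a) :=
      Finset.sum_le_sum fun t ht => Finset.sum_le_sum fun r hr => hone t ht r hr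
    _ = _ := by simp; ring

theorem tendsto_rpow_mul_log_div_rpow (c : ℝ) (hc : 0 < c) {β : ℝ} (hβ : 1 < β) (M : ℝ) :
    Tendsto (fun x : ℝ => x ^ ((β - 1) / 2) * (c * Real.log x / x) ^ (β - 1) * M) atTop (𝓝 0) := by
  have h1 := (isLittleO_log_rpow_rpow_atTop (s := (β - 1) / 2) (β - 1)
    (by linarith)).tendsto_div_nhds_zero
  have h2 := (h1.const_mul (c ^ (β - 1))).mul_const M
  simp only [mul_zero, zero_mul] at h2
  refine h2.congr' ?_
  filter_upwards [eventually_gt_atTop 1] with x hx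
  have hx0 : 0 < x := by linarith
  have hl : 0 ≤ Real.log x := Real.log_nonneg hx.le
  rw [Real.div_rpow (by positivity) hx0.le, Real.mul_rpow hc.le hl]
  have e : x ^ (β - 1) = x ^ ((β - 1) / 2) * x ^ ((β - 1) / 2) := by
    rw [← Real.rpow_add hx0]; congr 1; ring
  rw [e]
  have : 0 < x ^ ((β - 1) / 2) := by positivity
  field_simp

/-- Partial sums of the variables truncated at `δ x` stay below `η x` up to time `K x`, outside an
event of polynomially small probability. -/
theorem IsKDependent.truncated_sum_bound (hX : ∀ t, Measurable (X t))
    (hs : IsStrictlyStationary P X) {k : ℕ} (hd : IsKDependent P X k)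
    {β : ℝ} (hβ1 : 1 < β) (hβ2 : β ≤ 2) (hint : Integrable (fun ω => |X 0 ω| ^ β) P)
    (hi : Integrable (X 0) P) (h0 : ∫ ω, X 0 ω ∂P = 0) {σ : ℝ} (hσ : |σ| = 1)
    {η K γ : ℝ} (hη : 0 < η) (hK : 0 < K) (hγ : 0 < γ) :
    ∃ δ₀ : ℝ, 0 < δ₀ ∧ ∀ δ, 0 < δ → δ ≤ δ₀ → ∀ᶠ x in atTop, ∀ n : ℕ, (n : ℝ) ≤ K * x →
      P.real {ω | ∃ t ≤ n, η * x < ∑ i ∈ Finset.Icc 1 t, σ * trunc (δ * x) (X i ω)} ≤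
        x ^ (-γ) := by
  have hk : (0 : ℝ) < k + 1 := by positivity
  -- With s = c log x / x and level ηx/(k+1) per class, the Chernoff exponent is 2(γ+2) log x. The
  -- slope ρ' below is such that growth up to time Kx consumes at most half of it. Of the remaining
  -- x^{-(γ+2)}, two powers absorb the union bound factor (n+1)(k+1) ≤ x².
  set c : ℝ := 2 * (k + 1) * (γ + 2) / η with hc
  have hc0 : 0 < c := by positivity
  set ρ' : ℝ := η / (2 * K * (k + 1)) with hρ'
  have hρ0 : 0 < ρ' := by positivity
  -- This makes exp(sδx) = x^{cδ} at most x^{(β-1)/2}, which is still beaten by s^{β-1}.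
  refine ⟨(β - 1) / (2 * c), div_pos (by linarith) (by positivity), fun δ hδ hδ0 => ?_⟩
  have hcδ : c * δ ≤ (β - 1) / 2 := by
    rw [le_div_iff₀ (by positivity)] at hδ0
    nlinarith
  set M := ∫ ω, |X 0 ω| ^ β ∂P with hM
  have hM0 : 0 ≤ M := integral_nonneg fun ω => by positivity
  have ev1 := (tendsto_integral_trunc (hX 0) hi h0 σ hδ).eventually
    (ge_mem_nhds (show (0 : ℝ) < ρ' / 2 by positivity))
  have ev2 := (tendsto_rpow_mul_log_div_rpow c hc0 hβ1 M).eventually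
    (ge_mem_nhds (show (0 : ℝ) < ρ' / 2 by positivity))
  filter_upwards [ev1, ev2, eventually_gt_atTop 1, eventually_ge_atTop ((K + 1) * (k + 1))]
    with x h1 h2 hx hxK n hn
  have hx0 : 0 < x := by linarith
  have hlog : 0 < Real.log x := Real.log_pos hx
  set s := c * Real.log x / x with hsdef
  have hs0 : 0 < s := by positivity
  have hsx : s * x = c * Real.log x := by rw [hsdef]; field_simp
  have hmgf : ∫⁻ ω, ENNReal.ofReal (Real.exp (s * (σ * trunc (δ * x) (X 0 ω)))) ∂P ≤
      ENNReal.ofReal (Real.exp (s * ρ')) := by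
    refine (lintegral_exp_trunc_le (hX 0) hβ1.le hβ2 hint hσ hs0 (by positivity)).trans ?_
    apply ENNReal.ofReal_le_ofReal (Real.exp_le_exp.2 _)
    have e1 : Real.exp (s * (δ * x)) ≤ x ^ ((β - 1) / 2) := by
      rw [show s * (δ * x) = δ * (s * x) by ring, hsx, Real.rpow_def_of_pos hx0]
      apply Real.exp_le_exp.2
      nlinarith
    have e2 : s ^ β = s * s ^ (β - 1) := by
      nth_rewrite 2 [← Real.rpow_one s]
      rw [← Real.rpow_add hs0]; congr 1; ring
    calc s * (∫ ω, σ * trunc (δ * x) (X 0 ω) ∂P) + Real.exp (s * (δ * x)) * s ^ β * M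
        ≤ s * (ρ' / 2) + x ^ ((β - 1) / 2) * s ^ β * M := by gcongr
      _ = s * (ρ' / 2) + s * (x ^ ((β - 1) / 2) * s ^ (β - 1) * M) := by rw [e2]; ring
      _ ≤ s * (ρ' / 2) + s * (ρ' / 2) := by gcongr
      _ = _ := by ring
  have hch := hd.chernoff hX hs (g := fun z => σ * trunc (δ * x) z) ((measurable_trunc _).const_mul σ)
    (a := η * x / (k + 1)) hs0 (by positivity) hmgf n
  rw [show ((k : ℝ) + 1) * (η * x / (k + 1)) = η * x by field_simp] at hch
  refine hch.trans ?_
  have e3 : s * ρ' * n - s * (η * x / (k + 1)) ≤ Real.log x * (-(γ + 2)) := by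
    have : s * ρ' * n ≤ s * ρ' * (K * x) := by gcongr
    have e4 : s * ρ' * (K * x) - s * (η * x / (k + 1)) = -((s * x) * η / (2 * (k + 1))) := by
      rw [hρ']; field_simp; ring
    have e5 : (s * x) * η / (2 * (k + 1)) = Real.log x * (γ + 2) := by
      rw [hsx, hc]; field_simp
    linarith
  have e6 : ((n : ℝ) + 1) * (k + 1) ≤ x * x := by
    have : (n : ℝ) + 1 ≤ (K + 1) * x := by nlinarith
    calc ((n : ℝ) + 1) * (k + 1) ≤ ((K + 1) * x) * (k + 1) := by gcongr
      _ = ((K + 1) * (k + 1)) * x := by ring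
      _ ≤ x * x := by gcongr
  calc _ ≤ (x * x) * x ^ (-(γ + 2)) := by
        rw [Real.rpow_def_of_pos hx0]
        gcongr
    _ = x ^ (-γ) := by
        rw [← sq, ← Real.rpow_natCast, ← Real.rpow_add hx0]; congr 1; push_cast; ring

end NoBigJump

/-! ### Late ruin and separated exceedances -/

/-- A centered stationary `k`-dependent sequence with regularly varying tails of index `α > 1`. -/
structure IsHeavyKDependent {Ω : Type*} [MeasurableSpace Ω] (P : Measure Ω) (X : ℤ → Ω → ℝ)
    (k : ℕ) (α : ℝ) : Prop where
  meas : ∀ t, Measurable (X t)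
  stat : IsStrictlyStationary P X
  dep : IsKDependent P X k
  one_lt : 1 < α
  tail : RegVar (absTail P (X 0)) α
  mean : ∫ ω, X 0 ω ∂P = 0

theorem sum_trunc_eq_walk {Ω : Type*} {X : ℤ → Ω → ℝ} {b : ℝ} {ω : Ω} {n t : ℕ} (ht : t ≤ n)
    (hb : ∀ i ∈ Finset.Icc 1 n, |X (i : ℤ) ω| ≤ b) :
    ∑ i ∈ Finset.Icc 1 t, trunc b (X i ω) = walk X t ω :=
  Finset.sum_congr rfl fun i hi => trunc_of_le (hb i (by simp at hi ⊢; omega))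

namespace IsHeavyKDependent

variable {Ω : Type*} [mΩ : MeasurableSpace Ω] {P : Measure Ω} {X : ℤ → Ω → ℝ}
  {k : ℕ} {α : ℝ}

theorem measureReal_exists_lt_abs_le (h : IsHeavyKDependent P X k α) (n : ℕ) (y : ℝ) :
    P.real {ω | ∃ i ∈ Finset.Icc 1 n, y < |X (i : ℤ) ω|} ≤ n * absTail P (X 0) y := by
  have : {ω | ∃ i ∈ Finset.Icc 1 n, y < |X (i : ℤ) ω|} =
      ⋃ i ∈ Finset.Icc 1 n, {ω | y < |X (i : ℤ) ω|} := by ext; simp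
  rw [this]
  refine (measureReal_biUnion_finset_le _ _).trans ?_
  have e : ∀ i : ℕ, P.real {ω | y < |X (i : ℤ) ω|} = absTail P (X 0) y :=
    fun i => congrFun (h.stat.absTail_eq h.meas i) y
  simp [e]

variable [IsProbabilityMeasure P]

theorem truncated_sum_bound (h : IsHeavyKDependent P X k α) {σ : ℝ} (hσ : |σ| = 1)
    {η K γ : ℝ} (hη : 0 < η) (hK : 0 < K) (hγ : 0 < γ) :
    ∃ δ₀ : ℝ, 0 < δ₀ ∧ ∀ δ, 0 < δ → δ ≤ δ₀ → ∀ᶠ x in atTop, ∀ n : ℕ, (n : ℝ) ≤ K * x →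
      P.real {ω | ∃ t ≤ n, η * x < ∑ i ∈ Finset.Icc 1 t, σ * trunc (δ * x) (X i ω)} ≤
        x ^ (-γ) := by
  have h1 := h.one_lt
  have hi : Integrable (X 0) P := by
    have := integrable_abs_rpow (h.meas 0) h.tail one_pos h1
    simp only [Real.rpow_one] at this
    exact (integrable_norm_iff (h.meas 0).aestronglyMeasurable).1 this
  -- The exponent must exceed 1, stay below α for integrability, and not exceed 2.
  refine h.dep.truncated_sum_bound h.meas h.stat (β := min ((1 + α) / 2) 2) ?_ (min_le_right _ _)
    (integrable_abs_rpow (h.meas 0) h.tail ?_ ?_) hi h.mean hσ hη hK hγ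
  · exact lt_min (by linarith) (by norm_num)
  · exact lt_min (by linarith) (by norm_num)
  · exact (min_le_left _ _).trans_lt (by linarith)

/-- The contribution of a single dyadic block of times. -/
theorem exists_block_bound (h : IsHeavyKDependent P X k α) {ρ : ℝ} (hρ : 0 < ρ) :
    ∃ δ : ℝ, 0 < δ ∧ ∀ᶠ T : ℝ in atTop, P.real {ω | ∃ t : ℕ, T ≤ t ∧ t ≤ 2 * T ∧ ρ * t < walk X t ω} ≤
      2 * T * absTail P (X 0) (δ * T) + T ^ (-α) := by
  have h1 := h.one_lt
  obtain ⟨δ, hδ, hb⟩ := h.truncated_sum_bound (σ := 1) (by simp) hρ two_pos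
    (show 0 < α by linarith)
  refine ⟨δ, hδ, ?_⟩
  filter_upwards [hb δ hδ le_rfl, eventually_gt_atTop 0] with T hT hT0
  have hn : ((⌊2 * T⌋₊ : ℕ) : ℝ) ≤ 2 * T := Nat.floor_le (by positivity)
  have hsub : {ω | ∃ t : ℕ, T ≤ t ∧ t ≤ 2 * T ∧ ρ * t < walk X t ω} ⊆
      {ω | ∃ i ∈ Finset.Icc 1 ⌊2 * T⌋₊, δ * T < |X (i : ℤ) ω|} ∪
      {ω | ∃ t ≤ ⌊2 * T⌋₊, ρ * T < ∑ i ∈ Finset.Icc 1 t, 1 * trunc (δ * T) (X i ω)} := by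
    rintro ω ⟨t, ht1, ht2, ht3⟩
    by_cases hbig : ∃ i ∈ Finset.Icc 1 ⌊2 * T⌋₊, δ * T < |X (i : ℤ) ω|
    · exact Or.inl hbig
    · right
      push Not at hbig
      have htn : t ≤ ⌊2 * T⌋₊ := Nat.le_floor ht2
      refine ⟨t, htn, ?_⟩
      simp only [one_mul]
      rw [sum_trunc_eq_walk htn hbig]
      nlinarith
  refine (measureReal_mono hsub).trans ((measureReal_union_le _ _).trans (add_le_add ?_ (hT _ hn)))
  refine (h.measureReal_exists_lt_abs_le _ _).trans ?_
  have := (h.tail.pos (δ * T)).le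
  gcongr

/-- Ruin after time `K x` is negligible as `K → ∞`. -/
theorem exists_late_bound (h : IsHeavyKDependent P X k α) {ρ : ℝ} (hρ : 0 < ρ) :
    ∃ C : ℝ, 0 < C ∧ ∀ K : ℝ, 1 ≤ K → ∀ᶠ x in atTop,
      P.real {ω | ∃ t : ℕ, K * x ≤ t ∧ ρ * t < walk X t ω} ≤
        C * K ^ (1 - α) * (x * absTail P (X 0) x) := by
  have h1 := h.one_lt
  obtain ⟨δ, hδ, hblock⟩ := h.exists_block_bound hρ
  obtain ⟨T₁, hT₁⟩ := eventually_atTop.1 hblock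
  -- The exponent (1+α)/2 exceeds 1: doubling T doubles the block length but shrinks the tail by
  -- more than 2, so the block bounds form a geometric series of ratio q₁ < 1.
  obtain ⟨x₀, hx₀, hdoub⟩ := h.tail.exists_doubling_le (β := (1 + α) / 2) (by linarith)
  set F := absTail P (X 0) with hF
  set q₁ : ℝ := 2 * (2 : ℝ) ^ (-((1 + α) / 2)) with hq₁
  set q₂ : ℝ := (2 : ℝ) ^ (-α) with hq₂
  have q1pos : 0 < q₁ := by positivity
  have q2pos : 0 < q₂ := by positivity
  have q1lt : q₁ < 1 := by
    have : q₁ = (2 : ℝ) ^ (1 + -((1 + α) / 2)) := by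
      rw [Real.rpow_add two_pos, Real.rpow_one]
    rw [this]
    exact Real.rpow_lt_one_of_one_lt_of_neg (by norm_num) (by linarith)
  have q2lt : q₂ < 1 := Real.rpow_lt_one_of_one_lt_of_neg (by norm_num) (by linarith)
  have d1 : 0 < 1 - q₁ := by linarith
  have d2 : 0 < 1 - q₂ := by linarith
  have tailsum : ∀ T : ℝ, 0 < T → T₁ ≤ T → x₀ ≤ δ * T →
      P.real {ω | ∃ t : ℕ, T ≤ t ∧ ρ * t < walk X t ω} ≤
        2 * T * F (δ * T) / (1 - q₁) + T ^ (-α) / (1 - q₂) := by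
    intro T hT0 hT1 hTx
    have hFT := h.tail.pos (δ * T)
    have hsub : {ω | ∃ t : ℕ, T ≤ t ∧ ρ * t < walk X t ω} ⊆
        ⋃ m : ℕ, {ω | ∃ t : ℕ, 2 ^ m * T ≤ t ∧ t ≤ 2 * (2 ^ m * T) ∧ ρ * t < walk X t ω} := by
      rintro ω ⟨t, ht1, ht2⟩
      obtain ⟨m, hm1, hm2⟩ := exists_nat_pow_near (x := t / T) (y := 2)
        ((one_le_div hT0).2 ht1) (by norm_num)
      refine Set.mem_iUnion.2 ⟨m, t, (le_div_iff₀ hT0).1 hm1, ?_, ht2⟩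
      have := (div_lt_iff₀ hT0).1 hm2
      rw [pow_succ] at this
      linarith
    have hm : ∀ m : ℕ, P {ω | ∃ t : ℕ, 2 ^ m * T ≤ t ∧ t ≤ 2 * (2 ^ m * T) ∧ ρ * t < walk X t ω} ≤
        ENNReal.ofReal (2 * T * F (δ * T) * q₁ ^ m + T ^ (-α) * q₂ ^ m) := by
      intro m
      rw [← ofReal_measureReal (measure_ne_top _ _)]
      apply ENNReal.ofReal_le_ofReal
      have h2m : (1 : ℝ) ≤ 2 ^ m := one_le_pow₀ (by norm_num)
      refine (hT₁ (2 ^ m * T) (by nlinarith)).trans ?_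
      have e1 : F (δ * (2 ^ m * T)) ≤ ((2 : ℝ) ^ (-((1 + α) / 2))) ^ m * F (δ * T) := by
        have := RegVar.doubling_iterate hx₀ hdoub m (δ * T) hTx
        rwa [show δ * (2 ^ m * T) = 2 ^ m * (δ * T) by ring]
      have e2 : (2 ^ m * T) ^ (-α) = T ^ (-α) * q₂ ^ m := by
        rw [Real.mul_rpow (by positivity) hT0.le, hq₂, ← Real.rpow_natCast, ← Real.rpow_natCast,
          ← Real.rpow_mul (by norm_num), ← Real.rpow_mul (by norm_num), mul_comm, mul_comm (-α)]
      rw [e2]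
      refine add_le_add ?_ le_rfl
      calc 2 * (2 ^ m * T) * F (δ * (2 ^ m * T))
          ≤ 2 * (2 ^ m * T) * (((2 : ℝ) ^ (-((1 + α) / 2))) ^ m * F (δ * T)) := by gcongr
        _ = 2 * T * F (δ * T) * q₁ ^ m := by rw [hq₁, mul_pow]; ring
    have hsum : HasSum (fun m : ℕ => 2 * T * F (δ * T) * q₁ ^ m + T ^ (-α) * q₂ ^ m)
        (2 * T * F (δ * T) / (1 - q₁) + T ^ (-α) / (1 - q₂)) := by
      simp only [div_eq_mul_inv]
      exact ((hasSum_geometric_of_lt_one q1pos.le q1lt).mul_left _).add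
        ((hasSum_geometric_of_lt_one q2pos.le q2lt).mul_left _)
    have hP : P {ω | ∃ t : ℕ, T ≤ t ∧ ρ * t < walk X t ω} ≤
        ENNReal.ofReal (2 * T * F (δ * T) / (1 - q₁) + T ^ (-α) / (1 - q₂)) := by
      refine (measure_mono hsub).trans ((measure_iUnion_le _).trans ?_)
      refine (ENNReal.tsum_le_tsum hm).trans ?_
      rw [← ENNReal.ofReal_tsum_of_nonneg _ hsum.summable, hsum.tsum_eq]
      intro m; positivity
    exact ENNReal.toReal_le_of_le_ofReal (by positivity) hP
  -- One factor 2 is the length of a block, the other is the slack in F(δKx) ≤ 2(δK)^{-α} F(x),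
  -- valid for large x. The constant does not depend on K.
  refine ⟨4 * δ ^ (-α) / (1 - q₁) + 1 / (1 - q₂), by positivity, fun K hK => ?_⟩
  have hK0 : 0 < K := by linarith
  have ev1 := (h.tail.tendsto (δ * K) (by positivity)).eventually
    (ge_mem_nhds (show (δ * K) ^ (-α) < 2 * (δ * K) ^ (-α) by
      have : 0 < (δ * K) ^ (-α) := by positivity
      linarith))
  have ev2 := (h.tail.tendsto_rpow_neg_div h1 (γ := α) (by linarith)).eventually
    (ge_mem_nhds one_pos)
  filter_upwards [ev1, ev2, eventually_gt_atTop 0, eventually_ge_atTop (T₁ / K),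
    eventually_ge_atTop (x₀ / (δ * K))] with x h2 h3 hx hxT hxx
  have hFx := h.tail.pos x
  refine (tailsum (K * x) (by positivity) ?_ ?_).trans ?_
  · rw [mul_comm]; exact (div_le_iff₀ hK0).1 hxT
  · have := (div_le_iff₀ (by positivity)).1 hxx
    linarith
  · rw [div_le_iff₀ hFx] at h2
    rw [div_le_iff₀ (by positivity), one_mul] at h3
    have e1 : 2 * (K * x) * F (δ * (K * x)) ≤ 4 * δ ^ (-α) * K ^ (1 - α) * (x * F x) := by
      have e : K ^ (1 - α) = K * K ^ (-α) := by
        rw [sub_eq_add_neg, Real.rpow_add hK0, Real.rpow_one]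
      rw [Real.mul_rpow hδ.le hK0.le] at h2
      rw [e, ← mul_assoc δ]
      calc 2 * (K * x) * F (δ * K * x) ≤ 2 * (K * x) * (2 * (δ ^ (-α) * K ^ (-α)) * F x) := by
            gcongr
        _ = _ := by ring
    have e2 : (K * x) ^ (-α) ≤ K ^ (1 - α) * (x * F x) := by
      rw [Real.mul_rpow hK0.le hx.le]
      have : K ^ (-α) ≤ K ^ (1 - α) := Real.rpow_le_rpow_of_exponent_le hK (by linarith)
      gcongr
    calc _ ≤ 4 * δ ^ (-α) * K ^ (1 - α) * (x * F x) / (1 - q₁) +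
          K ^ (1 - α) * (x * F x) / (1 - q₂) := by gcongr
      _ = _ := by ring

/-- Far apart exceedances are negligible. -/
theorem measureReal_two_exceedances_le (h : IsHeavyKDependent P X k α) (n : ℕ) (y : ℝ) :
    P.real {ω | ∃ i ∈ Finset.Icc 1 n, ∃ j ∈ Finset.Icc 1 n, i + k < j ∧
      y < |X (i : ℤ) ω| ∧ y < |X (j : ℤ) ω|} ≤ (n * absTail P (X 0) y) ^ 2 := by
  have hsub : {ω | ∃ i ∈ Finset.Icc 1 n, ∃ j ∈ Finset.Icc 1 n, i + k < j ∧
      y < |X (i : ℤ) ω| ∧ y < |X (j : ℤ) ω|} ⊆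
      ⋃ p ∈ (Finset.Icc 1 n ×ˢ Finset.Icc 1 n).filter (fun p => p.1 + k < p.2),
        {ω | y < |X (p.1 : ℤ) ω| ∧ y < |X (p.2 : ℤ) ω|} := by
    rintro ω ⟨i, hi, j, hj, hij, h1, h2⟩
    simp only [Set.mem_iUnion]
    exact ⟨(i, j), by simp only [Finset.mem_filter, Finset.mem_product]; exact ⟨⟨hi, hj⟩, hij⟩,
      h1, h2⟩
  refine (measureReal_mono hsub (measure_ne_top _ _)).trans
    ((measureReal_biUnion_finset_le _ _).trans ?_)
  calc _ ≤ ∑ p ∈ (Finset.Icc 1 n ×ˢ Finset.Icc 1 n).filter (fun p => p.1 + k < p.2),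
        absTail P (X 0) y * absTail P (X 0) y := by
        refine Finset.sum_le_sum fun p hp => le_of_eq ?_
        have := (Finset.mem_filter.1 hp).2
        exact h.dep.measureReal_two h.meas h.stat (by omega) y y
    _ ≤ ∑ p ∈ (Finset.Icc 1 n ×ˢ Finset.Icc 1 n), absTail P (X 0) y * absTail P (X 0) y := by
        refine Finset.sum_le_sum_of_subset_of_nonneg (Finset.filter_subset _ _) fun _ _ _ => ?_
        exact mul_self_nonneg _
    _ = _ := by simp; ring

end IsHeavyKDependent

/-! ### Windows and the radial power measure -/

/-- Real sequences indexed by the window `{-k, …, k}`. -/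
abbrev Win (k : ℕ) : Type := Set.Icc (-(k : ℤ)) (k : ℤ) → ℝ

/-- The time `0` as an element of the window. -/
def origin (k : ℕ) : Set.Icc (-(k : ℤ)) (k : ℤ) := ⟨0, by simp⟩

/-- The restriction of a process to the window. -/
def window {Ω : Type*} (X : ℤ → Ω → ℝ) (k : ℕ) (ω : Ω) : Win k := fun t => X t ω

theorem measurable_window {Ω : Type*} [MeasurableSpace Ω] {X : ℤ → Ω → ℝ}
    (hX : ∀ t, Measurable (X t)) (k : ℕ) : Measurable (window X k) :=
  measurable_pi_lambda _ fun t => hX t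

theorem measurable_spectralTail {Ω' : Type*} [MeasurableSpace Ω'] {Y : ℤ → Ω' → ℝ}
    (hY : ∀ t, Measurable (Y t)) (t : ℤ) : Measurable (spectralTail Y t) :=
  (hY t).div (hY 0).abs

theorem window_eq_smul_spectral {Ω' : Type*} {Y : ℤ → Ω' → ℝ} {k : ℕ} {ω : Ω'} (h : 1 < |Y 0 ω|) :
    window Y k ω = |Y 0 ω| • window (spectralTail Y) k ω := by
  ext t
  have : |Y 0 ω| ≠ 0 := by linarith
  simp only [window, spectralTail, Pi.smul_apply, smul_eq_mul]
  field_simp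

section PowerMeasure

/-- The measure `α z^{-α-1} dz` on `(0, ∞)`. -/
def powerMeasure (α : ℝ) : Measure ℝ :=
  (volume.restrict (Set.Ioi 0)).withDensity fun z => ENNReal.ofReal (α * z ^ (-α - 1))

instance (α : ℝ) : SigmaFinite (powerMeasure α) := by
  unfold powerMeasure; infer_instance

theorem powerMeasure_Ioi {α : ℝ} (hα : 0 < α) {u : ℝ} (hu : 0 < u) :
    powerMeasure α (Set.Ioi u) = ENNReal.ofReal (u ^ (-α)) := by
  rw [powerMeasure, withDensity_apply _ measurableSet_Ioi, Measure.restrict_restrict measurableSet_Ioi,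
    Set.inter_eq_left.2 (Set.Ioi_subset_Ioi hu.le)]
  have hi := (integrableOn_Ioi_rpow_of_lt (a := -α - 1) (by linarith) hu).const_mul α
  rw [← ofReal_integral_eq_lintegral_ofReal hi, integral_const_mul,
    integral_Ioi_rpow_of_lt (by linarith) hu]
  · congr 1
    rw [sub_add_cancel]
    field_simp
  · filter_upwards [ae_restrict_mem measurableSet_Ioi] with z hz
    have : 0 < z := hu.trans hz
    positivity

theorem powerMeasure_Iic_zero (α : ℝ) : powerMeasure α (Set.Iic 0) = 0 := by
  rw [powerMeasure, withDensity_apply _ measurableSet_Iic, Measure.restrict_restrict measurableSet_Iic,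
    Set.Iic_inter_Ioi]
  simp

theorem powerMeasure_lt_mul {α : ℝ} (hα : 0 < α) {c : ℝ} (hc : 0 < c) (H : ℝ) :
    powerMeasure α {z | c < z * H} = ENNReal.ofReal ((max H 0) ^ α * c ^ (-α)) := by
  rcases le_or_gt H 0 with h | h
  · have : {z | c < z * H} ⊆ Set.Iic 0 := by
      intro z (hz : c < z * H)
      by_contra hz'
      simp only [Set.mem_Iic, not_le] at hz'
      nlinarith
    rw [measure_mono_null this (powerMeasure_Iic_zero α), max_eq_right h,
      Real.zero_rpow hα.ne']
    simp
  · have : {z | c < z * H} = Set.Ioi (c / H) := by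
      ext z; simp [div_lt_iff₀ h]
    rw [this, powerMeasure_Ioi hα (by positivity), max_eq_left h.le]
    congr 1
    rw [Real.div_rpow hc.le h.le, Real.rpow_neg h.le, div_inv_eq_mul, mul_comm]

/-- By the layer-cake formula the integral is that of H_+^α (t+c)^{-α} over t > 0, which is the
source of the factor 1/(α-1). -/
theorem lintegral_powerMeasure_sub {α : ℝ} (hα : 1 < α) {c : ℝ} (hc : 0 < c) (H : ℝ) :
    ∫⁻ z, ENNReal.ofReal (max (z * H - c) 0) ∂(powerMeasure α) =
      ENNReal.ofReal ((max H 0) ^ α * (c ^ (1 - α) / (α - 1))) := by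
  have hm : Measurable (fun z : ℝ => max (z * H - c) 0) :=
    ((measurable_id.mul_const H).sub_const c).max measurable_const
  rw [lintegral_eq_lintegral_meas_lt (f := fun z : ℝ => max (z * H - c) 0) _ (ae_of_all _ fun z => le_max_right _ _) hm.aemeasurable]
  have hH : 0 ≤ (max H 0) ^ α := Real.rpow_nonneg (le_max_right _ _) _
  have e : ∀ t ∈ Set.Ioi (0 : ℝ), powerMeasure α {a | t < max (a * H - c) 0} =
      ENNReal.ofReal ((max H 0) ^ α * (t + c) ^ (-α)) := by
    intro t (ht : 0 < t)
    rw [← powerMeasure_lt_mul (by linarith) (by positivity)]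
    congr 1
    ext z
    simp only [Set.mem_ofPred_eq, lt_max_iff]
    constructor
    · rintro (h | h) <;> linarith
    · intro h; left; linarith
  rw [setLIntegral_congr_fun measurableSet_Ioi e]
  have hi : IntegrableOn (fun t : ℝ => (t + c) ^ (-α)) (Set.Ioi 0) :=
    integrableOn_add_rpow_Ioi_of_lt (by linarith) (by linarith)
  rw [← ofReal_integral_eq_lintegral_ofReal (hi.const_mul _), integral_const_mul]
  · congr 2
    have h1 : ∫ t in Set.Ioi (0 : ℝ), (t + c) ^ (-α) = ∫ t in Set.Ioi c, t ^ (-α) := by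
      rw [← integral_indicator measurableSet_Ioi, ← integral_indicator measurableSet_Ioi,

        ← integral_add_right_eq_self ((Set.Ioi c).indicator fun t : ℝ => t ^ (-α)) c]
      congr 1
      ext t
      simp [Set.indicator]
    rw [h1, integral_Ioi_rpow_of_lt (by linarith) hc]
    rw [show -α + 1 = 1 - α by ring, show (1 - α : ℝ) = -(α - 1) by ring, neg_div_neg_eq]
  · filter_upwards [ae_restrict_mem measurableSet_Ioi] with t ht
    have : (0 : ℝ) < t := ht
    positivity

end PowerMeasure

/-! ### Polar decomposition of the tail process -/

section TailProcess

variable {Ω Ω' : Type*} [MeasurableSpace Ω] [MeasurableSpace Ω'] {P : Measure Ω}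
  {X : ℤ → Ω → ℝ} {α : ℝ} {Q : Measure Ω'}
  {Y : ℤ → Ω' → ℝ} {k : ℕ}

/-- The defining convergence is used at the threshold δx instead of x; regular variation of the tail
supplies the factor δ^{-α}. -/
theorem IsTailProcess.tendsto_restrict (hX : ∀ t, Measurable (X t))
    (hF : RegVar (absTail P (X 0)) α) (hY : IsTailProcess P X α Q Y) {f : Win k → ℝ}
    (hf : Continuous f) {B : ℝ} (hB : ∀ y, |f y| ≤ B) {δ : ℝ} (hδ : 0 < δ) :
    Tendsto (fun x : ℝ => (∫ ω in {ω | δ * x < |X 0 ω|}, f (x⁻¹ • window X k ω) ∂P) /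
      absTail P (X 0) x) atTop (𝓝 (δ ^ (-α) * ∫ ω, f (δ • window Y k ω) ∂Q)) := by
  have hg : Continuous (fun y : Win k => f (δ • y)) := hf.comp (continuous_const_smul δ)
  let g : BoundedContinuousFunction (Win k) ℝ :=
    BoundedContinuousFunction.ofNormedAddCommGroup (fun y => f (δ • y)) hg B fun y => hB _
  have h1 := hY.tendsto k g
  have hYm : Measurable (window Y k) := measurable_window hY.measurable k
  have e1 : ∫ v, g v ∂(Q.map (fun ω (t : Set.Icc (-(k : ℤ)) (k : ℤ)) => Y t ω)) =
      ∫ ω, f (δ • window Y k ω) ∂Q :=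
    integral_map hYm.aemeasurable hg.aestronglyMeasurable
  have hA : ∀ x : ℝ, MeasurableSet {ω | x < |X 0 ω|} := fun x =>
    measurableSet_lt measurable_const (hX 0).abs
  have e2 : ∀ x : ℝ, ∫ v, g v ∂((cond P {ω | x < |X 0 ω|}).map
      (fun ω (t : Set.Icc (-(k : ℤ)) (k : ℤ)) => x⁻¹ * X t ω)) =
      (absTail P (X 0) x)⁻¹ * ∫ ω in {ω | x < |X 0 ω|}, f (δ • (x⁻¹ • window X k ω)) ∂P := by
    intro x
    have hwm : Measurable (fun ω (t : Set.Icc (-(k : ℤ)) (k : ℤ)) => x⁻¹ * X t ω) :=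
      measurable_pi_lambda _ fun t => (hX t).const_mul _
    rw [integral_map hwm.aemeasurable g.continuous.aestronglyMeasurable]
    rw [ProbabilityTheory.cond, integral_smul_measure, ENNReal.toReal_inv]
    rfl
  rw [e1] at h1
  simp_rw [e2] at h1
  have hδx : Tendsto (fun x : ℝ => δ * x) atTop atTop := tendsto_id.const_mul_atTop hδ
  have h2 := (hF.tendsto δ hδ).mul (h1.comp hδx)
  refine h2.congr' ?_
  filter_upwards [eventually_gt_atTop 0] with x hx
  have e3 : ∀ ω, δ • ((δ * x)⁻¹ • window X k ω) = x⁻¹ • window X k ω := fun ω => by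
    rw [smul_smul]; congr 1; field_simp
  simp only [Function.comp, e3]
  have := (hF.pos (δ * x)).ne'
  have := (hF.pos x).ne'
  field_simp

/-- Since f ignores windows with |y_0| ≤ u, the thresholds x and ux yield the same integral before
the limit. Equating the two limits expresses the homogeneity of the tail measure. -/
theorem IsTailProcess.integral_rescale (hX : ∀ t, Measurable (X t))
    (hF : RegVar (absTail P (X 0)) α) (hY : IsTailProcess P X α Q Y) {f : Win k → ℝ}
    (hf : Continuous f) {B : ℝ} (hB : ∀ y, |f y| ≤ B) {u : ℝ} (hu : 1 ≤ u)
    (hfu : ∀ y, |y (origin k)| ≤ u → f y = 0) :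
    ∫ ω, f (window Y k ω) ∂Q = u ^ (-α) * ∫ ω, f (u • window Y k ω) ∂Q := by
  have h1 := hY.tendsto_restrict hX hF hf hB one_pos
  have h2 := hY.tendsto_restrict hX hF hf hB (show 0 < u by linarith)
  simp only [Real.one_rpow, one_mul, one_smul] at h1
  refine tendsto_nhds_unique_of_eventuallyEq h1 h2 ?_
  filter_upwards [eventually_gt_atTop 0] with x hx
  congr 1
  have hA : ∀ x : ℝ, MeasurableSet {ω | x < |X 0 ω|} := fun x =>
    measurableSet_lt measurable_const (hX 0).abs
  rw [← integral_indicator (hA _), ← integral_indicator (hA _)]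
  congr 1
  ext ω
  by_cases h : u * x < |X 0 ω|
  · have h' : x < |X 0 ω| := by nlinarith
    rw [Set.indicator_of_mem (show ω ∈ {ω | x < |X 0 ω|} from h'),
      Set.indicator_of_mem (show ω ∈ {ω | u * x < |X 0 ω|} from h)]
  · rw [Set.indicator_of_notMem (show ω ∉ {ω | u * x < |X 0 ω|} from h)]
    have : f (x⁻¹ • window X k ω) = 0 := by
      apply hfu
      simp only [Pi.smul_apply, smul_eq_mul, abs_mul, abs_inv, abs_of_pos hx]
      rw [inv_mul_le_iff₀ hx, mul_comm]
      exact not_lt.1 h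
    simp [Set.indicator, this]

variable [IsProbabilityMeasure Q]

/-- The Pareto law is prescribed only for y > 1; letting y decrease to 1 gives full mass. -/
theorem IsTailProcess.ae_one_lt (hY : IsTailProcess P X α Q Y) : ∀ᵐ ω ∂Q, 1 < |Y 0 ω| := by
  have hm : MeasurableSet {ω | 1 < |Y 0 ω|} :=
    measurableSet_lt measurable_const (hY.measurable 0).abs
  refine (prob_compl_eq_zero_iff hm).2 (le_antisymm prob_le_one ?_)
  have hlim : Tendsto (fun n : ℕ => ENNReal.ofReal ((1 + 1 / ((n : ℝ) + 1)) ^ (-α))) atTop (𝓝 1) := by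
    rw [← ENNReal.ofReal_one]
    apply ENNReal.tendsto_ofReal
    have h1 : Tendsto (fun n : ℕ => 1 + 1 / ((n : ℝ) + 1)) atTop (𝓝 1) := by
      simpa using tendsto_one_div_add_atTop_nhds_zero_nat.const_add (1 : ℝ)
    simpa using h1.rpow_const (p := -α) (Or.inl one_ne_zero)
  refine le_of_tendsto' hlim fun n => ?_
  have hn : 1 < 1 + 1 / ((n : ℝ) + 1) := by
    have : 0 < 1 / ((n : ℝ) + 1) := by positivity
    linarith
  rw [← hY.pareto _ hn]
  exact measure_mono fun ω (hω : _ < _) => hn.trans hω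

/-- Integration of functions of the spectral tail process over `{|Y_0| > u}`. -/
theorem IsTailProcess.setIntegral_spectral (hX : ∀ t, Measurable (X t))
    (hF : RegVar (absTail P (X 0)) α) (hY : IsTailProcess P X α Q Y) {f : Win k → ℝ}
    (hf : Continuous f) {B : ℝ} (hB : ∀ y, |f y| ≤ B) {u : ℝ} (hu : 1 ≤ u) :
    ∫ ω in {ω | u < |Y 0 ω|}, f (window (spectralTail Y) k ω) ∂Q =
      u ^ (-α) * ∫ ω, f (window (spectralTail Y) k ω) ∂Q := by
  have hu0 : 0 < u := by linarith
  have hB0 : 0 ≤ B := (abs_nonneg _).trans (hB 0)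
  have hYm : Measurable (window Y k) := measurable_window hY.measurable k
  -- A continuous ramp converging to the indicator of |y_0| > u and vanishing off that set, so that
  -- `integral_rescale` applies.
  set r : ℕ → Win k → ℝ := fun n y => min 1 (n * max (|y (origin k)| - u) 0) with hr
  have hrc : ∀ n, Continuous (r n) := fun n => by
    have : Continuous (fun y : Win k => y (origin k)) := continuous_apply _
    fun_prop
  have hr0 : ∀ n y, 0 ≤ r n y := fun n y => by positivity
  have hr1 : ∀ n y, r n y ≤ 1 := fun n y => min_le_left _ _
  have hrlim : ∀ y, u < |y (origin k)| → Tendsto (fun n => r n y) atTop (𝓝 1) := by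
    intro y hy
    have hpos : 0 < max (|y (origin k)| - u) 0 := lt_max_of_lt_left (by linarith)
    refine tendsto_const_nhds.congr' ?_
    obtain ⟨N, hN⟩ := exists_nat_ge (1 / max (|y (origin k)| - u) 0)
    filter_upwards [eventually_ge_atTop N] with n hn
    have : (N : ℝ) ≤ n := by exact_mod_cast hn
    rw [div_le_iff₀ hpos] at hN
    exact (min_eq_left (hN.trans (by gcongr))).symm
  have hrz : ∀ n y, |y (origin k)| ≤ u → r n y = 0 := by
    intro n y hy
    simp only [hr]
    rw [max_eq_right (by linarith)]; simp
  -- Dividing by max(|y_0|, u) is continuous everywhere and equals division by |y_0| where the ramp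
  -- is nonzero. Hence scaling y by u changes only the ramp in the limit.
  set g : ℕ → Win k → ℝ := fun n y => f ((max |y (origin k)| u)⁻¹ • y) * r n y with hg
  have hgc : ∀ n, Continuous (g n) := fun n => by
    have h0 : Continuous (fun y : Win k => max |y (origin k)| u) := by
      have : Continuous (fun y : Win k => y (origin k)) := continuous_apply _
      fun_prop
    have hinv := h0.inv₀ fun y => (lt_max_of_lt_right hu0).ne'
    exact (hf.comp (hinv.smul continuous_id)).mul (hrc n)
  have hgB : ∀ n y, |g n y| ≤ B := fun n y => by
    simp only [hg]
    rw [abs_mul, abs_of_nonneg (hr0 n y)]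
    calc _ ≤ B * 1 := mul_le_mul (hB _) (hr1 n y) (hr0 n y) hB0
      _ = B := mul_one B
  have hgz : ∀ n y, |y (origin k)| ≤ u → g n y = 0 := fun n y hy => by
    simp only [hg, hrz n y hy, mul_zero]
  have heq : ∀ n, ∫ ω, g n (window Y k ω) ∂Q = u ^ (-α) * ∫ ω, g n (u • window Y k ω) ∂Q :=
    fun n => hY.integral_rescale hX hF (hgc n) (hgB n) hu (hgz n)
  have hA : MeasurableSet {ω | u < |Y 0 ω|} :=
    measurableSet_lt measurable_const (hY.measurable 0).abs
  have lim1 : Tendsto (fun n => ∫ ω, g n (window Y k ω) ∂Q) atTop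
      (𝓝 (∫ ω in {ω | u < |Y 0 ω|}, f (window (spectralTail Y) k ω) ∂Q)) := by
    rw [← integral_indicator hA]
    refine tendsto_integral_of_dominated_convergence (fun _ => B)
      (fun n => ((hgc n).measurable.comp hYm).aestronglyMeasurable) (integrable_const B)
      (fun n => ae_of_all _ fun ω => hgB n _) (ae_of_all _ fun ω => ?_)
    by_cases h : u < |Y 0 ω|
    · rw [Set.indicator_of_mem (show ω ∈ {ω | u < |Y 0 ω|} from h)]
      have h0 : |window Y k ω (origin k)| = |Y 0 ω| := rfl
      have e : (max |window Y k ω (origin k)| u)⁻¹ • window Y k ω =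
          window (spectralTail Y) k ω := by
        rw [h0, max_eq_left h.le]
        ext t
        simp [window, spectralTail, div_eq_inv_mul]
      simp only [hg, e]
      simpa using (hrlim (window Y k ω) h).const_mul (f (window (spectralTail Y) k ω))
    · rw [Set.indicator_of_notMem (show ω ∉ {ω | u < |Y 0 ω|} from h)]
      simp only [hgz _ (window Y k ω) (not_lt.1 h)]
      exact tendsto_const_nhds
  have lim2 : Tendsto (fun n => ∫ ω, g n (u • window Y k ω) ∂Q) atTop
      (𝓝 (∫ ω, f (window (spectralTail Y) k ω) ∂Q)) := by
    refine tendsto_integral_of_dominated_convergence (fun _ => B)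
      (fun n => ((hgc n).measurable.comp (hYm.const_smul u)).aestronglyMeasurable)
      (integrable_const B) (fun n => ae_of_all _ fun ω => hgB n _) ?_
    filter_upwards [hY.ae_one_lt] with ω hω
    have h0 : |(u • window Y k ω) (origin k)| = u * |Y 0 ω| := by
      simp only [Pi.smul_apply, smul_eq_mul, abs_mul, abs_of_pos hu0]; rfl
    have h : u < u * |Y 0 ω| := by nlinarith
    have e : (max |(u • window Y k ω) (origin k)| u)⁻¹ • (u • window Y k ω) =
        window (spectralTail Y) k ω := by
      rw [h0, max_eq_left h.le]
      ext t
      simp only [window, spectralTail, Pi.smul_apply, smul_eq_mul]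
      field_simp
    simp only [hg, e]
    simpa using (hrlim (u • window Y k ω) (by rw [h0]; exact h)).const_mul
      (f (window (spectralTail Y) k ω))
  exact tendsto_nhds_unique lim1 ((lim2.const_mul _).congr fun n => (heq n).symm)

/-- The law of the spectral tail process on the window. -/
def spectralLaw (Q : Measure Ω') (Y : ℤ → Ω' → ℝ) (k : ℕ) : Measure (Win k) :=
  Q.map (window (spectralTail Y) k)

theorem measurable_window_spectralTail (hY : ∀ t, Measurable (Y t)) (k : ℕ) :
    Measurable (window (spectralTail Y) k) :=
  measurable_window (measurable_spectralTail hY) k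

theorem IsTailProcess.isProbabilityMeasure_spectralLaw (hY : IsTailProcess P X α Q Y) (k : ℕ) :
    IsProbabilityMeasure (spectralLaw Q Y k) :=
  Measure.isProbabilityMeasure_map (measurable_window_spectralTail hY.measurable k).aemeasurable

/-- Independence of Θ and |Y_0|: the identity is known for bounded continuous functions, which
determine finite measures. -/
theorem IsTailProcess.measure_spectral_inter (hX : ∀ t, Measurable (X t))
    (hF : RegVar (absTail P (X 0)) α) (hY : IsTailProcess P X α Q Y) {u : ℝ} (hu : 1 ≤ u)
    {s : Set (Win k)} (hs : MeasurableSet s) :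
    Q {ω | window (spectralTail Y) k ω ∈ s ∧ u < |Y 0 ω|} =
      ENNReal.ofReal (u ^ (-α)) * spectralLaw Q Y k s := by
  have hu0 : 0 < u := by linarith
  have hm := measurable_window_spectralTail hY.measurable k
  have := hY.isProbabilityMeasure_spectralLaw k
  have key : (Q.restrict {ω | u < |Y 0 ω|}).map (window (spectralTail Y) k) =
      ENNReal.ofReal (u ^ (-α)) • spectralLaw Q Y k := by
    have : IsFiniteMeasure (ENNReal.ofReal (u ^ (-α)) • spectralLaw Q Y k) :=
      Measure.smul_finite _ ENNReal.ofReal_ne_top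
    refine ext_of_forall_integral_eq_of_IsFiniteMeasure fun f => ?_
    rw [integral_map hm.aemeasurable f.continuous.aestronglyMeasurable, integral_smul_measure,
      spectralLaw, integral_map hm.aemeasurable f.continuous.aestronglyMeasurable,
      hY.setIntegral_spectral hX hF f.continuous (fun y => f.norm_coe_le_norm y) hu,
      ENNReal.toReal_ofReal (by positivity), smul_eq_mul]
  have h1 := congrArg (fun m => m s) key
  simp only [Measure.map_apply hm hs, Measure.smul_apply, smul_eq_mul] at h1
  rw [← h1, Measure.restrict_apply (hm hs)]
  rfl

/-- Polar decomposition of the tail process. -/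
theorem IsTailProcess.map_polar (hX : ∀ t, Measurable (X t)) (hα : 0 < α)
    (hF : RegVar (absTail P (X 0)) α) (hY : IsTailProcess P X α Q Y) {δ : ℝ} (hδ : 0 < δ) :
    (spectralLaw Q Y k).prod ((powerMeasure α).restrict (Set.Ioi δ)) =
      ENNReal.ofReal (δ ^ (-α)) • Q.map (fun ω => (window (spectralTail Y) k ω, δ * |Y 0 ω|)) := by
  have hm := measurable_window_spectralTail hY.measurable k
  have hm2 : Measurable (fun ω => δ * |Y 0 ω|) := (hY.measurable 0).abs.const_mul δ
  have := hY.isProbabilityMeasure_spectralLaw k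
  refine Measure.prod_eq fun s t hs ht => ?_
  have hfin : IsFiniteMeasure ((powerMeasure α).restrict (Set.Ioi δ)) := ⟨by
    rw [Measure.restrict_apply_univ, powerMeasure_Ioi hα hδ]; exact ENNReal.ofReal_lt_top⟩
  set m₁ : Measure ℝ := ENNReal.ofReal (δ ^ (-α)) •
    (Q.restrict {ω | window (spectralTail Y) k ω ∈ s}).map (fun ω => δ * |Y 0 ω|) with hm₁
  have f1 : IsFiniteMeasure m₁ := Measure.smul_finite _ ENNReal.ofReal_ne_top
  have f2 : IsFiniteMeasure (spectralLaw Q Y k s • (powerMeasure α).restrict (Set.Ioi δ)) :=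
    Measure.smul_finite _ (measure_ne_top _ _)
  have hm1app : ∀ t, MeasurableSet t → m₁ t = ENNReal.ofReal (δ ^ (-α)) *
      Q {ω | window (spectralTail Y) k ω ∈ s ∧ δ * |Y 0 ω| ∈ t} := by
    intro t ht
    rw [hm₁, Measure.smul_apply, Measure.map_apply hm2 ht, Measure.restrict_apply (hm2 ht),
      smul_eq_mul]
    congr 2
    ext ω
    exact and_comm
  have hfull : ∀ t, MeasurableSet t → Set.Ioi δ ⊆ t →
      m₁ t = (spectralLaw Q Y k s • (powerMeasure α).restrict (Set.Ioi δ)) t := by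
    intro t ht hsub
    rw [hm1app t ht, Measure.smul_apply, Measure.restrict_apply ht, Set.inter_eq_right.2 hsub,
      powerMeasure_Ioi hα hδ, smul_eq_mul, mul_comm]
    congr 1
    rw [spectralLaw, Measure.map_apply hm hs]
    refine measure_congr ?_
    filter_upwards [hY.ae_one_lt] with ω hω
    apply propext
    change (_ ∧ _) ↔ _
    exact and_iff_left (hsub (show δ < δ * |Y 0 ω| by nlinarith))
  -- Half-lines form a generating π-system. Below δ both sides carry full mass because |Y_0| > 1
  -- almost surely; above δ the identity is the independence at level u/δ.
  have hext : m₁ = spectralLaw Q Y k s • (powerMeasure α).restrict (Set.Ioi δ) := by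
    refine ext_of_generate_finite (Set.range Set.Ioi)
      ((BorelSpace.measurable_eq (α := ℝ)).trans (borel_eq_generateFrom_Ioi ℝ)) isPiSystem_Ioi ?_
      (hfull _ MeasurableSet.univ (Set.subset_univ _))
    rintro _ ⟨u, rfl⟩
    rcases le_or_gt u δ with hu | hu
    · exact hfull _ measurableSet_Ioi (Set.Ioi_subset_Ioi hu)
    · have hu0 : 0 < u := hδ.trans hu
      have h1 : 1 ≤ u / δ := (one_le_div hδ).2 hu.le
      rw [hm1app _ measurableSet_Ioi, Measure.smul_apply, Measure.restrict_apply measurableSet_Ioi,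
        Set.inter_eq_left.2 (Set.Ioi_subset_Ioi hu.le), powerMeasure_Ioi hα hu0, smul_eq_mul]
      have e : {ω | window (spectralTail Y) k ω ∈ s ∧ δ * |Y 0 ω| ∈ Set.Ioi u} =
          {ω | window (spectralTail Y) k ω ∈ s ∧ u / δ < |Y 0 ω|} := by
        ext ω
        simp only [Set.mem_ofPred_eq, Set.mem_Ioi, div_lt_iff₀ hδ, mul_comm]
      rw [e, hY.measure_spectral_inter hX hF h1 hs, ← mul_assoc,
        ← ENNReal.ofReal_mul (by positivity), ← Real.mul_rpow hδ.le (by positivity),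
        mul_div_cancel₀ _ hδ.ne', mul_comm]
  have := congrArg (fun m => m t) hext
  simp only [hm1app t ht, Measure.smul_apply, smul_eq_mul] at this
  rw [← this, Measure.smul_apply, Measure.map_apply (hm.prodMk hm2) (hs.prod ht)]
  rfl

/-- Limits of the exceedance functionals in polar coordinates. -/
theorem IsTailProcess.tendsto_restrict_polar (hX : ∀ t, Measurable (X t)) (hα : 0 < α)
    (hF : RegVar (absTail P (X 0)) α) (hY : IsTailProcess P X α Q Y) {f : Win k → ℝ}
    (hf : Continuous f) (hf0 : ∀ y, 0 ≤ f y) {B : ℝ} (hB : ∀ y, f y ≤ B) {δ : ℝ} (hδ : 0 < δ) :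
    Tendsto (fun x : ℝ => (∫ ω in {ω | δ * x < |X 0 ω|}, f (x⁻¹ • window X k ω) ∂P) /
      absTail P (X 0) x) atTop (𝓝 (∫⁻ p in {p : Win k × ℝ | δ < p.2},
        ENNReal.ofReal (f (p.2 • p.1)) ∂((spectralLaw Q Y k).prod (powerMeasure α))).toReal) := by
  have hB' : ∀ y, |f y| ≤ B := fun y => by rw [abs_of_nonneg (hf0 y)]; exact hB y
  have h := hY.tendsto_restrict hX hF hf hB' hδ
  convert h using 2
  have hm := measurable_window_spectralTail hY.measurable k
  have hm2 : Measurable (fun ω => δ * |Y 0 ω|) := (hY.measurable 0).abs.const_mul δ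
  have := hY.isProbabilityMeasure_spectralLaw k
  have e1 : ((spectralLaw Q Y k).prod (powerMeasure α)).restrict {p : Win k × ℝ | δ < p.2} =
      (spectralLaw Q Y k).prod ((powerMeasure α).restrict (Set.Ioi δ)) := by
    have : {p : Win k × ℝ | δ < p.2} = Set.univ ×ˢ Set.Ioi δ := by ext; simp
    rw [this, ← Measure.prod_restrict, Measure.restrict_univ]
  have hfm : Measurable (fun p : Win k × ℝ => ENNReal.ofReal (f (p.2 • p.1))) :=
    (hf.measurable.comp (measurable_snd.smul measurable_fst)).ennreal_ofReal
  rw [e1, hY.map_polar hX hα hF hδ, lintegral_smul_measure,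
    lintegral_map hfm (hm.prodMk hm2), smul_eq_mul, ENNReal.toReal_mul,
    ENNReal.toReal_ofReal (by positivity)]
  congr 1
  rw [integral_eq_lintegral_of_nonneg_ae (ae_of_all _ fun ω => hf0 _)]
  · congr 1
    refine lintegral_congr_ae ?_
    filter_upwards [hY.ae_one_lt] with ω hω
    rw [window_eq_smul_spectral hω, smul_smul]
  · exact (hf.measurable.comp
      ((measurable_window hY.measurable k).const_smul δ)).aestronglyMeasurable

end TailProcess

theorem powerMeasure_restrict_Ioi_zero (α : ℝ) :
    (powerMeasure α).restrict (Set.Ioi 0) = powerMeasure α := by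
  refine Measure.restrict_eq_self_of_ae_mem ?_
  rw [ae_iff]
  convert powerMeasure_Iic_zero α using 2
  ext z; simp

/-! ### Cutoffs and cluster functionals -/

section Window

variable {k : ℕ}

/-- A continuous cutoff which localizes the negative coordinates near zero. -/
def cutoff (κ δ : ℝ) (y : Win k) : ℝ :=
  ∏ t : Set.Icc (-(k : ℤ)) (k : ℤ), if (t : ℤ) < 0 then max 0 (min 1 (2 - κ * |y t| / δ)) else 1

theorem continuous_cutoff (κ δ : ℝ) : Continuous (cutoff κ δ : Win k → ℝ) := by
  refine continuous_finsetProd _ fun t _ => ?_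
  split_ifs
  · have : Continuous (fun y : Win k => y t) := continuous_apply _
    fun_prop
  · exact continuous_const

theorem cutoff_nonneg (κ δ : ℝ) (y : Win k) : 0 ≤ cutoff κ δ y :=
  Finset.prod_nonneg fun t _ => by split_ifs <;> positivity

theorem cutoff_le_one (κ δ : ℝ) (y : Win k) : cutoff κ δ y ≤ 1 :=
  Finset.prod_le_one (fun t _ => by split_ifs <;> positivity) fun t _ => by
    split_ifs
    · exact max_le zero_le_one (min_le_left _ _)
    · exact le_rfl

/-- For κ = 1 the cutoff therefore dominates the indicator that no negative coordinate exceeds δ;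
this version serves upper bounds. -/
theorem cutoff_eq_one {κ δ : ℝ} (hδ : 0 < δ) {y : Win k}
    (h : ∀ t : Set.Icc (-(k : ℤ)) (k : ℤ), (t : ℤ) < 0 → κ * |y t| ≤ δ) : cutoff κ δ y = 1 := by
  refine Finset.prod_eq_one fun t _ => ?_
  split_ifs with ht
  · have : κ * |y t| / δ ≤ 1 := (div_le_one hδ).2 (h t ht)
    rw [min_eq_left (by linarith), max_eq_right zero_le_one]
  · rfl

/-- For κ = 2 the cutoff dies as soon as a negative coordinate reaches δ, so it lies below the same
indicator and serves the lower bound. -/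
theorem cutoff_eq_zero {κ δ : ℝ} (hδ : 0 < δ) {y : Win k} {t : Set.Icc (-(k : ℤ)) (k : ℤ)}
    (ht : (t : ℤ) < 0) (h : 2 * δ ≤ κ * |y t|) : cutoff κ δ y = 0 := by
  refine Finset.prod_eq_zero (Finset.mem_univ t) ?_
  rw [if_pos ht, max_eq_left]
  have : 2 ≤ κ * |y t| / δ := (le_div_iff₀ hδ).2 h
  exact (min_le_right _ _).trans (by linarith)

/-- Windows vanishing at negative times. -/
def zeroPastWin (k : ℕ) : Set (Win k) :=
  {θ | ∀ t : Set.Icc (-(k : ℤ)) (k : ℤ), (t : ℤ) < 0 → θ t = 0}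

theorem measurableSet_zeroPastWin (k : ℕ) : MeasurableSet (zeroPastWin k) := by
  simp only [zeroPastWin, Set.ofPred_forall]
  exact MeasurableSet.iInter fun t => MeasurableSet.iInter fun _ =>
    measurableSet_eq_fun (measurable_pi_apply t) measurable_const

/-- The coordinates `0, …, k` of a window. -/
def posPart (y : Win k) : Fin (k + 1) → ℝ := fun i => y ⟨((i : ℕ) : ℤ), by
  have := i.2; simp only [Set.mem_Icc]; omega⟩

/-- The maximal partial sum over the coordinates `0, …, k`. -/
def maxSum (y : Win k) : ℝ := ⨆ t : Fin (k + 1), ∑ i ∈ Finset.Iic t, posPart y i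

theorem continuous_maxSum : Continuous (maxSum : Win k → ℝ) := by
  have : (maxSum : Win k → ℝ) = fun y => Finset.univ.sup' Finset.univ_nonempty
      fun t : Fin (k + 1) => ∑ i ∈ Finset.Iic t, posPart y i := by
    funext y
    rw [Finset.sup'_univ_eq_ciSup]
    rfl
  rw [this]
  refine Continuous.finset_sup'_apply _ fun t _ => ?_
  exact continuous_finsetSum _ fun i _ => continuous_apply _

theorem sum_posPart_le_maxSum (y : Win k) (t : Fin (k + 1)) :
    ∑ i ∈ Finset.Iic t, posPart y i ≤ maxSum y :=
  le_ciSup (f := fun t : Fin (k + 1) => ∑ i ∈ Finset.Iic t, posPart y i)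
    (Set.finite_range _).bddAbove t

theorem exists_maxSum_eq (y : Win k) :
    ∃ t : Fin (k + 1), ∑ i ∈ Finset.Iic t, posPart y i = maxSum y :=
  exists_eq_ciSup_of_finite

theorem maxSum_smul {z : ℝ} (hz : 0 ≤ z) (y : Win k) : maxSum (z • y) = z * maxSum y := by
  rw [maxSum, maxSum, Real.mul_iSup_of_nonneg hz]
  refine iSup_congr fun t => ?_
  rw [Finset.mul_sum]
  rfl

theorem maxSum_le {c : ℝ} (hc : 0 ≤ c) {y : Win k} (h : ∀ t, |y t| ≤ c / (k + 1)) :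
    maxSum y ≤ c := by
  refine ciSup_le fun t => ?_
  calc ∑ i ∈ Finset.Iic t, posPart y i ≤ ∑ i ∈ Finset.Iic t, c / (k + 1) :=
        Finset.sum_le_sum fun i _ => (le_abs_self _).trans (h _)
    _ ≤ ∑ i : Fin (k + 1), c / (k + 1) :=
        Finset.sum_le_sum_of_subset_of_nonneg (Finset.subset_univ _) fun _ _ _ => by positivity
    _ = c := by simp; field_simp

/-- The functional `min(K, (max_l ∑_{i ≤ l} y_i - c)_+ / ρ)`. -/
def excess (c ρ K : ℝ) (y : Win k) : ℝ := min K (max (maxSum y - c) 0 / ρ)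

theorem continuous_excess (c ρ K : ℝ) : Continuous (excess c ρ K : Win k → ℝ) := by
  have := continuous_maxSum (k := k)
  unfold excess
  fun_prop

theorem excess_nonneg {c ρ K : ℝ} (hρ : 0 < ρ) (hK : 0 ≤ K) (y : Win k) : 0 ≤ excess c ρ K y :=
  le_min hK (div_nonneg (le_max_right _ _) hρ.le)

/-- The functional vanishes near the origin, as it must be integrated against a measure with
infinite mass near z = 0. -/
theorem excess_eq_zero {c ρ K : ℝ} (hc : 0 ≤ c) (hK : 0 ≤ K) {y : Win k}
    (h : ∀ t, |y t| ≤ c / (k + 1)) : excess c ρ K y = 0 := by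
  have := maxSum_le hc h
  rw [excess, max_eq_right (by linarith), zero_div, min_eq_right hK]

end Window

/-! ### The limit measure near the origin and the cluster constant -/

section TailProcess

variable {Ω Ω' : Type*} [MeasurableSpace Ω] [MeasurableSpace Ω'] {P : Measure Ω}
  {X : ℤ → Ω → ℝ} {α : ℝ} {Q : Measure Ω'} [IsProbabilityMeasure Q]
  {Y : ℤ → Ω' → ℝ} {k : ℕ}

/-- The limit measure of the exceedances, in polar coordinates. -/
abbrev polarMeasure (Q : Measure Ω') (Y : ℤ → Ω' → ℝ) (k : ℕ) (α : ℝ) : Measure (Win k × ℝ) :=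
  (spectralLaw Q Y k).prod (powerMeasure α)

/-- A small z may come with a large θ_t, so finiteness is not automatic. On z > δ the measure is a
limit of quantities at most P(|X_t| > cx/2)/F(x), and stationarity replaces X_t by X_0. The bound is
free of δ and passes to the increasing union. The factor 1/2 is the width of the continuous ramp. -/
theorem IsTailProcess.polarMeasure_lt_mul_abs [IsProbabilityMeasure P]
    (hX : ∀ t, Measurable (X t)) (hs : IsStrictlyStationary P X) (hα : 0 < α)
    (hF : RegVar (absTail P (X 0)) α) (hY : IsTailProcess P X α Q Y) {c : ℝ} (hc : 0 < c)
    (t : Set.Icc (-(k : ℤ)) (k : ℤ)) :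
    polarMeasure Q Y k α {p | c < p.2 * |p.1 t|} ≤ ENNReal.ofReal ((c / 2) ^ (-α)) := by
  have := hY.isProbabilityMeasure_spectralLaw k
  set f : Win k → ℝ := fun y => min 1 (max (2 * |y t| / c - 1) 0) with hf
  have hfc : Continuous f := by
    have : Continuous (fun y : Win k => y t) := continuous_apply _
    fun_prop
  have hf0 : ∀ y, 0 ≤ f y := fun y => by positivity
  have hf1 : ∀ y, f y ≤ 1 := fun y => min_le_left _ _
  have hfz : ∀ y, |y t| ≤ c / 2 → f y = 0 := fun y hy => by
    have : 2 * |y t| / c ≤ 1 := (div_le_one hc).2 (by linarith)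
    simp only [hf]
    rw [max_eq_right (by linarith), min_eq_right zero_le_one]
  have hfo : ∀ y, c ≤ |y t| → f y = 1 := fun y hy => by
    have : 2 ≤ 2 * |y t| / c := (le_div_iff₀ hc).2 (by linarith)
    simp only [hf]
    rw [max_eq_left (by linarith), min_eq_left (by linarith)]
  have hδ : ∀ δ : ℝ, 0 < δ → polarMeasure Q Y k α {p | δ < p.2 ∧ c < p.2 * |p.1 t|} ≤
      ENNReal.ofReal ((c / 2) ^ (-α)) := by
    intro δ hδ
    have hlim := hY.tendsto_restrict_polar (k := k) hX hα hF hfc hf0 hf1 hδ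
    have hlim2 := hF.tendsto (c / 2) (by positivity)
    have hle := le_of_tendsto_of_tendsto hlim hlim2 (by
      filter_upwards [eventually_gt_atTop 0] with x hx
      refine div_le_div_of_nonneg_right ?_ (hF.pos x).le
      have hm : MeasurableSet {ω | c / 2 * x < |X t ω|} :=
        measurableSet_lt measurable_const (hX t).abs
      have hfm : Measurable (fun ω => f (x⁻¹ • window X k ω)) :=
        hfc.measurable.comp ((measurable_window hX k).const_smul x⁻¹)
      have hfi : Integrable (fun ω => f (x⁻¹ • window X k ω)) P :=
        Integrable.of_bound hfm.aestronglyMeasurable 1 (ae_of_all _ fun ω => by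
          rw [Real.norm_eq_abs, abs_of_nonneg (hf0 _)]; exact hf1 _)
      calc ∫ ω in {ω | δ * x < |X 0 ω|}, f (x⁻¹ • window X k ω) ∂P
          ≤ ∫ ω, f (x⁻¹ • window X k ω) ∂P :=
            setIntegral_le_integral hfi (ae_of_all _ fun ω => hf0 _)
        _ ≤ ∫ ω, {ω | c / 2 * x < |X t ω|}.indicator (fun _ => (1 : ℝ)) ω ∂P := by
            refine integral_mono hfi ((integrable_const 1).indicator hm) fun ω => ?_
            by_cases h : c / 2 * x < |X t ω|
            · rw [Set.indicator_of_mem (show ω ∈ {ω | c / 2 * x < |X t ω|} from h)]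
              exact hf1 _
            · rw [Set.indicator_of_notMem (show ω ∉ {ω | c / 2 * x < |X t ω|} from h)]
              refine (hfz _ ?_).le
              simp only [Pi.smul_apply, smul_eq_mul, abs_mul, abs_inv, abs_of_pos hx]
              rw [inv_mul_le_iff₀ hx, mul_comm]
              exact not_lt.1 h
        _ = absTail P (X 0) (c / 2 * x) := by
            rw [integral_indicator hm, ← hs.absTail_eq hX t]
            simp [absTail])
    have hmeas : MeasurableSet {p : Win k × ℝ | δ < p.2} :=
      measurableSet_lt measurable_const measurable_snd
    have hmeas2 : MeasurableSet {p : Win k × ℝ | δ < p.2 ∧ c < p.2 * |p.1 t|} :=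
      hmeas.inter (measurableSet_lt measurable_const
        (measurable_snd.mul ((measurable_pi_apply t).comp measurable_fst).abs))
    have hfin : ∫⁻ p in {p : Win k × ℝ | δ < p.2}, ENNReal.ofReal (f (p.2 • p.1))
        ∂(polarMeasure Q Y k α) ≠ ⊤ := by
      refine ne_top_of_le_ne_top ?_ (lintegral_mono (g := fun _ => 1) fun p => ?_)
      · rw [setLIntegral_one]
        have : {p : Win k × ℝ | δ < p.2} = Set.univ ×ˢ Set.Ioi δ := by ext; simp
        rw [this, Measure.prod_prod, powerMeasure_Ioi hα hδ]
        exact ENNReal.mul_ne_top (measure_ne_top _ _) ENNReal.ofReal_ne_top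
      · exact ENNReal.ofReal_le_one.2 (hf1 _)
    have h2 := (ENNReal.le_ofReal_iff_toReal_le hfin (by positivity)).2 hle
    refine le_trans ?_ h2
    calc polarMeasure Q Y k α {p | δ < p.2 ∧ c < p.2 * |p.1 t|}
        = ∫⁻ p in {p : Win k × ℝ | δ < p.2 ∧ c < p.2 * |p.1 t|}, 1 ∂(polarMeasure Q Y k α) := by
          rw [setLIntegral_one]
      _ ≤ ∫⁻ p in {p : Win k × ℝ | δ < p.2 ∧ c < p.2 * |p.1 t|}, ENNReal.ofReal (f (p.2 • p.1))
          ∂(polarMeasure Q Y k α) := by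
          refine setLIntegral_mono' hmeas2 fun p hp => ?_
          rw [hfo]
          · simp
          · have : 0 < p.2 := hδ.trans hp.1
            simp only [Pi.smul_apply, smul_eq_mul, abs_mul, abs_of_pos this]
            exact hp.2.le
      _ ≤ _ := lintegral_mono_set fun p hp => hp.1
  have hun : {p : Win k × ℝ | c < p.2 * |p.1 t|} =
      ⋃ n : ℕ, {p | 1 / ((n : ℝ) + 1) < p.2 ∧ c < p.2 * |p.1 t|} := by
    ext p
    simp only [Set.mem_iUnion, Set.mem_ofPred_eq, exists_and_right, iff_and_self]
    intro h
    have h0 : 0 < p.2 := by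
      by_contra h0
      have := abs_nonneg (p.1 t)
      nlinarith
    exact exists_nat_one_div_lt h0
  have hmono : Monotone fun n : ℕ => {p : Win k × ℝ | 1 / ((n : ℝ) + 1) < p.2 ∧ c < p.2 * |p.1 t|} := by
    intro a b hab p hp
    refine ⟨lt_of_le_of_lt ?_ hp.1, hp.2⟩
    have : (a : ℝ) ≤ b := by exact_mod_cast hab
    exact one_div_le_one_div_of_le (by positivity) (by linarith)
  rw [hun, hmono.measure_iUnion]
  exact iSup_le fun n => hδ _ (by positivity)

theorem IsTailProcess.polarMeasure_exists_lt_top [IsProbabilityMeasure P]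
    (hX : ∀ t, Measurable (X t)) (hs : IsStrictlyStationary P X) (hα : 0 < α)
    (hF : RegVar (absTail P (X 0)) α) (hY : IsTailProcess P X α Q Y) {c : ℝ} (hc : 0 < c) :
    polarMeasure Q Y k α {p | ∃ t, c < p.2 * |p.1 t|} < ⊤ := by
  rw [Set.ofPred_exists]
  refine (measure_iUnion_le _).trans_lt ?_
  rw [tsum_fintype]
  exact ENNReal.sum_lt_top.2 fun t _ =>
    (hY.polarMeasure_lt_mul_abs hX hs hα hF hc t).trans_lt ENNReal.ofReal_lt_top

/-- The value of the limit functional restricted to paths with vanishing past. -/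
def clusterIntegral (Q : Measure Ω') (Y : ℤ → Ω' → ℝ) (α : ℝ) (φ : Win k → ℝ) : ENNReal :=
  ∫⁻ p in zeroPastWin k ×ˢ Set.Ioi (0 : ℝ), ENNReal.ofReal (φ (p.2 • p.1)) ∂(polarMeasure Q Y k α)

theorem clusterIntegral_lt_top [IsProbabilityMeasure P]
    (hX : ∀ t, Measurable (X t)) (hs : IsStrictlyStationary P X) (hα : 0 < α)
    (hF : RegVar (absTail P (X 0)) α) (hY : IsTailProcess P X α Q Y) {φ : Win k → ℝ}
    {B : ℝ} (hB : ∀ y, φ y ≤ B) {c : ℝ} (hc : 0 < c)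
    (hφc : ∀ y, (∀ t, |y t| ≤ c) → φ y = 0) : clusterIntegral Q Y α φ < ⊤ := by
  have hbound : ∀ p : Win k × ℝ, p ∈ zeroPastWin k ×ˢ Set.Ioi (0 : ℝ) →
      ENNReal.ofReal (φ (p.2 • p.1)) ≤
        {p : Win k × ℝ | ∃ t, c < p.2 * |p.1 t|}.indicator (fun _ => ENNReal.ofReal B) p := by
    intro p hp
    by_cases h : ∃ t, c < p.2 * |p.1 t|
    · rw [Set.indicator_of_mem (show p ∈ {p : Win k × ℝ | ∃ t, c < p.2 * |p.1 t|} from h)]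
      exact ENNReal.ofReal_le_ofReal (hB _)
    · rw [Set.indicator_of_notMem (show p ∉ {p : Win k × ℝ | ∃ t, c < p.2 * |p.1 t|} from h)]
      push Not at h
      rw [hφc, ENNReal.ofReal_zero]
      intro t
      simp only [Pi.smul_apply, smul_eq_mul, abs_mul, abs_of_pos (show 0 < p.2 from hp.2)]
      exact h t
  have hm : MeasurableSet {p : Win k × ℝ | ∃ t, c < p.2 * |p.1 t|} := by
    rw [Set.ofPred_exists]
    exact MeasurableSet.iUnion fun t => measurableSet_lt measurable_const
        (measurable_snd.mul ((measurable_pi_apply t).comp measurable_fst).abs)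
  calc clusterIntegral Q Y α φ ≤ ∫⁻ p in zeroPastWin k ×ˢ Set.Ioi (0 : ℝ),
        {p : Win k × ℝ | ∃ t, c < p.2 * |p.1 t|}.indicator (fun _ => ENNReal.ofReal B) p
        ∂(polarMeasure Q Y k α) :=
      setLIntegral_mono' ((measurableSet_zeroPastWin k).prod measurableSet_Ioi) hbound
    _ ≤ ∫⁻ p, {p : Win k × ℝ | ∃ t, c < p.2 * |p.1 t|}.indicator (fun _ => ENNReal.ofReal B) p
        ∂(polarMeasure Q Y k α) := setLIntegral_le_lintegral _ _
    _ = ENNReal.ofReal B * polarMeasure Q Y k α {p | ∃ t, c < p.2 * |p.1 t|} :=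
      lintegral_indicator_const hm _
    _ < ⊤ := ENNReal.mul_lt_top ENNReal.ofReal_lt_top
      (hY.polarMeasure_exists_lt_top hX hs hα hF hc)

/-- As δ decreases to 0, {z > δ} grows to {z > 0}, and the cutoff becomes eventually 0 if some
negative coordinate of θ is nonzero and eventually 1 otherwise. A multiple of the indicator of {∃ t,
z|θ_t| > c} dominates. -/
theorem IsTailProcess.tendsto_cutoff [IsProbabilityMeasure P]
    (hX : ∀ t, Measurable (X t)) (hs : IsStrictlyStationary P X) (hα : 0 < α)
    (hF : RegVar (absTail P (X 0)) α) (hY : IsTailProcess P X α Q Y) {φ : Win k → ℝ}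
    (hφ : Continuous φ) {B : ℝ} (hB : ∀ y, φ y ≤ B) {c : ℝ} (hc : 0 < c)
    (hφc : ∀ y, (∀ t, |y t| ≤ c) → φ y = 0) (hφ0 : ∀ y, 0 ≤ φ y) {κ : ℝ} (hκ : 0 < κ) :
    Tendsto (fun δ : ℝ => ∫⁻ p in {p : Win k × ℝ | δ < p.2},
      ENNReal.ofReal (φ (p.2 • p.1) * cutoff κ δ (p.2 • p.1)) ∂(polarMeasure Q Y k α))
      (𝓝[>] 0) (𝓝 (clusterIntegral Q Y α φ)) := by
  have := hY.isProbabilityMeasure_spectralLaw k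
  have hZ : MeasurableSet (zeroPastWin k ×ˢ Set.Ioi (0 : ℝ)) :=
    (measurableSet_zeroPastWin k).prod measurableSet_Ioi
  have hδm : ∀ δ : ℝ, MeasurableSet {p : Win k × ℝ | δ < p.2} := fun δ =>
    measurableSet_lt measurable_const measurable_snd
  have hsm : Measurable (fun p : Win k × ℝ => p.2 • p.1) := measurable_snd.smul measurable_fst
  have hm : MeasurableSet {p : Win k × ℝ | ∃ t, c < p.2 * |p.1 t|} := by
    rw [Set.ofPred_exists]
    exact MeasurableSet.iUnion fun t => measurableSet_lt measurable_const
        (measurable_snd.mul ((measurable_pi_apply t).comp measurable_fst).abs)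
  have hB0 : 0 ≤ B := (hφ0 0).trans (hB 0)
  rw [clusterIntegral, ← lintegral_indicator hZ]
  simp_rw [← lintegral_indicator (hδm _)]
  refine tendsto_lintegral_filter_of_dominated_convergence
    ({p : Win k × ℝ | ∃ t, c < p.2 * |p.1 t|}.indicator (fun _ => ENNReal.ofReal B)) ?_ ?_ ?_ ?_
  · exact Eventually.of_forall fun δ => Measurable.indicator
      (((hφ.measurable.comp hsm).mul ((continuous_cutoff κ δ).measurable.comp hsm)).ennreal_ofReal)
      (hδm δ)
  · filter_upwards [self_mem_nhdsWithin] with δ hδ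
    refine ae_of_all _ fun p => ?_
    have hδ0 : 0 < δ := hδ
    by_cases hp : δ < p.2
    · rw [Set.indicator_of_mem (show p ∈ {p : Win k × ℝ | δ < p.2} from hp)]
      by_cases h : ∃ t, c < p.2 * |p.1 t|
      · rw [Set.indicator_of_mem (show p ∈ {p : Win k × ℝ | ∃ t, c < p.2 * |p.1 t|} from h)]
        apply ENNReal.ofReal_le_ofReal
        calc _ ≤ B * 1 := mul_le_mul (hB _) (cutoff_le_one _ _ _) (cutoff_nonneg _ _ _) hB0
          _ = B := mul_one B
      · push Not at h
        rw [hφc, zero_mul, ENNReal.ofReal_zero]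
        · exact zero_le
        · intro t
          simp only [Pi.smul_apply, smul_eq_mul, abs_mul, abs_of_pos (hδ0.trans hp)]
          exact h t
    · rw [Set.indicator_of_notMem (show p ∉ {p : Win k × ℝ | δ < p.2} from hp)]
      exact zero_le
  · rw [lintegral_indicator_const hm]
    exact (ENNReal.mul_lt_top ENNReal.ofReal_lt_top
      (hY.polarMeasure_exists_lt_top hX hs hα hF hc)).ne
  · refine ae_of_all _ fun p => ?_
    refine tendsto_const_nhds.congr' ?_
    by_cases hp : 0 < p.2
    · by_cases hθ : p.1 ∈ zeroPastWin k
      · rw [Set.indicator_of_mem (show p ∈ zeroPastWin k ×ˢ Set.Ioi (0 : ℝ) from ⟨hθ, hp⟩)]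
        filter_upwards [self_mem_nhdsWithin, mem_nhdsWithin_of_mem_nhds (gt_mem_nhds hp)]
          with δ hδ hδp
        have hδ0 : 0 < δ := hδ
        rw [Set.indicator_of_mem (show p ∈ {p : Win k × ℝ | δ < p.2} from hδp),
          cutoff_eq_one hδ0, mul_one]
        intro t ht
        simp [hθ t ht, hδ0.le]
      · rw [Set.indicator_of_notMem (fun h => hθ h.1)]
        obtain ⟨t, ht, hne⟩ : ∃ t, (t : Set.Icc (-(k : ℤ)) (k : ℤ)).1 < 0 ∧ p.1 t ≠ 0 := by
          by_contra h
          push Not at h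
          exact hθ fun t ht => h t ht
        have hpos : 0 < κ * (p.2 * |p.1 t|) / 2 := by
          have := abs_pos.2 hne
          positivity
        filter_upwards [self_mem_nhdsWithin, mem_nhdsWithin_of_mem_nhds (gt_mem_nhds hpos)]
          with δ hδ hδp
        have hδ0 : 0 < δ := hδ
        have : cutoff κ δ (p.2 • p.1) = 0 := by
          refine cutoff_eq_zero hδ0 ht ?_
          simp only [Pi.smul_apply, smul_eq_mul, abs_mul, abs_of_pos hp]
          have : δ < κ * (p.2 * |p.1 t|) / 2 := hδp
          linarith
        simp [Set.indicator, this]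
    · rw [Set.indicator_of_notMem (fun h => hp h.2)]
      filter_upwards [self_mem_nhdsWithin] with δ hδ
      have hδ0 : 0 < δ := hδ
      rw [Set.indicator_of_notMem]
      intro (h : δ < p.2)
      exact hp (hδ0.trans h)

theorem IsTailProcess.clusterIntegral_eq (hY : IsTailProcess P X α Q Y) {φ : Win k → ℝ}
    (hφ : Continuous φ) : clusterIntegral Q Y α φ = ∫⁻ θ in zeroPastWin k,
      ∫⁻ z in Set.Ioi 0, ENNReal.ofReal (φ (z • θ)) ∂(powerMeasure α) ∂(spectralLaw Q Y k) := by
  have := hY.isProbabilityMeasure_spectralLaw k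
  have hm : Measurable (fun p : Win k × ℝ => ENNReal.ofReal (φ (p.2 • p.1))) :=
    (hφ.measurable.comp (measurable_snd.smul measurable_fst)).ennreal_ofReal
  rw [clusterIntegral, ← Measure.prod_restrict, lintegral_prod _ hm.aemeasurable]

/-- `E[(max_l ∑_{i ≤ l} Θ_i)_+^α; Θ_{-j} = 0, j = 1, …, k]`. -/
def clusterConst (Q : Measure Ω') (Y : ℤ → Ω' → ℝ) (k : ℕ) (α : ℝ) : ENNReal :=
  ∫⁻ θ in zeroPastWin k, ENNReal.ofReal ((max (maxSum θ) 0) ^ α) ∂(spectralLaw Q Y k)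

/-- Integrating out the radius turns the α-th moment of H_+ on the vanishing-past event into the
measure of a set, so finiteness of the moment can be read off from the limit measure. -/
theorem IsTailProcess.polarMeasure_zeroPast (hα : 0 < α) (hY : IsTailProcess P X α Q Y)
    {H : Win k → ℝ} (hH : Measurable H) {c : ℝ} (hc : 0 < c) :
    polarMeasure Q Y k α {p | p.1 ∈ zeroPastWin k ∧ c < p.2 * H p.1} =
      ∫⁻ θ in zeroPastWin k, ENNReal.ofReal ((max (H θ) 0) ^ α * c ^ (-α)) ∂(spectralLaw Q Y k) := by
  have := hY.isProbabilityMeasure_spectralLaw k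
  have hm : MeasurableSet {p : Win k × ℝ | p.1 ∈ zeroPastWin k ∧ c < p.2 * H p.1} :=
    (measurable_fst (measurableSet_zeroPastWin k)).inter
      (measurableSet_lt measurable_const (measurable_snd.mul (hH.comp measurable_fst)))
  rw [Measure.prod_apply hm, ← lintegral_indicator (measurableSet_zeroPastWin k)]
  refine lintegral_congr fun θ => ?_
  by_cases hθ : θ ∈ zeroPastWin k
  · rw [Set.indicator_of_mem hθ, ← powerMeasure_lt_mul hα hc]
    congr 1
    ext z; simp [hθ]
  · rw [Set.indicator_of_notMem hθ]
    convert measure_empty (μ := powerMeasure α)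
    ext z; simp [hθ]

/-- The constant is the measure of the set where z times the positive part of the maximal sum
exceeds 1. There some z|θ_t| exceeds 1/(2(k+1)), which has finite measure. -/
theorem IsTailProcess.clusterConst_lt_top [IsProbabilityMeasure P]
    (hX : ∀ t, Measurable (X t)) (hs : IsStrictlyStationary P X) (hα : 0 < α)
    (hF : RegVar (absTail P (X 0)) α) (hY : IsTailProcess P X α Q Y) :
    clusterConst Q Y k α < ⊤ := by
  have h1 := hY.polarMeasure_zeroPast (k := k) hα
    ((continuous_maxSum (k := k)).max continuous_const).measurable one_pos (H := fun θ => max (maxSum θ) 0)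
  simp only [Real.one_rpow, mul_one, max_eq_left (le_max_right _ (0 : ℝ))] at h1
  rw [clusterConst, ← h1]
  refine (measure_mono ?_).trans_lt (hY.polarMeasure_exists_lt_top (k := k) hX hs hα hF
    (c := 1 / 2 / (k + 1)) (by positivity))
  intro p hp
  by_contra hc
  simp only [Set.mem_ofPred_eq, not_exists, not_lt] at hc
  have hp2 := hp.2
  have hM : 0 ≤ max (maxSum p.1) 0 := le_max_right _ _
  have h0 : 0 < p.2 := by
    by_contra h0
    nlinarith
  have h3 : maxSum (p.2 • p.1) ≤ 1 / 2 := maxSum_le (by norm_num) fun t => by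
    simp only [Pi.smul_apply, smul_eq_mul, abs_mul, abs_of_pos h0]
    exact hc t
  rw [maxSum_smul h0.le] at h3
  rcases max_cases (maxSum p.1) 0 with ⟨h, -⟩ | ⟨h, -⟩
  · rw [h] at hp2; linarith
  · rw [h] at hp2; linarith

theorem IsTailProcess.clusterIntegral_excess_le (hα : 1 < α) (hY : IsTailProcess P X α Q Y)
    {c ρ K : ℝ} (hc : 0 < c) :
    clusterIntegral (k := k) Q Y α (excess c ρ K) ≤
      clusterConst Q Y k α * ENNReal.ofReal (c ^ (1 - α) / (α - 1) / ρ) := by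
  have hJ : Measurable (fun θ : Win k => ENNReal.ofReal ((max (maxSum θ) 0) ^ α)) :=
    ((continuous_maxSum.measurable.max measurable_const).pow_const α).ennreal_ofReal
  rw [hY.clusterIntegral_eq (continuous_excess c ρ K), clusterConst, ← lintegral_mul_const _ hJ]
  refine lintegral_mono fun θ => ?_
  calc ∫⁻ z in Set.Ioi 0, ENNReal.ofReal (excess c ρ K (z • θ)) ∂(powerMeasure α)
      ≤ ∫⁻ z in Set.Ioi 0, ENNReal.ofReal (max (z * maxSum θ - c) 0) * ENNReal.ofReal (1 / ρ)
          ∂(powerMeasure α) := by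
        refine setLIntegral_mono' measurableSet_Ioi fun z (hz : 0 < z) => ?_
        rw [← ENNReal.ofReal_mul (le_max_right _ _)]
        apply ENNReal.ofReal_le_ofReal
        rw [excess, maxSum_smul hz.le, mul_one_div]
        exact min_le_right _ _
    _ = _ := by
        have hm : Measurable (fun z : ℝ => ENNReal.ofReal (max (z * maxSum θ - c) 0)) :=
          (((measurable_id.mul_const _).sub_const c).max measurable_const).ennreal_ofReal
        rw [powerMeasure_restrict_Ioi_zero, lintegral_mul_const _ hm,
          lintegral_powerMeasure_sub hα hc, ← ENNReal.ofReal_mul, ← ENNReal.ofReal_mul]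
        · congr 1; ring
        · positivity
        · have : 0 < α - 1 := by linarith
          positivity

/-- Monotone convergence removes the cap; the uncapped functional is integrated exactly by
`lintegral_powerMeasure_sub`. -/
theorem IsTailProcess.tendsto_clusterIntegral_excess (hα : 1 < α) (hY : IsTailProcess P X α Q Y)
    {c ρ : ℝ} (hc : 0 < c) :
    Tendsto (fun n : ℕ => clusterIntegral (k := k) Q Y α (excess c ρ n)) atTop
      (𝓝 (clusterConst Q Y k α * ENNReal.ofReal (c ^ (1 - α) / (α - 1) / ρ))) := by
  have := hY.isProbabilityMeasure_spectralLaw k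
  have hJ : Measurable (fun θ : Win k => ENNReal.ofReal ((max (maxSum θ) 0) ^ α)) :=
    ((continuous_maxSum.measurable.max measurable_const).pow_const α).ennreal_ofReal
  have hlimval : ∫⁻ p in zeroPastWin k ×ˢ Set.Ioi (0 : ℝ),
      ENNReal.ofReal (max (maxSum (p.2 • p.1) - c) 0 / ρ) ∂(polarMeasure Q Y k α) =
      clusterConst Q Y k α * ENNReal.ofReal (c ^ (1 - α) / (α - 1) / ρ) := by
    have hcont : Continuous (fun y : Win k => max (maxSum y - c) 0 / ρ) := by
      have := continuous_maxSum (k := k)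
      fun_prop
    have := hY.clusterIntegral_eq hcont
    rw [clusterIntegral] at this
    rw [this, clusterConst, ← lintegral_mul_const _ hJ]
    refine lintegral_congr fun θ => ?_
    calc ∫⁻ z in Set.Ioi 0, ENNReal.ofReal (max (maxSum (z • θ) - c) 0 / ρ) ∂(powerMeasure α)
        = ∫⁻ z in Set.Ioi 0, ENNReal.ofReal (max (z * maxSum θ - c) 0) * ENNReal.ofReal (1 / ρ)
            ∂(powerMeasure α) := by
          refine setLIntegral_congr_fun measurableSet_Ioi fun z (hz : 0 < z) => ?_
          rw [← ENNReal.ofReal_mul (le_max_right _ _), maxSum_smul hz.le, mul_one_div]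
      _ = _ := by
          have hm : Measurable (fun z : ℝ => ENNReal.ofReal (max (z * maxSum θ - c) 0)) :=
            (((measurable_id.mul_const _).sub_const c).max measurable_const).ennreal_ofReal
          rw [powerMeasure_restrict_Ioi_zero, lintegral_mul_const _ hm,
            lintegral_powerMeasure_sub hα hc, ← ENNReal.ofReal_mul, ← ENNReal.ofReal_mul]
          · congr 1; ring
          · positivity
          · have : 0 < α - 1 := by linarith
            positivity
  rw [← hlimval]
  simp only [clusterIntegral]
  refine lintegral_tendsto_of_tendsto_of_monotone (fun n => ?_) (ae_of_all _ fun p => ?_)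
    (ae_of_all _ fun p => ?_)
  · exact ((continuous_excess c ρ n).measurable.comp
      (measurable_snd.smul measurable_fst)).ennreal_ofReal.aemeasurable
  · intro a b hab
    apply ENNReal.ofReal_le_ofReal
    exact min_le_min_right _ (by exact_mod_cast hab)
  · refine tendsto_const_nhds.congr' ?_
    obtain ⟨N, hN⟩ := exists_nat_ge (max (maxSum (p.2 • p.1) - c) 0 / ρ)
    filter_upwards [eventually_ge_atTop N] with n hn
    rw [excess, min_eq_right]
    exact hN.trans (by exact_mod_cast hn)

end TailProcess

/-! ### Counting the starting times of clusters -/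

section Window

variable {k : ℕ}

/-- Windows with a first exceedance of `b` at time `0` and maximal partial sum above `v`. -/
def clusterSet (k : ℕ) (b v : ℝ) : Set (Win k) :=
  {y | b < |y (origin k)| ∧ (∀ t : Set.Icc (-(k : ℤ)) (k : ℤ), (t : ℤ) < 0 → |y t| ≤ b) ∧
    v < maxSum y}

theorem measurableSet_clusterSet (b v : ℝ) : MeasurableSet (clusterSet k b v) := by
  refine (measurableSet_lt measurable_const (measurable_pi_apply _).abs).inter
    (MeasurableSet.inter ?_ (measurableSet_lt measurable_const continuous_maxSum.measurable))
  change MeasurableSet {y : Win k | ∀ t : Set.Icc (-(k : ℤ)) (k : ℤ), (t : ℤ) < 0 → |y t| ≤ b}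
  simp only [Set.ofPred_forall]
  exact MeasurableSet.iInter fun t => MeasurableSet.iInter fun _ =>
    measurableSet_le (measurable_pi_apply t).abs measurable_const

/-- Counting the times i with ρi < v is what produces the factor 1/ρ; the horizon n becomes the cap
of `excess`. -/
theorem sum_ite_mul_lt_le {ρ : ℝ} (hρ : 0 < ρ) (v : ℝ) (n : ℕ) :
    ∑ i ∈ Finset.Icc 1 n, (if ρ * (i : ℝ) < v then (1 : ℝ) else 0) ≤ min (n : ℝ) (max v 0 / ρ) := by
  rw [Finset.sum_boole]
  refine le_min ?_ ?_
  · have := Finset.card_filter_le (Finset.Icc 1 n) (fun i : ℕ => ρ * (i : ℝ) < v)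
    rw [Nat.card_Icc] at this
    exact_mod_cast this
  · have h0 : 0 ≤ max v 0 / ρ := by positivity
    have hsub : (Finset.Icc 1 n).filter (fun i : ℕ => ρ * (i : ℝ) < v) ⊆
        Finset.Icc 1 ⌊max v 0 / ρ⌋₊ := by
      intro i hi
      simp only [Finset.mem_filter, Finset.mem_Icc] at hi ⊢
      refine ⟨hi.1.1, Nat.le_floor ?_⟩
      rw [le_div_iff₀ hρ]
      exact (le_max_of_le_left (by linarith [hi.2]))
    have h1 := Finset.card_le_card hsub
    rw [Nat.card_Icc, Nat.add_sub_cancel] at h1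
    calc (((Finset.Icc 1 n).filter (fun i : ℕ => ρ * (i : ℝ) < v)).card : ℝ)
        ≤ (⌊max v 0 / ρ⌋₊ : ℝ) := by exact_mod_cast h1
      _ ≤ _ := Nat.floor_le h0

/-- The last admissible i is ⌈v/ρ⌉₊ - 1 (or n), so rounding loses at most 1. -/
theorem le_sum_ite_mul_lt {ρ : ℝ} (hρ : 0 < ρ) (v : ℝ) {n : ℕ} {N : ℝ} (hN : N ≤ n + 1) :
    min N (max v 0 / ρ) - 1 ≤
      ∑ i ∈ Finset.Icc 1 n, (if ρ * (i : ℝ) < v then (1 : ℝ) else 0) := by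
  rw [Finset.sum_boole]
  have hsub : Finset.Icc 1 (min n (⌈v / ρ⌉₊ - 1)) ⊆
      (Finset.Icc 1 n).filter (fun i : ℕ => ρ * (i : ℝ) < v) := by
    intro i hi
    simp only [Finset.mem_filter, Finset.mem_Icc, le_min_iff] at hi ⊢
    refine ⟨⟨hi.1, hi.2.1⟩, ?_⟩
    have : i < ⌈v / ρ⌉₊ := by omega
    rw [Nat.lt_ceil, lt_div_iff₀ hρ] at this
    linarith
  have h1 := Finset.card_le_card hsub
  rw [Nat.card_Icc, Nat.add_sub_cancel] at h1
  have h2 : ((min n (⌈v / ρ⌉₊ - 1) : ℕ) : ℝ) ≤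
      (((Finset.Icc 1 n).filter (fun i : ℕ => ρ * (i : ℝ) < v)).card : ℝ) := by exact_mod_cast h1
  refine le_trans ?_ h2
  rcases le_total n (⌈v / ρ⌉₊ - 1) with h | h
  · rw [min_eq_left h]
    have := min_le_left N (max v 0 / ρ)
    linarith
  · rw [min_eq_right h]
    have h3 := min_le_right N (max v 0 / ρ)
    have h4 : max v 0 / ρ ≤ ⌈v / ρ⌉₊ := by
      rw [div_le_iff₀ hρ]
      refine max_le ?_ (by positivity)
      rw [← div_le_iff₀ hρ]
      exact Nat.le_ceil _
    have h5 : (⌈v / ρ⌉₊ : ℝ) ≤ ((⌈v / ρ⌉₊ - 1 : ℕ) : ℝ) + 1 := by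
      have : ⌈v / ρ⌉₊ ≤ (⌈v / ρ⌉₊ - 1) + 1 := by omega
      exact_mod_cast this
    linarith

theorem mul_excess_inv_smul {x : ℝ} (hx : 0 < x) (c ρ K : ℝ) (y : Win k) :
    x * excess c ρ K (x⁻¹ • y) = min (K * x) (max (maxSum y - c * x) 0 / ρ) := by
  rw [excess, maxSum_smul (inv_nonneg.2 hx.le), mul_min_of_nonneg _ _ hx.le, mul_comm x K]
  congr 1
  rw [← mul_div_assoc, mul_max_of_nonneg _ _ hx.le, mul_zero, mul_sub, mul_inv_cancel_left₀ hx.ne',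
    mul_comm x c]

theorem abs_inv_smul_window {Ω : Type*} {X : ℤ → Ω → ℝ} {x : ℝ} (hx : 0 < x) (ω : Ω) (t : Set.Icc (-(k : ℤ)) (k : ℤ)) :
    |(x⁻¹ • window X k ω) t| = x⁻¹ * |X t ω| := by
  simp only [Pi.smul_apply, smul_eq_mul, abs_mul, abs_inv, abs_of_pos hx]
  rfl

theorem zeroPast_eq_preimage {Ω' : Type*} (Y : ℤ → Ω' → ℝ) (k : ℕ) :
    zeroPast Y k = window (spectralTail Y) k ⁻¹' zeroPastWin k := by
  ext ω
  constructor
  · rintro h ⟨t, ht⟩ ht0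
    simp only [Set.mem_Icc] at ht ht0
    have := h t.natAbs (by omega) (by omega)
    rwa [show -((t.natAbs : ℕ) : ℤ) = t by omega] at this
  · intro h j h1 h2
    exact h ⟨-(j : ℤ), by simp only [Set.mem_Icc]; omega⟩ (by simp only; omega)

theorem lam_eq {Ω' : Type*} [MeasurableSpace Ω'] {Q : Measure Ω'} {Y : ℤ → Ω' → ℝ}
    (hY : ∀ t, Measurable (Y t)) :
    lam Q Y k = (spectralLaw Q Y k).real (zeroPastWin k) := by
  rw [lam, zeroPast_eq_preimage, measureReal_def, measureReal_def, spectralLaw,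
    Measure.map_apply (measurable_window_spectralTail hY k) (measurableSet_zeroPastWin k)]

end Window

section Counting

variable {Ω : Type*} [MeasurableSpace Ω] {P : Measure Ω} [IsProbabilityMeasure P]
  {X : ℤ → Ω → ℝ} {k : ℕ}

/-- The integral `E[φ(X/x) χ(X/x); |X_0| > δ x]` with the cutoff `χ`. -/
def cutoffIntegral (P : Measure Ω) (X : ℤ → Ω → ℝ) (φ : Win k → ℝ) (κ δ x : ℝ) : ℝ :=
  ∫ ω in {ω | δ * x < |X 0 ω|}, φ (x⁻¹ • window X k ω) * cutoff κ δ (x⁻¹ • window X k ω) ∂P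

theorem integrable_cutoff (hX : ∀ t, Measurable (X t)) {φ : Win k → ℝ} (hφ : Continuous φ)
    (hφ0 : ∀ y, 0 ≤ φ y) {B : ℝ} (hB : ∀ y, φ y ≤ B) (κ δ x : ℝ) :
    Integrable (fun ω => φ (x⁻¹ • window X k ω) * cutoff κ δ (x⁻¹ • window X k ω)) P := by
  have hm := (measurable_window hX k).const_smul x⁻¹
  refine Integrable.of_bound ((hφ.measurable.comp hm).mul
    ((continuous_cutoff κ δ).measurable.comp hm)).aestronglyMeasurable B (ae_of_all _ fun ω => ?_)
  rw [Real.norm_eq_abs, abs_of_nonneg (mul_nonneg (hφ0 _) (cutoff_nonneg _ _ _))]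
  calc _ ≤ B * 1 := mul_le_mul (hB _) (cutoff_le_one _ _ _) (cutoff_nonneg _ _ _)
        ((hφ0 0).trans (hB 0))
    _ = B := mul_one B

theorem measurableSet_window_mem (hX : ∀ t, Measurable (X t)) {s : Set (Win k)}
    (hs : MeasurableSet s) : MeasurableSet {ω | window X k ω ∈ s} :=
  measurable_window hX k hs

theorem sum_measureReal_eq_integral {ι : Type*} (s : Finset ι) {E : ι → Set Ω}
    (hE : ∀ i, MeasurableSet (E i)) :
    ∑ i ∈ s, P.real (E i) = ∫ ω, ∑ i ∈ s, (E i).indicator (fun _ => (1 : ℝ)) ω ∂P := by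
  rw [integral_finsetSum _ fun i _ => (integrable_const 1).indicator (hE i)]
  refine Finset.sum_congr rfl fun i _ => ?_
  rw [integral_indicator (hE i)]; simp

/-- Exchange sum and expectation: on the first-exceedance event the number of i whose level is
passed is bounded by `sum_ite_mul_lt_le`, and the cutoff with κ = 1 equals 1. -/
theorem sum_cluster_le (hX : ∀ t, Measurable (X t)) {δ x c ρ K : ℝ} (hδ : 0 < δ) (hx : 0 < x)
    (hρ : 0 < ρ) (hK : 0 ≤ K) {n : ℕ} (hn : (n : ℝ) ≤ K * x) :
    ∑ i ∈ Finset.Icc 1 n, P.real {ω | window X k ω ∈ clusterSet k (δ * x) (c * x + ρ * (i : ℝ))} ≤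
      x * cutoffIntegral P X (excess (k := k) c ρ K) 1 δ x := by
  have hA : MeasurableSet {ω | δ * x < |X 0 ω|} :=
    measurableSet_lt measurable_const (hX 0).abs
  have hint := integrable_cutoff (P := P) hX (continuous_excess (k := k) c ρ K)
    (excess_nonneg hρ hK) (fun y => min_le_left _ _) 1 δ x
  rw [sum_measureReal_eq_integral (P := P) _
    fun i => measurableSet_window_mem hX (measurableSet_clusterSet _ _),
    cutoffIntegral, ← integral_indicator hA, ← integral_const_mul]
  refine integral_mono (integrable_finsetSum _ fun i _ => (integrable_const 1).indicator
    (measurableSet_window_mem hX (measurableSet_clusterSet _ _)))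
    ((hint.indicator hA).const_mul x) fun ω => ?_
  simp only
  by_cases h : δ * x < |X 0 ω| ∧
      ∀ t : Set.Icc (-(k : ℤ)) (k : ℤ), (t : ℤ) < 0 → |X t ω| ≤ δ * x
  · rw [Set.indicator_of_mem (show ω ∈ {ω | δ * x < |X 0 ω|} from h.1), cutoff_eq_one hδ, mul_one,
      mul_excess_inv_smul hx]
    · calc ∑ i ∈ Finset.Icc 1 n, {ω | window X k ω ∈
              clusterSet k (δ * x) (c * x + ρ * (i : ℝ))}.indicator (fun _ => (1 : ℝ)) ω
          ≤ ∑ i ∈ Finset.Icc 1 n,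
            (if ρ * (i : ℝ) < maxSum (window X k ω) - c * x then (1 : ℝ) else 0) := by
            refine Finset.sum_le_sum fun i _ => ?_
            by_cases hi : ω ∈ {ω | window X k ω ∈ clusterSet k (δ * x) (c * x + ρ * (i : ℝ))}
            · rw [Set.indicator_of_mem hi, if_pos]
              have := hi.2.2
              linarith
            · rw [Set.indicator_of_notMem hi]
              split_ifs <;> norm_num
        _ ≤ _ := sum_ite_mul_lt_le hρ _ n
        _ ≤ _ := min_le_min_right _ hn
    · intro t ht
      rw [abs_inv_smul_window hx, one_mul, inv_mul_le_iff₀ hx, mul_comm]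
      exact h.2 t ht
  · rw [Finset.sum_eq_zero]
    · refine mul_nonneg hx.le (Set.indicator_nonneg (fun ω _ => ?_) _)
      exact mul_nonneg (excess_nonneg hρ hK _) (cutoff_nonneg _ _ _)
    · intro i _
      refine Set.indicator_of_notMem (fun hi => h ⟨hi.1, hi.2.1⟩) _

/-- The same exchange with κ = 2; the rounding loss of 1 on {|X_0| > δx} accounts for the subtracted
tail. -/
theorem le_sum_cluster (hX : ∀ t, Measurable (X t)) {δ x c ρ K : ℝ} (hδ : 0 < δ) (hx : 0 < x)
    (hρ : 0 < ρ) (hK : 0 ≤ K) {n : ℕ} (hn : K * x ≤ n + 1) :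
    x * cutoffIntegral P X (excess (k := k) c ρ K) 2 δ x - absTail P (X 0) (δ * x) ≤
    ∑ i ∈ Finset.Icc 1 n,
      P.real {ω | window X k ω ∈ clusterSet k (δ * x) (c * x + ρ * (i : ℝ))} := by
  have hA : MeasurableSet {ω | δ * x < |X 0 ω|} :=
    measurableSet_lt measurable_const (hX 0).abs
  have hint := integrable_cutoff (P := P) hX (continuous_excess (k := k) c ρ K)
    (excess_nonneg hρ hK) (fun y => min_le_left _ _) 2 δ x
  have e : absTail P (X 0) (δ * x) =
      ∫ ω, {ω | δ * x < |X 0 ω|}.indicator (fun _ => (1 : ℝ)) ω ∂P := by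
    rw [integral_indicator hA]; simp [absTail]
  rw [sum_measureReal_eq_integral (P := P) _
    fun i => measurableSet_window_mem hX (measurableSet_clusterSet _ _), e,
    cutoffIntegral, ← integral_indicator hA, ← integral_const_mul, ← integral_sub
      ((hint.indicator hA).const_mul x) ((integrable_const 1).indicator hA)]
  refine integral_mono (((hint.indicator hA).const_mul x).sub ((integrable_const 1).indicator hA))
    (integrable_finsetSum _ fun i _ => (integrable_const 1).indicator
    (measurableSet_window_mem hX (measurableSet_clusterSet _ _))) fun ω => ?_
  simp only
  have hnn : 0 ≤ ∑ i ∈ Finset.Icc 1 n, {ω | window X k ω ∈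
      clusterSet k (δ * x) (c * x + ρ * (i : ℝ))}.indicator (fun _ => (1 : ℝ)) ω :=
    Finset.sum_nonneg fun i _ => Set.indicator_nonneg (fun _ _ => zero_le_one) _
  by_cases h0 : δ * x < |X 0 ω|
  · rw [Set.indicator_of_mem (show ω ∈ {ω | δ * x < |X 0 ω|} from h0),
      Set.indicator_of_mem (show ω ∈ {ω | δ * x < |X 0 ω|} from h0)]
    by_cases h : ∀ t : Set.Icc (-(k : ℤ)) (k : ℤ), (t : ℤ) < 0 → |X t ω| ≤ δ * x
    · calc x * (excess c ρ K (x⁻¹ • window X k ω) * cutoff 2 δ (x⁻¹ • window X k ω)) - 1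
          ≤ x * (excess c ρ K (x⁻¹ • window X k ω) * 1) - 1 := by
            have := excess_nonneg (c := c) hρ hK (x⁻¹ • window X k ω)
            gcongr
            exact cutoff_le_one _ _ _
        _ = min (K * x) (max (maxSum (window X k ω) - c * x) 0 / ρ) - 1 := by
            rw [mul_one, mul_excess_inv_smul hx]
        _ ≤ _ := le_sum_ite_mul_lt hρ _ hn
        _ ≤ _ := by
            refine Finset.sum_le_sum fun i _ => ?_
            split_ifs with hi
            · rw [Set.indicator_of_mem]
              exact ⟨h0, h, by linarith⟩
            · exact Set.indicator_nonneg (fun _ _ => zero_le_one) _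
    · push Not at h
      obtain ⟨t, ht, htx⟩ := h
      rw [cutoff_eq_zero hδ ht, mul_zero, mul_zero]
      · linarith
      · rw [abs_inv_smul_window hx]
        have : δ ≤ x⁻¹ * |X t ω| := by
          rw [inv_mul_eq_div, le_div_iff₀ hx]; exact htx.le
        linarith
  · rw [Set.indicator_of_notMem (show ω ∉ {ω | δ * x < |X 0 ω|} from h0),
      Set.indicator_of_notMem (show ω ∉ {ω | δ * x < |X 0 ω|} from h0)]
    linarith

end Counting

/-! ### Positivity of λ_k -/

section Limits

variable {Ω Ω' : Type*} [MeasurableSpace Ω] [MeasurableSpace Ω'] {P : Measure Ω}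
  [IsProbabilityMeasure P] {X : ℤ → Ω → ℝ} {α : ℝ} {Q : Measure Ω'} [IsProbabilityMeasure Q]
  {Y : ℤ → Ω' → ℝ} {k : ℕ}

/-- The limits of the cutoff integrals converge to the cluster integral as `δ → 0`. -/
theorem IsTailProcess.exists_tendsto_cutoffIntegral
    (hX : ∀ t, Measurable (X t)) (hs : IsStrictlyStationary P X) (hα : 0 < α)
    (hF : RegVar (absTail P (X 0)) α) (hY : IsTailProcess P X α Q Y) {φ : Win k → ℝ}
    (hφ : Continuous φ) {B : ℝ} (hB : ∀ y, φ y ≤ B) {c : ℝ} (hc : 0 < c)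
    (hφc : ∀ y, (∀ t, |y t| ≤ c) → φ y = 0) (hφ0 : ∀ y, 0 ≤ φ y) {κ : ℝ} (hκ : 0 < κ) :
    ∃ V : ℝ → ℝ, Tendsto V (𝓝[>] 0) (𝓝 (clusterIntegral Q Y α φ).toReal) ∧
      ∀ δ, 0 < δ → Tendsto (fun x => cutoffIntegral P X φ κ δ x / absTail P (X 0) x) atTop
        (𝓝 (V δ)) := by
  have hlim := hY.tendsto_cutoff hX hs hα hF hφ hB hc hφc hφ0 hκ
  have hfin := clusterIntegral_lt_top hX hs hα hF hY hB hc hφc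
  refine ⟨_, (ENNReal.tendsto_toReal hfin.ne).comp hlim, fun δ hδ => ?_⟩
  refine hY.tendsto_restrict_polar hX hα hF (f := fun y => φ y * cutoff κ δ y)
    (hφ.mul (continuous_cutoff κ δ)) (fun y => mul_nonneg (hφ0 y) (cutoff_nonneg _ _ _))
    (B := B) (fun y => ?_) hδ
  calc _ ≤ B * 1 := mul_le_mul (hB _) (cutoff_le_one _ _ _) (cutoff_nonneg _ _ _)
        ((hφ0 0).trans (hB 0))
    _ = B := mul_one B

theorem measureReal_le_cutoffIntegral (hX : ∀ t, Measurable (X t)) {φ : Win k → ℝ}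
    (hφ : Continuous φ) (hφ0 : ∀ y, 0 ≤ φ y) {B : ℝ} (hB : ∀ y, φ y ≤ B) {δ x : ℝ} (hδ : 0 < δ)
    (hx : 0 < x) {E : Set Ω} (hE : MeasurableSet E) (h0 : ∀ ω ∈ E, δ * x < |X 0 ω|)
    (hpast : ∀ ω ∈ E, ∀ t : Set.Icc (-(k : ℤ)) (k : ℤ), (t : ℤ) < 0 → |X t ω| ≤ δ * x)
    (hφ1 : ∀ ω ∈ E, 1 ≤ φ (x⁻¹ • window X k ω)) :
    P.real E ≤ cutoffIntegral P X φ 1 δ x := by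
  have hA : MeasurableSet {ω | δ * x < |X 0 ω|} :=
    measurableSet_lt measurable_const (hX 0).abs
  have hint := integrable_cutoff (P := P) hX hφ hφ0 hB 1 δ x
  have e : P.real E = ∫ ω, E.indicator (fun _ => (1 : ℝ)) ω ∂P := by
    rw [integral_indicator hE]; simp
  rw [e, cutoffIntegral, ← integral_indicator hA]
  refine integral_mono ((integrable_const 1).indicator hE) (hint.indicator hA) fun ω => ?_
  by_cases hω : ω ∈ E
  · rw [Set.indicator_of_mem hω, Set.indicator_of_mem (show ω ∈ {ω | δ * x < |X 0 ω|} from h0 ω hω),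
      cutoff_eq_one hδ, mul_one]
    · exact hφ1 ω hω
    · intro t ht
      rw [abs_inv_smul_window hx, one_mul, inv_mul_le_iff₀ hx, mul_comm]
      exact hpast ω hω t ht
  · rw [Set.indicator_of_notMem hω]
    exact Set.indicator_nonneg (fun ω _ => mul_nonneg (hφ0 _) (cutoff_nonneg _ _ _)) _

/-- Given |X_0| > x, go back to the earliest exceedance of δx at some time -a with a ≤ k. Either the
k times before -a are free of exceedances, and a shift by a puts the first exceedance at 0, or an
exceedance occurs at -b with k < b ≤ 2k, which is independent of X_0. -/
theorem absTail_le_cutoffIntegral (h : IsHeavyKDependent P X k α) {φ : Win k → ℝ}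
    (hφ : Continuous φ) (hφ0 : ∀ y, 0 ≤ φ y) {B : ℝ} (hB : ∀ y, φ y ≤ B)
    (hφ1 : ∀ y t, 1 ≤ |y t| → 1 ≤ φ y) {δ x : ℝ} (hδ : 0 < δ) (hδ1 : δ ≤ 1) (hx : 0 < x) :
    absTail P (X 0) x ≤ (k + 1) * cutoffIntegral P X φ 1 δ x +
      k * (absTail P (X 0) (δ * x) * absTail P (X 0) x) := by
  set A : ℕ → Set (ℤ → ℝ) := fun a => {y | δ * x < |y 0| ∧
    (∀ j ∈ Finset.Icc 1 k, |y (-(j : ℤ))| ≤ δ * x) ∧ x < |y a|} with hAdef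
  have hAm : ∀ a, MeasurableSet (A a) := fun a => by
    refine (measurableSet_lt measurable_const (measurable_pi_apply _).abs).inter
      (MeasurableSet.inter ?_ (measurableSet_lt measurable_const (measurable_pi_apply _).abs))
    change MeasurableSet {y : ℤ → ℝ | ∀ j ∈ Finset.Icc 1 k, |y (-(j : ℤ))| ≤ δ * x}
    simp only [Set.ofPred_forall]
    exact MeasurableSet.iInter fun j => MeasurableSet.iInter fun _ =>
      measurableSet_le (measurable_pi_apply _).abs measurable_const
  have hX0 : Measurable (fun ω (t : ℤ) => X t ω) := measurable_pi_lambda _ h.meas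
  have hAa : ∀ a ∈ Finset.range (k + 1), P.real {ω | (fun t => X (t + (-(a : ℤ))) ω) ∈ A a} ≤
      cutoffIntegral P X φ 1 δ x := by
    intro a ha
    rw [h.stat.measureReal_path h.meas _ (hAm a)]
    refine measureReal_le_cutoffIntegral h.meas hφ hφ0 hB hδ hx (hX0 (hAm a))
      (fun ω hω => hω.1) (fun ω hω t ht => ?_) (fun ω hω => ?_)
    · obtain ⟨t, ht'⟩ := t
      simp only [Set.mem_Icc] at ht' ht
      have := hω.2.1 t.natAbs (by simp only [Finset.mem_Icc]; omega)
      rwa [show -((t.natAbs : ℕ) : ℤ) = t by omega] at this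
    · have ha' : ((a : ℕ) : ℤ) ∈ Set.Icc (-(k : ℤ)) (k : ℤ) := by
        simp only [Finset.mem_range] at ha
        simp only [Set.mem_Icc]; omega
      refine hφ1 _ ⟨a, ha'⟩ ?_
      rw [abs_inv_smul_window hx, inv_mul_eq_div, one_le_div hx]
      exact hω.2.2.le
  have hsub : {ω | x < |X 0 ω|} ⊆
      (⋃ a ∈ Finset.range (k + 1), {ω | (fun t => X (t + (-(a : ℤ))) ω) ∈ A a}) ∪
      ⋃ b ∈ Finset.Icc (k + 1) (2 * k), {ω | δ * x < |X (-(b : ℤ)) ω| ∧ x < |X 0 ω|} := by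
    intro ω (hω : x < |X 0 ω|)
    by_cases hb : ∃ b ∈ Finset.Icc (k + 1) (2 * k), δ * x < |X (-(b : ℤ)) ω|
    · obtain ⟨b, hb, hbx⟩ := hb
      exact Or.inr (Set.mem_biUnion hb ⟨hbx, hω⟩)
    · left
      push Not at hb
      have h00 : δ * x < |X (-((0 : ℕ) : ℤ)) ω| := by
        simp only [Nat.cast_zero, neg_zero]; nlinarith
      classical
      set a := Nat.findGreatest (fun a => δ * x < |X (-(a : ℤ)) ω|) k with ha
      have ha1 : δ * x < |X (-(a : ℤ)) ω| := Nat.findGreatest_spec (P := fun a : ℕ =>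
        δ * x < |X (-(a : ℤ)) ω|) (Nat.zero_le k) h00
      have hak : a ≤ k := Nat.findGreatest_le k
      refine Set.mem_biUnion (Finset.mem_coe.2 (Finset.mem_range.2 (Nat.lt_succ_of_le hak)))
        ⟨by simpa using ha1, fun j hj => ?_, by simpa using hω⟩
      simp only [Finset.mem_Icc] at hj
      beta_reduce
      rw [show -(j : ℤ) + -(a : ℤ) = -((a + j : ℕ) : ℤ) by push_cast; ring]
      rcases le_or_gt (a + j) k with h1 | h1
      · exact not_lt.1 (Nat.findGreatest_is_greatest (P := fun a : ℕ =>
          δ * x < |X (-(a : ℤ)) ω|) (show a < a + j by omega) h1)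
      · exact hb _ (by simp only [Finset.mem_Icc]; omega)
  have hb : ∀ b ∈ Finset.Icc (k + 1) (2 * k),
      P.real {ω | δ * x < |X (-(b : ℤ)) ω| ∧ x < |X 0 ω|} ≤
        absTail P (X 0) (δ * x) * absTail P (X 0) x := by
    intro b hb
    simp only [Finset.mem_Icc] at hb
    exact (h.dep.measureReal_two h.meas h.stat (by omega) _ _).le
  calc absTail P (X 0) x ≤ _ := measureReal_mono hsub (measure_ne_top _ _)
    _ ≤ _ := measureReal_union_le _ _
    _ ≤ ∑ a ∈ Finset.range (k + 1), P.real {ω | (fun t => X (t + (-(a : ℤ))) ω) ∈ A a} +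
        ∑ b ∈ Finset.Icc (k + 1) (2 * k), P.real {ω | δ * x < |X (-(b : ℤ)) ω| ∧ x < |X 0 ω|} :=
      add_le_add (measureReal_biUnion_finset_le _ _) (measureReal_biUnion_finset_le _ _)
    _ ≤ ∑ a ∈ Finset.range (k + 1), cutoffIntegral P X φ 1 δ x +
        ∑ b ∈ Finset.Icc (k + 1) (2 * k), absTail P (X 0) (δ * x) * absTail P (X 0) x :=
      add_le_add (Finset.sum_le_sum hAa) (Finset.sum_le_sum hb)
    _ = _ := by
      simp only [Finset.sum_const, Finset.card_range, Nat.card_Icc, nsmul_eq_mul]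
      rw [show 2 * k + 1 - (k + 1) = k by omega]
      push_cast
      ring

/-- If λ_k were 0, the cluster integral of a bump equal to 1 on large windows would vanish, hence
V(δ) → 0. But `absTail_le_cutoffIntegral` forces (k+1)V(δ) ≥ 1 for every small δ. -/
theorem IsTailProcess.lam_pos (h : IsHeavyKDependent P X k α) (hY : IsTailProcess P X α Q Y) :
    0 < lam Q Y k := by
  have h1 := h.one_lt
  have := hY.isProbabilityMeasure_spectralLaw k
  rw [lam_eq hY.measurable]
  by_contra hneg
  have hz : (spectralLaw Q Y k).real (zeroPastWin k) = 0 :=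
    le_antisymm (not_lt.1 hneg) measureReal_nonneg
  rw [measureReal_eq_zero_iff] at hz
  set φ : Win k → ℝ := fun y => min 1 (max (2 * ‖y‖ - 1) 0) with hφdef
  have hφ : Continuous φ := by fun_prop
  have hφ0 : ∀ y, 0 ≤ φ y := fun y => by positivity
  have hB : ∀ y, φ y ≤ 1 := fun y => min_le_left _ _
  have hφc : ∀ y, (∀ t, |y t| ≤ 1 / 2) → φ y = 0 := fun y hy => by
    have : ‖y‖ ≤ 1 / 2 := (pi_norm_le_iff_of_nonneg (by norm_num)).2 hy
    simp only [hφdef]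
    rw [max_eq_right (by linarith), min_eq_right zero_le_one]
  have hφ1 : ∀ y t, 1 ≤ |y t| → 1 ≤ φ y := fun y t hy => by
    have : |y t| ≤ ‖y‖ := norm_le_pi_norm y t
    exact le_min le_rfl (le_max_of_le_left (by linarith))
  obtain ⟨V, hV, hVx⟩ := hY.exists_tendsto_cutoffIntegral h.meas h.stat (by linarith) h.tail hφ hB
    (show (0 : ℝ) < 1 / 2 by norm_num) hφc hφ0 one_pos
  have hI : clusterIntegral Q Y α φ = 0 := by
    rw [hY.clusterIntegral_eq hφ]
    exact setLIntegral_measure_zero _ _ hz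
  rw [hI, ENNReal.toReal_zero] at hV
  have hge : ∀ δ, 0 < δ → δ ≤ 1 → 1 ≤ (k + 1) * V δ := by
    intro δ hδ hδ1
    have hl1 := (hVx δ hδ).const_mul ((k : ℝ) + 1)
    have hl2 : Tendsto (fun x => (k : ℝ) * absTail P (X 0) (δ * x)) atTop (𝓝 0) := by
      have h2 := (h.tail.tendsto_id_mul h1 δ hδ).const_mul (k : ℝ)
      rw [mul_zero] at h2
      refine squeeze_zero' (Eventually.of_forall fun x =>
        mul_nonneg (Nat.cast_nonneg k) (h.tail.pos _).le) ?_ h2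
      filter_upwards [eventually_ge_atTop 1] with x hx
      have := (h.tail.pos (δ * x)).le
      gcongr
      nlinarith
    have hl := hl1.add hl2
    rw [add_zero] at hl
    refine ge_of_tendsto hl ?_
    filter_upwards [eventually_gt_atTop 0] with x hx
    have hF := h.tail.pos x
    have := absTail_le_cutoffIntegral h hφ hφ0 hB hφ1 hδ hδ1 hx
    rw [← mul_div_assoc, ← sub_le_iff_le_add, le_div_iff₀ hF]
    linarith
  have hlim := hV.const_mul ((k : ℝ) + 1)
  rw [mul_zero] at hlim
  have : (1 : ℝ) ≤ 0 := by
    refine ge_of_tendsto hlim ?_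
    filter_upwards [self_mem_nhdsWithin, mem_nhdsWithin_of_mem_nhds (gt_mem_nhds one_pos)]
      with δ hδ hδ1
    exact hge δ hδ (le_of_lt hδ1)
  linarith

end Limits

/-! ### Upper bound for the ruin probability -/

section Deterministic

variable {k : ℕ}

/-- The window of a path around time `i`. -/
def pathWindow (k : ℕ) (a : ℤ → ℝ) (i : ℤ) : Win k := fun t => a (t + i)

theorem sum_posPart_pathWindow (a : ℤ → ℝ) (i : ℕ) {l : ℕ} (hl : l < k + 1) :
    ∑ j ∈ Finset.Iic (⟨l, hl⟩ : Fin (k + 1)), posPart (pathWindow k a i) j =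
      ∑ j ∈ Finset.Icc i (i + l), a j := by
  have h1 : ∑ j ∈ Finset.Iic (⟨l, hl⟩ : Fin (k + 1)), posPart (pathWindow k a i) j =
      ∑ r ∈ Finset.Iic l, a ((r : ℤ) + i) := by
    rw [← Fin.map_valEmbedding_Iic (⟨l, hl⟩ : Fin (k + 1)), Finset.sum_map]
    rfl
  rw [h1]
  refine Finset.sum_nbij' (fun r => r + i) (fun j => j - i) ?_ ?_ ?_ ?_ ?_
  · intro r hr; simp only [Finset.mem_Iic, Finset.mem_Icc] at hr ⊢; omega
  · intro r hr; simp only [Finset.mem_Iic, Finset.mem_Icc] at hr ⊢; omega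
  · intro r hr; simp
  · intro r hr; simp only [Finset.mem_Icc] at hr; omega
  · intro r hr; push_cast; rfl

/-- If the truncated sums stay small and there is a single cluster of exceedances, a high level of
the walk is reached through this cluster. -/
theorem exists_mem_clusterSet {a : ℤ → ℝ} {n t : ℕ} {b e v ρ : ℝ} (hb : 0 ≤ b) (hρ : 0 ≤ ρ)
    (htn : t ≤ n)
    (hfar : ∀ i ∈ Finset.Icc 1 n, ∀ j ∈ Finset.Icc 1 n, i + k < j → b < |a (i : ℤ)| →
      |a (j : ℤ)| ≤ b)
    (hinit : ∀ i ∈ Finset.Icc 1 k, |a (i : ℤ)| ≤ b)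
    (hsmall : ∑ i ∈ Finset.Icc 1 t, trunc b (a i) ≤ e) (hev : e ≤ v)
    (hwalk : v + ρ * t < ∑ i ∈ Finset.Icc 1 t, a i) :
    ∃ i ∈ Finset.Icc 1 n, pathWindow k a i ∈ clusterSet k b (v - e - (k + 1) * b + ρ * (i : ℝ)) := by
  classical
  -- Without an exceedance up to t, truncation changes nothing and the walk would be at most e ≤ v.
  have hex : ∃ i : ℕ, 1 ≤ i ∧ i ≤ t ∧ b < |a (i : ℤ)| := by
    by_contra! hno
    have : ∑ i ∈ Finset.Icc 1 t, trunc b (a i) = ∑ i ∈ Finset.Icc 1 t, a i :=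
      Finset.sum_congr rfl fun i hi => by
        simp only [Finset.mem_Icc] at hi
        exact trunc_of_le (hno i hi.1 hi.2)
    have : 0 ≤ ρ * t := by positivity
    linarith
  set i₀ := Nat.find hex with hi₀
  obtain ⟨h1, h2, h3⟩ := Nat.find_spec hex
  have hbefore : ∀ j : ℕ, 1 ≤ j → j < i₀ → |a (j : ℤ)| ≤ b := by
    intro j hj hji
    have := Nat.find_min hex hji
    by_contra hc
    exact this ⟨hj, by omega, not_le.1 hc⟩
  have hk : k < i₀ := by
    by_contra hc
    have := hinit i₀ (by simp only [Finset.mem_Icc]; omega)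
    linarith
  -- The cluster is followed until time i₀ + k, or until t if the level is reached earlier.
  set l := min t (i₀ + k) - i₀ with hl
  have hlk : l < k + 1 := by omega
  have hil : i₀ + l = min t (i₀ + k) := by omega
  refine ⟨i₀, by simp only [Finset.mem_Icc]; omega, ?_, ?_, ?_⟩
  · simpa [pathWindow, origin] using h3
  · rintro ⟨s, hs⟩ hs0
    simp only [Set.mem_Icc] at hs hs0
    have := hbefore (s + i₀).toNat (by omega) (by omega)
    rw [show (((s + i₀).toNat : ℕ) : ℤ) = s + i₀ by omega] at this
    exact this
  · refine lt_of_lt_of_le ?_ (sum_posPart_le_maxSum _ ⟨l, hlk⟩)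
    rw [sum_posPart_pathWindow]
    -- Only times in the cluster contribute to the untruncated part: earlier ones precede the first
    -- exceedance, later ones are excluded by `hfar`. Undoing the truncation there costs at most
    -- (k+1)b.
    have e1 : ∑ i ∈ Finset.Icc 1 t, (a i - trunc b (a i)) =
        ∑ i ∈ Finset.Icc i₀ (i₀ + l), (a i - trunc b (a i)) := by
      symm
      apply Finset.sum_subset
      · apply Finset.Icc_subset_Icc <;> omega
      · intro j hj hj'
        simp only [Finset.mem_Icc] at hj hj'
        rw [trunc_of_le, sub_self]
        rcases lt_or_ge j i₀ with h | h
        · exact hbefore j hj.1 h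
        · exact hfar i₀ (by simp only [Finset.mem_Icc]; omega) j
            (by simp only [Finset.mem_Icc]; omega) (by omega) h3
    have e2 : ∑ i ∈ Finset.Icc i₀ (i₀ + l), (a i - trunc b (a i)) ≤
        ∑ i ∈ Finset.Icc i₀ (i₀ + l), (a i + b) := by
      refine Finset.sum_le_sum fun i _ => ?_
      have := (abs_le.1 (abs_trunc_le_level hb (a i))).1
      linarith
    have e3 : ∑ i ∈ Finset.Icc i₀ (i₀ + l), (a i + b) ≤
        ∑ i ∈ Finset.Icc i₀ (i₀ + l), a i + (k + 1) * b := by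
      rw [Finset.sum_add_distrib, Finset.sum_const, Nat.card_Icc, nsmul_eq_mul]
      have : ((i₀ + l + 1 - i₀ : ℕ) : ℝ) ≤ k + 1 := by
        have : i₀ + l + 1 - i₀ ≤ k + 1 := by omega
        exact_mod_cast this
      gcongr
    rw [Finset.sum_sub_distrib] at e1
    have h4 : ρ * (i₀ : ℝ) ≤ ρ * t := by
      have : (i₀ : ℝ) ≤ t := by exact_mod_cast h2
      gcongr
    linarith

end Deterministic

namespace IsHeavyKDependent

variable {Ω : Type*} [mΩ : MeasurableSpace Ω] {P : Measure Ω} {X : ℤ → Ω → ℝ}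
  {k : ℕ} {α : ℝ}

theorem measureReal_pathWindow (h : IsHeavyKDependent P X k α) (i : ℤ) {s : Set (Win k)}
    (hs : MeasurableSet s) :
    P.real {ω | pathWindow k (fun t => X t ω) i ∈ s} = P.real {ω | window X k ω ∈ s} := by
  have hm : Measurable (fun (a : ℤ → ℝ) => (fun t => a t : Win k)) :=
    measurable_pi_lambda _ fun t => measurable_pi_apply _
  exact h.stat.measureReal_path h.meas i (hm hs)

/-- The first four terms are the bad events: late ruin, an exceedance among the first k times, two
distant exceedances, a large truncated sum. Off these, `exists_mem_clusterSet` applies. The level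
drops by 2η: one η for the truncated sum, one for (k+1)δ. -/
theorem ruinProb_le [IsProbabilityMeasure P] (h : IsHeavyKDependent P X k α) {ρ η δ K x : ℝ} (hρ : 0 < ρ) (hη : η ≤ 1)
    (hδ : 0 < δ) (hδη : (k + 1) * δ ≤ η) (hK : 0 ≤ K) (hx : 0 < x) :
    ruinProb P X ρ x ≤ P.real {ω | ∃ t : ℕ, K * x ≤ t ∧ ρ * t < walk X t ω} +
      k * absTail P (X 0) (δ * x) + (K * x * absTail P (X 0) (δ * x)) ^ 2 +
      P.real {ω | ∃ t ≤ ⌊K * x⌋₊, η * x < ∑ i ∈ Finset.Icc 1 t, 1 * trunc (δ * x) (X i ω)} +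
      x * cutoffIntegral P X (excess (k := k) (1 - 2 * η) ρ K) 1 δ x := by
  set n := ⌊K * x⌋₊ with hn
  have hnK : (n : ℝ) ≤ K * x := Nat.floor_le (by positivity)
  set G : ℕ → Set Ω := fun i => {ω | pathWindow k (fun t => X t ω) i ∈
    clusterSet k (δ * x) ((1 - 2 * η) * x + ρ * (i : ℝ))} with hG
  have hsub : {ω | (x : EReal) < ⨆ t : ℕ, ((walk X t ω - ρ * t : ℝ) : EReal)} ⊆
      ((({ω | ∃ t : ℕ, K * x ≤ t ∧ ρ * t < walk X t ω} ∪
      {ω | ∃ i ∈ Finset.Icc 1 k, δ * x < |X (i : ℤ) ω|}) ∪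
      {ω | ∃ i ∈ Finset.Icc 1 n, ∃ j ∈ Finset.Icc 1 n, i + k < j ∧
        δ * x < |X (i : ℤ) ω| ∧ δ * x < |X (j : ℤ) ω|}) ∪
      {ω | ∃ t ≤ n, η * x < ∑ i ∈ Finset.Icc 1 t, 1 * trunc (δ * x) (X i ω)}) ∪
      ⋃ i ∈ Finset.Icc 1 n, G i := by
    intro ω hω
    have hω' : (x : EReal) < ⨆ t : ℕ, ((walk X t ω - ρ * t : ℝ) : EReal) := hω
    obtain ⟨t, ht⟩ := lt_iSup_iff.1 hω'
    have ht' : x < walk X t ω - ρ * t := by exact_mod_cast ht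
    by_contra hno
    simp only [Set.mem_union, Set.mem_iUnion, Set.mem_ofPred_eq, not_or, not_exists, not_and,
      not_lt] at hno
    obtain ⟨⟨⟨⟨h1, h2⟩, h3⟩, h4⟩, h5⟩ := hno
    have htn : t ≤ n := by
      by_contra hc
      have h6 := h1 t (by
        have : K * x < t := (Nat.floor_lt (by positivity)).1 (not_le.1 hc)
        exact this.le)
      linarith
    have hs := h4 t htn
    simp only [one_mul] at hs
    obtain ⟨i, hi, hmem⟩ := exists_mem_clusterSet (k := k) (a := fun t => X t ω) (n := n) (t := t)
      (b := δ * x) (e := η * x) (v := x) (ρ := ρ) (by positivity) hρ.le htn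
      (fun i hi j hj hij hbi => h3 i hi j hj hij hbi) h2 hs (by nlinarith)
      (by unfold walk at ht'; linarith)
    refine h5 i hi ⟨hmem.1, hmem.2.1, lt_of_le_of_lt ?_ hmem.2.2⟩
    nlinarith
  have hGsum : P.real (⋃ i ∈ Finset.Icc 1 n, G i) ≤
      x * cutoffIntegral P X (excess (k := k) (1 - 2 * η) ρ K) 1 δ x := by
    refine (measureReal_biUnion_finset_le _ _).trans (le_trans (Finset.sum_le_sum fun i _ => ?_)
      (sum_cluster_le h.meas hδ hx hρ hK hnK))
    exact (h.measureReal_pathWindow i (measurableSet_clusterSet _ _)).le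
  have hF := h.tail.pos (δ * x)
  have htwo : P.real {ω | ∃ i ∈ Finset.Icc 1 n, ∃ j ∈ Finset.Icc 1 n, i + k < j ∧
        δ * x < |X (i : ℤ) ω| ∧ δ * x < |X (j : ℤ) ω|} ≤
      (K * x * absTail P (X 0) (δ * x)) ^ 2 := by
    refine (h.measureReal_two_exceedances_le n (δ * x)).trans ?_
    gcongr
  refine (measureReal_mono hsub (measure_ne_top _ _)).trans ?_
  refine (measureReal_union_le _ _).trans (add_le_add ?_ hGsum)
  refine (measureReal_union_le _ _).trans (add_le_add ?_ le_rfl)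
  refine (measureReal_union_le _ _).trans (add_le_add ?_ htwo)
  exact (measureReal_union_le _ _).trans (add_le_add le_rfl (h.measureReal_exists_lt_abs_le k _))

theorem tendsto_absTail_div (h : IsHeavyKDependent P X k α) {δ : ℝ} (hδ : 0 < δ) :
    Tendsto (fun x => absTail P (X 0) (δ * x) / (x * absTail P (X 0) x)) atTop (𝓝 0) := by
  have := (h.tail.tendsto δ hδ).mul tendsto_inv_atTop_zero
  rw [mul_zero] at this
  refine this.congr' ?_
  filter_upwards [eventually_gt_atTop 0] with x hx
  have := (h.tail.pos x).ne'
  field_simp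

theorem tendsto_sq_absTail_div (h : IsHeavyKDependent P X k α) {δ : ℝ} (hδ : 0 < δ) (K : ℝ) :
    Tendsto (fun x => (K * x * absTail P (X 0) (δ * x)) ^ 2 / (x * absTail P (X 0) x)) atTop
      (𝓝 0) := by
  have := ((h.tail.tendsto_id_mul h.one_lt δ hδ).mul (h.tail.tendsto δ hδ)).const_mul (K ^ 2)
  rw [zero_mul, mul_zero] at this
  refine this.congr' ?_
  filter_upwards [eventually_gt_atTop 0] with x hx
  have := (h.tail.pos x).ne'
  field_simp

end IsHeavyKDependent

section Upper

variable {Ω Ω' : Type*} [MeasurableSpace Ω] [MeasurableSpace Ω'] {P : Measure Ω}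
  [IsProbabilityMeasure P] {X : ℤ → Ω → ℝ} {α : ℝ} {Q : Measure Ω'} [IsProbabilityMeasure Q]
  {Y : ℤ → Ω' → ℝ} {k : ℕ}

theorem IsTailProcess.exists_tendsto_excess (h : IsHeavyKDependent P X k α)
    (hY : IsTailProcess P X α Q Y) {c ρ K κ : ℝ} (hc : 0 < c) (hρ : 0 < ρ) (hK : 0 ≤ K)
    (hκ : 0 < κ) : ∃ V : ℝ → ℝ,
      Tendsto V (𝓝[>] 0) (𝓝 (clusterIntegral (k := k) Q Y α (excess c ρ K)).toReal) ∧
      ∀ δ, 0 < δ → Tendsto (fun x => cutoffIntegral P X (excess (k := k) c ρ K) κ δ x /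
        absTail P (X 0) x) atTop (𝓝 (V δ)) :=
  hY.exists_tendsto_cutoffIntegral h.meas h.stat (by linarith [h.one_lt]) h.tail
    (continuous_excess c ρ K) (fun y => min_le_left _ _) (c := c / (k + 1)) (by positivity)
    (fun _ hy => excess_eq_zero hc.le hK hy) (excess_nonneg hρ hK) hκ

theorem tendsto_mul_rpow_one_add (J α ρ s : ℝ) :
    Tendsto (fun η : ℝ => J * ((1 + s * η) ^ (1 - α) / (α - 1) / ρ)) (𝓝[>] 0)
      (𝓝 (J * (1 / (α - 1) / ρ))) := by
  have h1 : Tendsto (fun η : ℝ => 1 + s * η) (𝓝[>] 0) (𝓝 1) := by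
    have : Tendsto (fun η : ℝ => 1 + s * η) (𝓝 0) (𝓝 (1 + s * 0)) :=
      (continuous_const.add (continuous_const.mul continuous_id)).tendsto 0
    rw [mul_zero, add_zero] at this
    exact this.mono_left nhdsWithin_le_nhds
  have h2 := h1.rpow_const (p := 1 - α) (Or.inl one_ne_zero)
  rw [Real.one_rpow] at h2
  exact ((h2.div_const _).div_const _).const_mul J

/-- Upper bound for the ruin probability. -/
theorem IsTailProcess.eventually_ruinProb_le (h : IsHeavyKDependent P X k α)
    (hY : IsTailProcess P X α Q Y) {ρ : ℝ} (hρ : 0 < ρ) {ε : ℝ} (hε : 0 < ε) :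
    ∀ᶠ x in atTop, ruinProb P X ρ x / (x * absTail P (X 0) x) ≤
      (clusterConst Q Y k α).toReal * (1 / (α - 1) / ρ) + ε := by
  have h1 := h.one_lt
  have hα1 : 0 < α - 1 := by linarith
  set J := (clusterConst Q Y k α).toReal with hJ
  have hJfin := hY.clusterConst_lt_top (k := k) h.meas h.stat (by linarith) h.tail
  -- Parameters are fixed in the order η, K, δ, and x tends to infinity last; K comes from the late
  -- bound and δ must also suit the Chernoff estimate.
  obtain ⟨η, ⟨hη0, hη1⟩, hηJ⟩ : ∃ η : ℝ, (0 < η ∧ η < 1 / 4) ∧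
      J * ((1 + (-2) * η) ^ (1 - α) / (α - 1) / ρ) < J * (1 / (α - 1) / ρ) + ε / 4 := by
    have e1 := (tendsto_mul_rpow_one_add J α ρ (-2)).eventually
      (gt_mem_nhds (show J * (1 / (α - 1) / ρ) < J * (1 / (α - 1) / ρ) + ε / 4 by linarith))
    have e2 : ∀ᶠ η : ℝ in 𝓝[>] 0, η < 1 / 4 :=
      mem_nhdsWithin_of_mem_nhds (gt_mem_nhds (by norm_num))
    have e3 : ∀ᶠ η : ℝ in 𝓝[>] 0, 0 < η := self_mem_nhdsWithin
    obtain ⟨η, ha, hb, hc⟩ := (e1.and (e2.and e3)).exists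
    exact ⟨η, ⟨hc, hb⟩, ha⟩
  obtain ⟨C, hC, hlate⟩ := h.exists_late_bound hρ
  obtain ⟨K, hK1, hKC⟩ : ∃ K : ℝ, 1 ≤ K ∧ C * K ^ (1 - α) < ε / 4 := by
    have e1 : Tendsto (fun K : ℝ => C * K ^ (-(α - 1))) atTop (𝓝 0) := by
      simpa using (tendsto_rpow_neg_atTop hα1).const_mul C
    obtain ⟨K, ha, hb⟩ := ((e1.eventually (gt_mem_nhds (show (0 : ℝ) < ε / 4 by positivity))).and
      (eventually_ge_atTop 1)).exists
    refine ⟨K, hb, ?_⟩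
    rwa [show 1 - α = -(α - 1) by ring]
  have hK0 : 0 < K := by linarith
  have hc : 0 < 1 - 2 * η := by linarith
  obtain ⟨V, hV, hVx⟩ := hY.exists_tendsto_excess h hc hρ hK0.le one_pos
  obtain ⟨δ₀, hδ₀, hNB⟩ := h.truncated_sum_bound (σ := 1) (by simp) hη0 hK0
    (show 0 < α by linarith)
  have hIle : (clusterIntegral (k := k) Q Y α (excess (1 - 2 * η) ρ K)).toReal ≤
      J * ((1 + (-2) * η) ^ (1 - α) / (α - 1) / ρ) := by
    have h2 := hY.clusterIntegral_excess_le (k := k) (ρ := ρ) (K := K) h1 hc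
    have h3 := ENNReal.toReal_mono (ENNReal.mul_lt_top hJfin ENNReal.ofReal_lt_top).ne h2
    rw [ENNReal.toReal_mul, ENNReal.toReal_ofReal (by positivity)] at h3
    rwa [show 1 + (-2) * η = 1 - 2 * η by ring]
  obtain ⟨δ, hδ, hδ1, hδ2, hVδ⟩ : ∃ δ : ℝ, 0 < δ ∧ δ ≤ δ₀ ∧ (k + 1) * δ ≤ η ∧
      V δ < J * (1 / (α - 1) / ρ) + ε / 4 := by
    have e1 := hV.eventually (gt_mem_nhds (hIle.trans_lt hηJ))
    have e2 : ∀ᶠ δ : ℝ in 𝓝[>] 0, δ < min δ₀ (η / (k + 1)) :=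
      mem_nhdsWithin_of_mem_nhds (gt_mem_nhds (lt_min hδ₀ (by positivity)))
    have e3 : ∀ᶠ δ : ℝ in 𝓝[>] 0, 0 < δ := self_mem_nhdsWithin
    obtain ⟨δ, ha, hb, hc⟩ := (e1.and (e2.and e3)).exists
    refine ⟨δ, hc, (hb.trans_le (min_le_left _ _)).le, ?_, ha⟩
    have := (hb.trans_le (min_le_right _ _)).le
    rw [le_div_iff₀ (by positivity)] at this
    linarith
  have herr : Tendsto (fun x => k * (absTail P (X 0) (δ * x) / (x * absTail P (X 0) x)) +
      (K * x * absTail P (X 0) (δ * x)) ^ 2 / (x * absTail P (X 0) x) +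
      x ^ (-α) / (x * absTail P (X 0) x)) atTop (𝓝 0) := by
    have := (((h.tendsto_absTail_div hδ).const_mul (k : ℝ)).add
      (h.tendsto_sq_absTail_div hδ K)).add (h.tail.tendsto_rpow_neg_div h1 (γ := α) (by linarith))
    simpa using this
  filter_upwards [herr.eventually (gt_mem_nhds (show (0 : ℝ) < ε / 4 by positivity)),
    (hVx δ hδ).eventually (gt_mem_nhds hVδ), hlate K hK1, hNB δ hδ hδ1, eventually_gt_atTop 0]
    with x he hVlt hl hnb hx
  have hF := h.tail.pos x
  have hxF : 0 < x * absTail P (X 0) x := by positivity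
  have hb := h.ruinProb_le hρ (show η ≤ 1 by linarith) hδ hδ2 hK0.le hx
  have hnb' := hnb ⌊K * x⌋₊ (Nat.floor_le (by positivity))
  rw [div_le_iff₀ hxF]
  have i1 : C * K ^ (1 - α) * (x * absTail P (X 0) x) ≤ ε / 4 * (x * absTail P (X 0) x) := by
    gcongr
  have i2 : k * absTail P (X 0) (δ * x) + (K * x * absTail P (X 0) (δ * x)) ^ 2 + x ^ (-α) ≤
      ε / 4 * (x * absTail P (X 0) x) := by
    rw [← mul_div_assoc, ← add_div, ← add_div, div_lt_iff₀ hxF] at he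
    exact he.le
  have i3 : x * cutoffIntegral P X (excess (k := k) (1 - 2 * η) ρ K) 1 δ x ≤
      (J * (1 / (α - 1) / ρ) + ε / 4) * (x * absTail P (X 0) x) := by
    rw [div_lt_iff₀ hF] at hVlt
    nlinarith
  nlinarith

end Upper

/-! ### Lower bound for the ruin probability -/

theorem walk_eq_sum_Ioc {Ω : Type*} (X : ℤ → Ω → ℝ) (t : ℕ) (ω : Ω) :
    walk X t ω = ∑ i ∈ Finset.Ioc 0 t, X (i : ℤ) ω := rfl

/-- A high cluster started from a moderate position leads to ruin. -/
theorem exists_lt_walk_of_mem_clusterSet {Ω : Type*} {X : ℤ → Ω → ℝ} {k i : ℕ} {ω : Ω}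
    {b d v ρ : ℝ} (hb : 0 ≤ b) (hρ : 0 ≤ ρ) (hi : 1 ≤ i)
    (hmem : pathWindow k (fun t => X t ω) i ∈ clusterSet k b (v + d + k * b + ρ * k + ρ * (i : ℝ)))
    (hd : -d ≤ walk X (i - 1 - k) ω) : ∃ t : ℕ, v < walk X t ω - ρ * t := by
  obtain ⟨-, hpast, hmax⟩ := hmem
  obtain ⟨⟨l, hl⟩, hleq⟩ := exists_maxSum_eq (pathWindow k (fun t => X t ω) i)
  rw [sum_posPart_pathWindow] at hleq
  refine ⟨i + l, ?_⟩
  have e1 : walk X (i + l) ω = walk X (i - 1 - k) ω +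
      ∑ j ∈ Finset.Ioc (i - 1 - k) (i - 1), X (j : ℤ) ω +
      ∑ j ∈ Finset.Icc i (i + l), X (j : ℤ) ω := by
    have : Finset.Icc i (i + l) = Finset.Ioc (i - 1) (i + l) := by
      ext j; simp only [Finset.mem_Icc, Finset.mem_Ioc]; omega
    rw [this, walk_eq_sum_Ioc, walk_eq_sum_Ioc,
      Finset.sum_Ioc_consecutive _ (Nat.zero_le _) (by omega),
      Finset.sum_Ioc_consecutive _ (Nat.zero_le _) (by omega)]
  -- The gap of k times before i keeps the earlier walk independent of X_i. It costs at most kb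
  -- since these values are bounded by b; truncated subtraction only shortens the gap.
  have e2 : -(k * b) ≤ ∑ j ∈ Finset.Ioc (i - 1 - k) (i - 1), X (j : ℤ) ω := by
    have h1 : ∑ j ∈ Finset.Ioc (i - 1 - k) (i - 1), (-b) ≤
        ∑ j ∈ Finset.Ioc (i - 1 - k) (i - 1), X (j : ℤ) ω := by
      refine Finset.sum_le_sum fun j hj => ?_
      simp only [Finset.mem_Ioc] at hj
      have h2 := hpast ⟨(j : ℤ) - i, by simp only [Set.mem_Icc]; omega⟩ (by simp only; omega)
      simp only [pathWindow, sub_add_cancel] at h2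
      exact (abs_le.1 h2).1
    refine le_trans ?_ h1
    rw [Finset.sum_const, Nat.card_Ioc, nsmul_eq_mul]
    have : ((i - 1 - (i - 1 - k) : ℕ) : ℝ) ≤ k := by
      have : i - 1 - (i - 1 - k) ≤ k := by omega
      exact_mod_cast this
    nlinarith
  have e3 : ρ * ((i + l : ℕ) : ℝ) ≤ ρ * k + ρ * i := by
    have : (l : ℝ) ≤ k := by exact_mod_cast Nat.lt_succ_iff.1 hl
    push_cast
    nlinarith
  rw [e1, hleq]
  linarith

namespace IsHeavyKDependent

variable {Ω : Type*} [mΩ : MeasurableSpace Ω] {P : Measure Ω} {X : ℤ → Ω → ℝ}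
  {k : ℕ} {α : ℝ}

theorem measurable_walk (h : IsHeavyKDependent P X k α) (t : ℕ) : Measurable (walk X t) :=
  Finset.measurable_fun_sum _ fun i _ => h.meas i

variable [IsProbabilityMeasure P]

/-- The walk stops k+1 steps before i, so k-dependence applies; if i ≤ k+1 the walk is the empty
sum. -/
theorem measureReal_lt_abs_inter_walk_lt (h : IsHeavyKDependent P X k α) {i : ℕ} (y z : ℝ) :
    P.real ({ω | walk X (i - 1 - k) ω < z} ∩ {ω | y < |X (i : ℤ) ω|}) =
      P.real {ω | walk X (i - 1 - k) ω < z} * absTail P (X 0) y := by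
  have hw : Measurable[past X ((i : ℤ) - 1 - k)] (walk X (i - 1 - k)) := by
    refine @Finset.measurable_fun_sum _ _ _ _ _ _ (past X ((i : ℤ) - 1 - k)) _ _ fun j hj => ?_
    simp only [Finset.mem_Icc] at hj
    exact measurable_past (by omega)
  have hA : MeasurableSet[past X ((i : ℤ) - 1 - k)] {ω | walk X (i - 1 - k) ω < z} :=
    hw measurableSet_Iio
  rw [h.dep.measureReal_inter h.meas h.stat (m := (i : ℤ) - 1 - k) (n := i) (by omega)
    hA (measurableSet_future_lt_abs le_rfl y), ← h.stat.absTail_eq h.meas i]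
  rfl

/-- Ruin contains a disjoint union of events A_i: a high cluster starts at i, the walk before it is
not below -ηx, and no exceedance follows more than k later. Disjointness makes the probabilities
add. The 3η pays for the starting position, for kδ and for the drift ρk over the cluster. -/
theorem le_ruinProb (h : IsHeavyKDependent P X k α) {ρ η δ K x : ℝ} (hρ : 0 < ρ)
    (hδ : 0 < δ) (hδη : k * δ ≤ η) (hK : 0 ≤ K) (hx : 0 < x) (hxρ : ρ * k ≤ η * x) :
    x * cutoffIntegral P X (excess (k := k) (1 + 3 * η) ρ K) 2 δ x - absTail P (X 0) (δ * x) -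
      K * x * absTail P (X 0) (δ * x) *
        P.real {ω | ∃ t ≤ ⌊K * x⌋₊, walk X t ω < -(η * x)} -
      (K * x * absTail P (X 0) (δ * x)) ^ 2 ≤ ruinProb P X ρ x := by
  set n := ⌊K * x⌋₊ with hn
  have hnK : (n : ℝ) ≤ K * x := Nat.floor_le (by positivity)
  have hnK2 : K * x ≤ n + 1 := (Nat.lt_floor_add_one _).le
  set F := absTail P (X 0) with hFdef
  have hF := h.tail.pos (δ * x)
  set p := P.real {ω | ∃ t ≤ n, walk X t ω < -(η * x)} with hp
  set G : ℕ → Set Ω := fun i => {ω | pathWindow k (fun t => X t ω) i ∈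
    clusterSet k (δ * x) ((1 + 3 * η) * x + ρ * (i : ℝ))} with hG
  have hGm : ∀ i, MeasurableSet (G i) := fun i =>
    (measurable_pi_lambda _ fun t => h.meas _ :
      Measurable fun ω => pathWindow k (fun t => X t ω) i) (measurableSet_clusterSet _ _)
  have hG0 : ∀ i ω, ω ∈ G i → δ * x < |X (i : ℤ) ω| := fun i ω hω => by
    have := hω.1
    simpa [pathWindow, origin] using this
  set D : ℕ → Set Ω := fun i => {ω | walk X (i - 1 - k) ω < -(η * x)} with hD
  have hDm : ∀ i, MeasurableSet (D i) := fun i => measurableSet_lt (h.measurable_walk _) measurable_const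
  set R : ℕ → Set Ω := fun i => ⋃ j ∈ (Finset.Icc 1 n).filter (fun j => i + k < j),
    {ω | δ * x < |X (j : ℤ) ω|} with hR
  have hRm : ∀ i, MeasurableSet (R i) := fun i => Finset.measurableSet_biUnion _ fun j _ =>
    measurableSet_lt measurable_const (h.meas j).abs
  set A : ℕ → Set Ω := fun i => (G i \ D i) \ R i with hA
  have hAm : ∀ i, MeasurableSet (A i) := fun i => ((hGm i).diff (hDm i)).diff (hRm i)
  -- If j ≤ i + k, the exceedance at i contradicts the quiet past required at j; otherwise j lies in
  -- the range forbidden by R i.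
  have hdisj' : ∀ i ∈ Finset.Icc 1 n, ∀ j ∈ Finset.Icc 1 n, i < j → Disjoint (A i) (A j) := by
    intro i hi j hj hij
    rw [Set.disjoint_left]
    rintro ω ⟨⟨hGi, -⟩, hRi⟩ ⟨⟨hGj, -⟩, -⟩
    rcases le_or_gt j (i + k) with hjk | hjk
    · have h1 := hGj.2.1 ⟨(i : ℤ) - j, by simp only [Set.mem_Icc]; omega⟩ (by simp only; omega)
      simp only [pathWindow, sub_add_cancel] at h1
      have := hG0 i ω hGi
      linarith
    · exact hRi (Set.mem_biUnion (by simp only [Finset.coe_filter, Set.mem_ofPred_eq]; exact ⟨hj, hjk⟩)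
        (hG0 j ω hGj))
  have hdisj : Set.PairwiseDisjoint (↑(Finset.Icc 1 n)) A := by
    intro i hi j hj hij
    rcases lt_or_gt_of_ne hij with h1 | h1
    · exact hdisj' i hi j hj h1
    · exact (hdisj' j hj i hi h1).symm
  have hsub : (⋃ i ∈ Finset.Icc 1 n, A i) ⊆
      {ω | (x : EReal) < ⨆ t : ℕ, ((walk X t ω - ρ * t : ℝ) : EReal)} := by
    intro ω hω
    simp only [Set.mem_iUnion] at hω
    obtain ⟨i, hi, ⟨hGi, hDi⟩, -⟩ := hω
    obtain ⟨t, ht⟩ := exists_lt_walk_of_mem_clusterSet (X := X) (k := k) (i := i) (ω := ω)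
      (b := δ * x) (d := η * x) (v := x) (ρ := ρ) (by positivity) hρ.le (Finset.mem_Icc.1 hi).1
      ⟨hGi.1, hGi.2.1, lt_of_le_of_lt (by nlinarith) hGi.2.2⟩ (not_lt.1 hDi)
    have ht' : (x : EReal) < ((walk X t ω - ρ * t : ℝ) : EReal) := by exact_mod_cast ht
    exact ht'.trans_le (le_iSup (fun t : ℕ => ((walk X t ω - ρ * t : ℝ) : EReal)) t)
  have hAi : ∀ i ∈ Finset.Icc 1 n, P.real (G i) - F (δ * x) * p - n * F (δ * x) ^ 2 ≤
      P.real (A i) := by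
    intro i hi
    have h1 : P.real (G i) ≤ P.real (A i) + P.real (D i ∩ {ω | δ * x < |X (i : ℤ) ω|}) +
        P.real (⋃ j ∈ (Finset.Icc 1 n).filter (fun j => i + k < j),
          {ω | δ * x < |X (i : ℤ) ω| ∧ δ * x < |X (j : ℤ) ω|}) := by
      refine (measureReal_mono ?_ (measure_ne_top _ _)).trans ((measureReal_union_le _ _).trans
        (add_le_add (measureReal_union_le _ _) le_rfl))
      intro ω hω
      by_cases hd : ω ∈ D i
      · exact Or.inl (Or.inr ⟨hd, hG0 i ω hω⟩)
      · by_cases hr : ω ∈ R i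
        · right
          simp only [hR, Set.mem_iUnion] at hr
          obtain ⟨j, hj, hjx⟩ := hr
          exact Set.mem_biUnion hj ⟨hG0 i ω hω, hjx⟩
        · exact Or.inl (Or.inl ⟨⟨hω, hd⟩, hr⟩)
    have h2 : P.real (D i ∩ {ω | δ * x < |X (i : ℤ) ω|}) ≤ F (δ * x) * p := by
      rw [h.measureReal_lt_abs_inter_walk_lt, mul_comm]
      refine mul_le_mul_of_nonneg_left (measureReal_mono ?_ (measure_ne_top _ _)) hF.le
      intro ω hω
      have := (Finset.mem_Icc.1 hi).2
      exact ⟨i - 1 - k, by omega, hω⟩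
    have h3 : P.real (⋃ j ∈ (Finset.Icc 1 n).filter (fun j => i + k < j),
          {ω | δ * x < |X (i : ℤ) ω| ∧ δ * x < |X (j : ℤ) ω|}) ≤ n * F (δ * x) ^ 2 := by
      refine (measureReal_biUnion_finset_le _ _).trans ?_
      calc _ ≤ ∑ j ∈ (Finset.Icc 1 n).filter (fun j => i + k < j), F (δ * x) ^ 2 := by
            refine Finset.sum_le_sum fun j hj => ?_
            have := (Finset.mem_filter.1 hj).2
            rw [h.dep.measureReal_two h.meas h.stat (by omega), sq]
        _ ≤ ∑ j ∈ Finset.Icc 1 n, F (δ * x) ^ 2 :=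
            Finset.sum_le_sum_of_subset_of_nonneg (Finset.filter_subset _ _) fun _ _ _ => sq_nonneg _
        _ = _ := by simp
    linarith
  have hGsum := le_sum_cluster (P := P) (k := k) h.meas (c := 1 + 3 * η) hδ hx hρ hK hnK2
  have hGeq : ∑ i ∈ Finset.Icc 1 n, P.real (G i) = ∑ i ∈ Finset.Icc 1 n,
      P.real {ω | window X k ω ∈ clusterSet k (δ * x) ((1 + 3 * η) * x + ρ * (i : ℝ))} :=
    Finset.sum_congr rfl fun i _ => h.measureReal_pathWindow i (measurableSet_clusterSet _ _)
  have hAsum := Finset.sum_le_sum hAi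
  rw [Finset.sum_sub_distrib, Finset.sum_sub_distrib, hGeq] at hAsum
  simp only [Finset.sum_const, Nat.card_Icc, nsmul_eq_mul, Nat.add_sub_cancel] at hAsum
  have hU : P.real (⋃ i ∈ Finset.Icc 1 n, A i) = ∑ i ∈ Finset.Icc 1 n, P.real (A i) :=
    measureReal_biUnion_finset hdisj fun i _ => hAm i
  have hfinal := measureReal_mono (μ := P) hsub (measure_ne_top _ _)
  rw [hU] at hfinal
  have hp0 : 0 ≤ p := measureReal_nonneg
  have b1 : (n : ℝ) * (F (δ * x) * p) ≤ K * x * F (δ * x) * p := by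
    rw [mul_assoc (K * x)]
    gcongr
  have b2 : (n : ℝ) * (n * F (δ * x) ^ 2) ≤ (K * x * F (δ * x)) ^ 2 := by
    calc (n : ℝ) * (n * F (δ * x) ^ 2) = (n * F (δ * x)) ^ 2 := by ring
      _ ≤ _ := by gcongr
  have : P.real {ω | (x : EReal) < ⨆ t : ℕ, ((walk X t ω - ρ * t : ℝ) : EReal)} =
      ruinProb P X ρ x := rfl
  linarith

/-- Up to time `K x`, the walk stays above `-η x` with high probability. -/
theorem tendsto_measureReal_walk_lt (h : IsHeavyKDependent P X k α) {η K : ℝ} (hη : 0 < η)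
    (hK : 0 < K) :
    Tendsto (fun x => P.real {ω | ∃ t ≤ ⌊K * x⌋₊, walk X t ω < -(η * x)}) atTop (𝓝 0) := by
  have h1 := h.one_lt
  obtain ⟨δ, hδ, hb⟩ := h.truncated_sum_bound (σ := -1) (by simp) hη hK
    (show 0 < α by linarith)
  have hlim : Tendsto (fun x => K * (x * absTail P (X 0) (δ * x)) + x ^ (-α)) atTop (𝓝 0) := by
    have := ((h.tail.tendsto_id_mul h1 δ hδ).const_mul K).add
      (tendsto_rpow_neg_atTop (y := α) (by linarith))
    simpa using this
  refine squeeze_zero' (Eventually.of_forall fun x => measureReal_nonneg) ?_ hlim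
  filter_upwards [hb δ hδ le_rfl, eventually_gt_atTop 0] with x hx hx0
  set n := ⌊K * x⌋₊ with hn
  have hnK : (n : ℝ) ≤ K * x := Nat.floor_le (by positivity)
  have hsub : {ω | ∃ t ≤ n, walk X t ω < -(η * x)} ⊆
      {ω | ∃ i ∈ Finset.Icc 1 n, δ * x < |X (i : ℤ) ω|} ∪
      {ω | ∃ t ≤ n, η * x < ∑ i ∈ Finset.Icc 1 t, (-1) * trunc (δ * x) (X i ω)} := by
    rintro ω ⟨t, ht, hw⟩
    by_cases hbig : ∃ i ∈ Finset.Icc 1 n, δ * x < |X (i : ℤ) ω|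
    · exact Or.inl hbig
    · right
      push Not at hbig
      refine ⟨t, ht, ?_⟩
      rw [← Finset.mul_sum, sum_trunc_eq_walk ht hbig]
      linarith
  refine (measureReal_mono hsub (measure_ne_top _ _)).trans ((measureReal_union_le _ _).trans
    (add_le_add ?_ (hx n hnK)))
  refine (h.measureReal_exists_lt_abs_le n _).trans ?_
  have := (h.tail.pos (δ * x)).le
  rw [← mul_assoc]
  gcongr

end IsHeavyKDependent

section Lower

variable {Ω Ω' : Type*} [MeasurableSpace Ω] [MeasurableSpace Ω'] {P : Measure Ω}
  [IsProbabilityMeasure P] {X : ℤ → Ω → ℝ} {α : ℝ} {Q : Measure Ω'} [IsProbabilityMeasure Q]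
  {Y : ℤ → Ω' → ℝ} {k : ℕ}

/-- Lower bound for the ruin probability. -/
theorem IsTailProcess.eventually_le_ruinProb (h : IsHeavyKDependent P X k α)
    (hY : IsTailProcess P X α Q Y) {ρ : ℝ} (hρ : 0 < ρ) {ε : ℝ} (hε : 0 < ε) :
    ∀ᶠ x in atTop, (clusterConst Q Y k α).toReal * (1 / (α - 1) / ρ) - ε ≤
      ruinProb P X ρ x / (x * absTail P (X 0) x) := by
  have h1 := h.one_lt
  have hα1 : 0 < α - 1 := by linarith
  set J := (clusterConst Q Y k α).toReal with hJ
  have hJfin := hY.clusterConst_lt_top (k := k) h.meas h.stat (by linarith) h.tail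
  obtain ⟨η, hη0, hηJ⟩ : ∃ η : ℝ, 0 < η ∧
      J * (1 / (α - 1) / ρ) - ε / 4 < J * ((1 + 3 * η) ^ (1 - α) / (α - 1) / ρ) := by
    have e1 := (tendsto_mul_rpow_one_add J α ρ 3).eventually
      (lt_mem_nhds (show J * (1 / (α - 1) / ρ) - ε / 4 < J * (1 / (α - 1) / ρ) by linarith))
    have e3 : ∀ᶠ η : ℝ in 𝓝[>] 0, 0 < η := self_mem_nhdsWithin
    obtain ⟨η, ha, hc⟩ := (e1.and e3).exists
    exact ⟨η, hc, ha⟩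
  have hc : 0 < 1 + 3 * η := by linarith
  -- The cap is lifted by monotone convergence before δ and x are chosen, so K may depend on η only.
  obtain ⟨K, hK0, hKI⟩ : ∃ K : ℝ, 0 < K ∧ J * (1 / (α - 1) / ρ) - ε / 4 <
      (clusterIntegral (k := k) Q Y α (excess (1 + 3 * η) ρ K)).toReal := by
    have e1 := (ENNReal.tendsto_toReal
      (ENNReal.mul_lt_top hJfin ENNReal.ofReal_lt_top).ne).comp
      (hY.tendsto_clusterIntegral_excess (k := k) (ρ := ρ) h1 hc)
    rw [ENNReal.toReal_mul, ENNReal.toReal_ofReal (by positivity)] at e1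
    obtain ⟨m, ha, hb⟩ := ((e1.eventually (lt_mem_nhds hηJ)).and (eventually_gt_atTop 0)).exists
    exact ⟨m, by exact_mod_cast hb, ha⟩
  obtain ⟨V, hV, hVx⟩ := hY.exists_tendsto_excess h hc hρ hK0.le two_pos
  obtain ⟨δ, hδ, hδ2, hVδ⟩ : ∃ δ : ℝ, 0 < δ ∧ k * δ ≤ η ∧
      J * (1 / (α - 1) / ρ) - ε / 4 < V δ := by
    have e1 := hV.eventually (lt_mem_nhds hKI)
    have e2 : ∀ᶠ δ : ℝ in 𝓝[>] 0, δ < η / (k + 1) :=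
      mem_nhdsWithin_of_mem_nhds (gt_mem_nhds (by positivity))
    have e3 : ∀ᶠ δ : ℝ in 𝓝[>] 0, 0 < δ := self_mem_nhdsWithin
    obtain ⟨δ, ha, hb, hc⟩ := (e1.and (e2.and e3)).exists
    refine ⟨δ, hc, ?_, ha⟩
    rw [lt_div_iff₀ (by positivity)] at hb
    nlinarith
  set F := absTail P (X 0) with hFdef
  have herr : Tendsto (fun x => F (δ * x) / (x * F x) +
      K * (F (δ * x) / F x) * P.real {ω | ∃ t ≤ ⌊K * x⌋₊, walk X t ω < -(η * x)} +
      (K * x * F (δ * x)) ^ 2 / (x * F x)) atTop (𝓝 0) := by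
    have := ((h.tendsto_absTail_div hδ).add (((h.tail.tendsto δ hδ).const_mul K).mul
      (h.tendsto_measureReal_walk_lt hη0 hK0))).add (h.tendsto_sq_absTail_div hδ K)
    simpa using this
  filter_upwards [herr.eventually (gt_mem_nhds (show (0 : ℝ) < ε / 4 by positivity)),
    (hVx δ hδ).eventually (lt_mem_nhds hVδ), eventually_gt_atTop 0,
    eventually_ge_atTop (ρ * k / η)] with x he hVlt hx hxρ
  have hF : 0 < F x := h.tail.pos x
  have hxF : 0 < x * F x := by positivity
  rw [div_le_iff₀ hη0] at hxρ
  have hb := h.le_ruinProb hρ hδ hδ2 hK0.le hx (by linarith)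
  rw [le_div_iff₀ hxF]
  set p := P.real {ω | ∃ t ≤ ⌊K * x⌋₊, walk X t ω < -(η * x)} with hp
  have i2 : F (δ * x) + K * x * F (δ * x) * p + (K * x * F (δ * x)) ^ 2 ≤ ε / 4 * (x * F x) := by
    have e : K * (F (δ * x) / F x) * p = K * x * F (δ * x) * p / (x * F x) := by
      field_simp
    rw [e, ← add_div, ← add_div, div_lt_iff₀ hxF] at he
    exact he.le
  have i3 : (J * (1 / (α - 1) / ρ) - ε / 4) * (x * F x) ≤
      x * cutoffIntegral P X (excess (k := k) (1 + 3 * η) ρ K) 2 δ x := by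
    rw [lt_div_iff₀ hF] at hVlt
    nlinarith
  nlinarith

end Lower

/-! ### Assembly -/

theorem supPosPow_integral {Ω' : Type*} [MeasurableSpace Ω'] {Q : Measure Ω'} {Y : ℤ → Ω' → ℝ}
    {k : ℕ} (hY : ∀ t, Measurable (Y t)) (α : ℝ) :
    Measurable (supPosPow (k := k) α) ∧
    ∫⁻ θ, ENNReal.ofReal (supPosPow α θ) ∂(tildeLaw Q Y k) =
      (Q (zeroPast Y k))⁻¹ * clusterConst Q Y k α := by
  have hmY := measurable_window_spectralTail hY k
  have hZ : MeasurableSet (zeroPast Y k) := by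
    rw [zeroPast_eq_preimage]; exact hmY (measurableSet_zeroPastWin k)
  have hpm : Measurable (fun ω (j : Fin (k + 1)) => spectralTail Y ((j : ℕ) : ℤ) ω) :=
    measurable_pi_lambda _ fun j => measurable_spectralTail hY _
  have hsm : Measurable (supPosPow (k := k) α) := by
    have hs : Measurable fun θ : Fin (k + 1) → ℝ => ⨆ t : Fin (k + 1), ∑ i ∈ Finset.Iic t, θ i :=
      Measurable.iSup fun t => Finset.measurable_fun_sum _ fun i _ => measurable_pi_apply i
    exact (hs.max measurable_const).pow_const α
  refine ⟨hsm, ?_⟩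
  have hJ : Measurable (fun θ : Win k => ENNReal.ofReal ((max (maxSum θ) 0) ^ α)) :=
    ((continuous_maxSum.measurable.max measurable_const).pow_const α).ennreal_ofReal
  rw [tildeLaw, lintegral_map hsm.ennreal_ofReal hpm, ProbabilityTheory.cond,
    lintegral_smul_measure, clusterConst, spectralLaw,
    setLIntegral_map (measurableSet_zeroPastWin k) hJ hmY, ← zeroPast_eq_preimage]
  rfl

end RuinProb

end

theorem corollary4p6 {Ω Ω' : Type*} [MeasurableSpace Ω] [MeasurableSpace Ω']
    (P : Measure Ω) [IsProbabilityMeasure P] (X : ℤ → Ω → ℝ) (hX : ∀ t, Measurable (X t))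
    (k : ℕ) (α : ℝ) (hα : 1 < α)
    (hstat : RuinProb.IsStrictlyStationary P X)
    (hdep : RuinProb.IsKDependent P X k)
    (hrv : RuinProb.IsRegularlyVarying P X α)
    (hmean : ∫ ω, X 0 ω ∂P = 0)
    (Q : Measure Ω') [IsProbabilityMeasure Q] (Y : ℤ → Ω' → ℝ)
    (hY : RuinProb.IsTailProcess P X α Q Y)
    (ρ : ℝ) (hρ : 0 < ρ) :
    0 < RuinProb.lam Q Y k ∧
    Integrable (RuinProb.supPosPow α) (RuinProb.tildeLaw Q Y k) ∧
    Tendsto (fun x : ℝ => RuinProb.ruinProb P X ρ x / (x * P.real {ω | x < |X 0 ω|})) atTop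
      (𝓝 (RuinProb.lam Q Y k / ((α - 1) * ρ) *
        ∫ θ, RuinProb.supPosPow α θ ∂(RuinProb.tildeLaw Q Y k))) := by

  have hα0 : 0 < α := by linarith
  have htail : RuinProb.RegVar (RuinProb.absTail P (X 0)) α := by
    -- Regular variation is stated for vectors starting at time 1, the tail process is anchored at
    -- time 0.
    rw [← hstat.absTail_eq hX 1]
    exact hrv.regVar_absTail hX
  have h : RuinProb.IsHeavyKDependent P X k α := ⟨hX, hstat, hdep, hα, htail, hmean⟩
  have hlam := hY.lam_pos h
  obtain ⟨hsm, hlin⟩ := RuinProb.supPosPow_integral (k := k) (Q := Q) hY.measurable α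
  have hnn : ∀ θ : Fin (k + 1) → ℝ, 0 ≤ RuinProb.supPosPow α θ := fun θ =>
    Real.rpow_nonneg (le_max_right _ _) _
  have hJfin := hY.clusterConst_lt_top (k := k) hX hstat hα0 htail
  have hQ0 : Q (RuinProb.zeroPast Y k) ≠ 0 := fun h0 => by
    simp [RuinProb.lam, measureReal_def, h0] at hlam
  have hint : Integrable (RuinProb.supPosPow α) (RuinProb.tildeLaw Q Y k) := by
    refine ⟨hsm.aestronglyMeasurable, ?_⟩
    rw [hasFiniteIntegral_iff_ofReal (ae_of_all _ hnn), hlin]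
    exact ENNReal.mul_lt_top (ENNReal.inv_lt_top.2 (pos_iff_ne_zero.2 hQ0)) hJfin
  refine ⟨hlam, hint, ?_⟩
  have hval : ∫ θ, RuinProb.supPosPow α θ ∂(RuinProb.tildeLaw Q Y k) =
      (RuinProb.lam Q Y k)⁻¹ * (RuinProb.clusterConst Q Y k α).toReal := by
    rw [integral_eq_lintegral_of_nonneg_ae (ae_of_all _ hnn) hsm.aestronglyMeasurable, hlin,
      ENNReal.toReal_mul, ENNReal.toReal_inv]
    rfl
  -- The factor λ_k cancels the normalisation of the conditional law, leaving the unconditioned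
  -- constant of the two bounds.
  have hlimit : RuinProb.lam Q Y k / ((α - 1) * ρ) *
      ∫ θ, RuinProb.supPosPow α θ ∂(RuinProb.tildeLaw Q Y k) =
      (RuinProb.clusterConst Q Y k α).toReal * (1 / (α - 1) / ρ) := by
    have : α - 1 ≠ 0 := by linarith
    rw [hval]
    field_simp
  rw [hlimit, Metric.tendsto_nhds]
  intro ε hε
  filter_upwards [hY.eventually_ruinProb_le h hρ (half_pos hε),
    hY.eventually_le_ruinProb h hρ (half_pos hε)] with x h1 h2
  rw [Real.dist_eq, abs_lt]
  unfold RuinProb.absTail at h1 h2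
  constructor <;> linarith
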